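/- A roommates instance is a finite graph $G=(V,E)$ in which every vertex has a strict ranking of its neighbours; being unmatched is worse than every neighbour. For a matching $M$, an edge $(u,v)$ blocks $M$ if $u$ and $v$ prefer each other to their assignments in $M$, and is negative to $M$ if both prefer their assignments in $M$ to each other. A matching $M$ is strongly dominant if $V$ has a partition $(L,R)$ (parts may be empty) such that (i) $M\subseteq L\times R$, (ii) $M$ matches all vertices of $R$, (iii) every blocking edge to $M$ is in $R\times R$, and (iv) every edge in $L\times L$ is negative to $M$. The bidirected instance $G'$ has vertex set $V$ and, for every $(u,v)\in E$, two parallel edges $(u^+,v^-)$ and $(u^-,v^+)$; if the preference list of $u$ in $G$ is $v_1\succ\dots\succ v_k$, its list in $G'$ is $v_1^-\succ\dots\succ v_k^-\succ v_1^+\succ\dots\succ v_k^+$. A matching of $G'$ is a set of its edges with at most one edge incident to each vertex. It is stable if for every edge $(u^+,v^-)$ outside it, $u$ is matched to something it ranks better than $v^-$ or $v$ is matched to something it ranks better than $u^+$. Its projection is the set of edges $(u,v)\in E$ such that $(u^+,v^-)$ or $(u^-,v^+)$ belongs to it. **Theorem.** (a) For every roommates instance $G$, the projection of every stable matching of $G'$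 is a strongly dominant matching of $G$, and every strongly dominant matching of $G$ is the projection of some stable matching of $G'$. In particular, $G$ admits a strongly dominant matching if and only if $G'$ admits a stable matching. (b) There is a linear-time algorithm that, given a roommates instance $G$ by its preference lists, decides whether $G$ admits a strongly dominant matching and returns one if it exists. Precisely, there are a random access machine program (operations: constants, copying, addition, truncated subtraction, comparison, indirect load and store, each of unit cost) and a constant $c$ such that on every instance with $n$ vertices and $m$ edges the program halts after at most $c(n+m+1)$ steps with the correct answer, and all numbers it computes or stores are at most $c(n+m+1)$. -/

import Mathlib

/-! ### Roommates instances with strict preference lists -/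

/-- A roommates instance: a graph in which every vertex has a strict ranking of its neighbours,
given as a list without repetitions, best neighbour first. -/
structure Roommates (V : Type*) where
  graph : SimpleGraph V
  pref : V → List V
  nodup_pref : ∀ u, (pref u).Nodup
  mem_pref : ∀ u v, v ∈ pref u ↔ graph.Adj u v

/-- `x` stands strictly before `y` in the list `l`. -/
def ListedBefore {α : Type*} (l : List α) (x y : α) : Prop :=
  ∃ i j : ℕ, i < j ∧ l[i]? = some x ∧ l[j]? = some y

namespace Roommates

variable {V : Type*} (G : Roommates V)

/-- The vertex `u` ranks its neighbour `v` better than its neighbour `w`. -/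
def Prefers (u v w : V) : Prop := ListedBefore (G.pref u) v w

/-- The edge `uv` blocks `M`: each endpoint prefers the other one to its assignment in `M`
(being unmatched is worse than every neighbour, so an unmatched vertex always does). -/
def Blocks (M : G.graph.Subgraph) (u v : V) : Prop :=
  G.graph.Adj u v ∧ (∀ w, M.Adj u w → G.Prefers u v w) ∧ (∀ w, M.Adj v w → G.Prefers v u w)

/-- The edge `uv` is negative to `M`: each endpoint prefers its assignment in `M` to the other
endpoint. -/
def Negative (M : G.graph.Subgraph) (u v : V) : Prop :=
  G.graph.Adj u v ∧ (∃ w, M.Adj u w ∧ G.Prefers u w v) ∧ (∃ w, M.Adj v w ∧ G.Prefers v w u)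

/-- `M` is a strongly dominant matching: a matching with a partition `(L, R)` of the vertex set
(parts may be empty) such that every edge of `M` joins `L` and `R`, all vertices of `R` are matched,
every blocking edge lies in `R × R`, and every edge in `L × L` is negative. -/
def StronglyDominant (M : G.graph.Subgraph) : Prop :=
  M.IsMatching ∧ ∃ L R : Set V, IsCompl L R ∧
    (∀ u v, M.Adj u v → (u ∈ L ∧ v ∈ R) ∨ (u ∈ R ∧ v ∈ L)) ∧
    (∀ u ∈ R, u ∈ M.verts) ∧
    (∀ u v, G.Blocks M u v → u ∈ R ∧ v ∈ R) ∧
    (∀ u ∈ L, ∀ v ∈ L, G.graph.Adj u v → G.Negative M u v)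

/-! ### The bidirected instance -/

/-- The two forms in which a vertex appears to its neighbours. -/
inductive Form
  | plus
  | minus

/-- The preference list of `u` in the bidirected instance: all neighbours in minus form, in the
original order, followed by all neighbours in plus form, in the original order. -/
def biPref (u : V) : List (V × Form) :=
  (G.pref u).map (fun v => (v, Form.minus)) ++ (G.pref u).map (fun v => (v, Form.plus))

/-- The edges of the bidirected instance. Every edge `uv` of the graph gives two parallel edges
between `u` and `v`, namely `(u⁺, v⁻)` and `(u⁻, v⁺) = (v⁺, u⁻)`; the dart from `u` to `v` stands for
`(u⁺, v⁻)`, so that its first endpoint sees the second one in minus form and its second endpoint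
sees the first one in plus form. -/
abbrev BiEdge : Type _ := G.graph.Dart

/-- A matching of the bidirected instance: every vertex has at most one incident edge. -/
def BiMatching (M' : Set G.BiEdge) : Prop :=
  ∀ u : V, ∀ e ∈ M', ∀ f ∈ M', (e.fst = u ∨ e.snd = u) → (f.fst = u ∨ f.snd = u) → e = f

/-- The edge set `M'` matches `u` to the neighbour-in-a-form `x`. -/
def BiMatched (M' : Set G.BiEdge) (u : V) (x : V × Form) : Prop :=
  ∃ e ∈ M', (e.fst = u ∧ x = (e.snd, Form.minus)) ∨ (e.snd = u ∧ x = (e.fst, Form.plus))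

/-- A stable matching of the bidirected instance: for every edge `(u⁺, v⁻)` outside `M'`, either `u`
is matched to something that it ranks better than `v⁻`, or `v` is matched to something that it ranks
better than `u⁺`. -/
def BiStable (M' : Set G.BiEdge) : Prop :=
  G.BiMatching M' ∧ ∀ e : G.BiEdge, e ∉ M' →
    (∃ x, G.BiMatched M' e.fst x ∧ ListedBefore (G.biPref e.fst) x (e.snd, Form.minus)) ∨
    (∃ x, G.BiMatched M' e.snd x ∧ ListedBefore (G.biPref e.snd) x (e.fst, Form.plus))

/-- The projection of a set of edges of the bidirected instance: the edges `uv` of the graph such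
that `(u⁺, v⁻)` or `(u⁻, v⁺)` belongs to the set (with exactly their endpoints as vertices). -/
def projection (M' : Set G.BiEdge) : G.graph.Subgraph where
  verts := {u | ∃ e ∈ M', e.fst = u ∨ e.snd = u}
  Adj u v := ∃ e ∈ M', (e.fst = u ∧ e.snd = v) ∨ (e.fst = v ∧ e.snd = u)
  adj_sub := by
    rintro u v ⟨e, -, ⟨rfl, rfl⟩ | ⟨rfl, rfl⟩⟩
    · exact e.adj
    · exact e.adj.symm
  edge_vert := by
    rintro u v ⟨e, he, ⟨h, -⟩ | ⟨-, h⟩⟩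
    · exact ⟨e, he, Or.inl h⟩
    · exact ⟨e, he, Or.inr h⟩
  symm := ⟨by
    rintro u v ⟨e, he, h | h⟩
    · exact ⟨e, he, Or.inr h⟩
    · exact ⟨e, he, Or.inl h⟩⟩

/-! ### Input and output words -/

/-- An instance on the vertices `0, …, n - 1` as a sequence of `1 + n + 2 m` numbers: the number `n`
of vertices and then, for every vertex in turn, the length of its preference list followed by the
list. -/
def encode {n : ℕ} (G : Roommates (Fin n)) : List ℕ :=
  n :: (List.finRange n).flatMap (fun u => (G.pref u).length :: (G.pref u).map Fin.val)

/-- The sequence `out` describes `M`: entry `u` is `v + 1` if `u` is matched to `v`, and `0` if `u` is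
unmatched. -/
def Describes {n : ℕ} (G : Roommates (Fin n)) (out : ℕ → ℕ) (M : G.graph.Subgraph) : Prop :=
  ∀ u : Fin n, (∀ v : Fin n, M.Adj u v → out u = v + 1) ∧ (u ∉ M.verts → out u = 0)

end Roommates

/-! ### A random access machine with step count -/

namespace RAM

/-- A memory state: registers, addressed by constants of the program, and random access memory,
organized in banks. The bank is a constant of the program and the cell in it is addressed by the
contents of a register. A program mentions finitely many registers and banks. -/
structure State where
  reg : ℕ → ℕ
  mem : ℕ → ℕ → ℕ

/-- Store the value `k` in register `x`. -/
def State.setReg (s : State) (x k : ℕ) : State :=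
  { s with reg := Function.update s.reg x k }

/-- Store the value `k` in cell `i` of bank `b`. -/
def State.setMem (s : State) (b i k : ℕ) : State :=
  { s with mem := Function.update s.mem b (Function.update (s.mem b) i k) }

/-- Comparisons of two registers. -/
inductive Test
  | lt (x y : ℕ)
  | eq (x y : ℕ)

/-- The comparison holds in the given state. -/
def Test.Holds (s : State) : Test → Prop
  | .lt x y => s.reg x < s.reg y
  | .eq x y => s.reg x = s.reg y

/-- Programs, that is, elementary instructions under sequencing, branching and while-loops. -/
inductive Prog
  /-- do nothing -/
  | skip
  /-- `reg x := k` -/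
  | const (x k : ℕ)
  /-- `reg x := reg y` -/
  | move (x y : ℕ)
  /-- `reg x := reg y + reg z` -/
  | add (x y z : ℕ)
  /-- `reg x := reg y - reg z`, truncated at zero -/
  | sub (x y z : ℕ)
  /-- `reg x := mem b (reg y)` -/
  | load (x b y : ℕ)
  /-- `mem b (reg y) := reg x` -/
  | store (b y x : ℕ)
  /-- first `p`, then `q` -/
  | seq (p q : Prog)
  /-- `p` if the comparison holds, else `q` -/
  | ite (c : Test) (p q : Prog)
  /-- repeat `p` as long as the comparison holds -/
  | loop (c : Test) (p : Prog)

/-- `Exec W p s t s'`: on a machine whose words hold the numbers `0, …, W`, the program `p`, started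
in state `s`, halts after exactly `t` steps in state `s'`. Every elementary instruction and every
evaluation of a comparison is one step. An instruction whose result exceeds `W` cannot be executed. -/
inductive Exec (W : ℕ) : Prog → State → ℕ → State → Prop
  | skip (s : State) : Exec W .skip s 1 s
  | const (s : State) (x k : ℕ) (h : k ≤ W) :
      Exec W (.const x k) s 1 (s.setReg x k)
  | move (s : State) (x y : ℕ) (h : s.reg y ≤ W) :
      Exec W (.move x y) s 1 (s.setReg x (s.reg y))
  | add (s : State) (x y z : ℕ) (h : s.reg y + s.reg z ≤ W) :
      Exec W (.add x y z) s 1 (s.setReg x (s.reg y + s.reg z))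
  | sub (s : State) (x y z : ℕ) (h : s.reg y - s.reg z ≤ W) :
      Exec W (.sub x y z) s 1 (s.setReg x (s.reg y - s.reg z))
  | load (s : State) (x b y : ℕ) (h : s.mem b (s.reg y) ≤ W) :
      Exec W (.load x b y) s 1 (s.setReg x (s.mem b (s.reg y)))
  | store (s : State) (b y x : ℕ) (h : s.reg x ≤ W) :
      Exec W (.store b y x) s 1 (s.setMem b (s.reg y) (s.reg x))
  | seq (p q : Prog) (s₁ s₂ s₃ : State) (t₁ t₂ : ℕ) (h₁ : Exec W p s₁ t₁ s₂)
      (h₂ : Exec W q s₂ t₂ s₃) : Exec W (.seq p q) s₁ (t₁ + t₂) s₃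
  | ite_true (c : Test) (p q : Prog) (s s' : State) (t : ℕ) (hc : c.Holds s)
      (h : Exec W p s t s') : Exec W (.ite c p q) s (1 + t) s'
  | ite_false (c : Test) (p q : Prog) (s s' : State) (t : ℕ) (hc : ¬ c.Holds s)
      (h : Exec W q s t s') : Exec W (.ite c p q) s (1 + t) s'
  | loop_true (c : Test) (p : Prog) (s₁ s₂ s₃ : State) (t₁ t₂ : ℕ) (hc : c.Holds s₁)
      (h₁ : Exec W p s₁ t₁ s₂) (h₂ : Exec W (.loop c p) s₂ t₂ s₃) :
      Exec W (.loop c p) s₁ (1 + t₁ + t₂) s₃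
  | loop_false (c : Test) (p : Prog) (s : State) (hc : ¬ c.Holds s) :
      Exec W (.loop c p) s 1 s

/-- Execution is deterministic, and the word size only decides whether it is possible. -/
theorem Exec.det {W W' : ℕ} {p : Prog} {s s₁ s₂ : State} {t₁ t₂ : ℕ}
    (h₁ : Exec W p s t₁ s₁) (h₂ : Exec W' p s t₂ s₂) : t₁ = t₂ ∧ s₁ = s₂ := by
  induction h₁ generalizing t₂ s₂ with
  | seq p q a b c u v _ _ ih1 ih2 =>
    cases h₂ with
    | seq _ _ _ b' _ u' v' k1 k2 =>
      obtain ⟨rfl, rfl⟩ := ih1 k1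
      obtain ⟨rfl, rfl⟩ := ih2 k2
      simp
  | ite_true c p q a b t hc _ ih => cases h₂ with
    | ite_true _ _ _ _ _ _ _ k => obtain ⟨rfl, rfl⟩ := ih k; simp
    | ite_false _ _ _ _ _ _ hc' _ => exact absurd hc hc'
  | ite_false c p q a b t hc _ ih => cases h₂ with
    | ite_false _ _ _ _ _ _ _ k => obtain ⟨rfl, rfl⟩ := ih k; simp
    | ite_true _ _ _ _ _ _ hc' _ => exact absurd hc' hc
  | loop_true c p a b d u v hc _ _ ih1 ih2 => cases h₂ with
    | loop_true _ _ _ _ _ _ _ _ k1 k2 =>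
      obtain ⟨rfl, rfl⟩ := ih1 k1
      obtain ⟨rfl, rfl⟩ := ih2 k2
      simp
    | loop_false _ _ _ hc' => exact absurd hc hc'
  | loop_false c p a hc => cases h₂ with
    | loop_true _ _ _ _ _ _ _ hc' _ _ => exact absurd hc' hc
    | loop_false _ _ _ hc' => simp
  | _ => cases h₂; simp

/-- The initial state: the input word occupies bank `0`, everything else is zero. -/
def init (w : List ℕ) : State where
  reg := fun _ => 0
  mem := fun b i => if b = 0 then w.getD i 0 else 0

/-- The contents of bank `1`, which holds the output. -/
def State.output (s : State) : ℕ → ℕ := s.mem 1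

end RAM

/-! In `G'` every vertex ranks all minus forms above all plus forms. Given a stable matching of
`G'`, let `R` be the set of vertices matched to a minus form, that is, the first endpoints of its
darts, and let `L` be the rest. If `u ∈ L`, then `u` cannot protect against `(u⁺, v⁻)`, so `v` must:
either `v ∈ R`, or `v` has a partner that it prefers to `u`. For `u, v ∈ L` this is negativity. For
a blocking edge with `u ∈ L` it forces `v ∈ R`, and then nobody protects against the parallel edge
`(v⁺, u⁻)`. Conversely, orienting a strongly dominant matching from `R` to `L` gives a stable
matching of `G'`.

For (b), `G'` is a stable roommates instance with parallel edges, and Irving's algorithm solves it.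
Every list is closed by a loop that stands for being unmatched, so a stable matching assigns a
half-edge to every vertex. The table of surviving half-edges is never stored: it consists of the
half-edges that neither end ranks below its cutoff `b`. A proposal lowers a cutoff without excluding
any stable matching (`Proposing.accept`). When all proposals are settled and no list is empty, the
first half-edge of each vertex is the cutoff at its other end. If all lists have length one, the
cutoffs are a stable matching (`Reduced.stable_cutoff`). Otherwise the walk through second choices
closes a rotation. A stable matching within the cutoffs gives all or none of its members their first
choices (`Reduced.rotation_all_or_none`), and in the first case all of them can move to their second
choices (`Reduced.exists_stable_second`). So eliminating the rotation keeps some stable matching if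
there was one, and an emptied list proves that there is none.

The time is linear because cutoffs only fall, pointers only rise, and the part of the walk below an
eliminated rotation remains valid (`IsPath.eliminate`), so a potential pays for all steps. What
remains is to find the twin of each half-edge. Entries are grouped by neighbour into linked lists,
and one array holds the positions in the list of the current vertex. -/

/-! ### Order in preference lists and in the bidirected lists. -/

theorem ListedBefore.irrefl {α : Type*} {l : List α} (hl : l.Nodup) {x : α} :
    ¬ ListedBefore l x x := by
  rintro ⟨i, j, hij, hi, hj⟩
  have := (List.getElem?_inj (List.getElem?_eq_some_iff.1 hi).1 hl).1 (hi.trans hj.symm)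
  omega

theorem ListedBefore.asymm {α : Type*} {l : List α} (hl : l.Nodup) {x y : α}
    (h : ListedBefore l x y) : ¬ ListedBefore l y x := by
  rintro ⟨i, j, hij, hi, hj⟩
  obtain ⟨i', j', hij', hi', hj'⟩ := h
  have h1 := (List.getElem?_inj (List.getElem?_eq_some_iff.1 hi).1 hl).1 (hi.trans hj'.symm)
  have h2 := (List.getElem?_inj (List.getElem?_eq_some_iff.1 hj).1 hl).1 (hj.trans hi'.symm)
  omega

theorem ListedBefore.total {α : Type*} {l : List α} {x y : α} (hx : x ∈ l) (hy : y ∈ l)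
    (hne : x ≠ y) : ListedBefore l x y ∨ ListedBefore l y x := by
  obtain ⟨i, hi⟩ := List.mem_iff_getElem?.1 hx
  obtain ⟨j, hj⟩ := List.mem_iff_getElem?.1 hy
  rcases lt_trichotomy i j with h | h | h
  · exact Or.inl ⟨i, j, h, hi, hj⟩
  · subst h
    rw [hi] at hj
    exact absurd (Option.some.inj hj) hne
  · exact Or.inr ⟨j, i, h, hj, hi⟩

namespace Roommates

variable {V : Type*} (G : Roommates V)

theorem biPref_getElem?_minus (u : V) {k : ℕ} (hk : k < (G.pref u).length) :
    (G.biPref u)[k]? = some ((G.pref u)[k], Form.minus) := by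
  rw [biPref, List.getElem?_append_left (by simpa using hk)]
  simp [hk]

theorem biPref_getElem?_plus (u : V) {k : ℕ} (hk : k < (G.pref u).length) :
    (G.biPref u)[(G.pref u).length + k]? = some ((G.pref u)[k], Form.plus) := by
  rw [biPref, List.getElem?_append_right (by simp)]
  simp [hk]

theorem nodup_biPref (u : V) : (G.biPref u).Nodup := by
  rw [biPref, List.nodup_append]
  refine ⟨(G.nodup_pref u).map fun a b h => (Prod.mk.inj h).1,
    (G.nodup_pref u).map fun a b h => (Prod.mk.inj h).1, ?_⟩
  intro x hx y hy hxy
  simp only [List.mem_map] at hx hy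
  obtain ⟨v, -, rfl⟩ := hx
  obtain ⟨w, -, rfl⟩ := hy
  simp at hxy

theorem listedBefore_minus_minus {u v w : V} (h : G.Prefers u v w) :
    ListedBefore (G.biPref u) (v, Form.minus) (w, Form.minus) := by
  obtain ⟨i, j, hij, hi, hj⟩ := h
  obtain ⟨hi', rfl⟩ := List.getElem?_eq_some_iff.1 hi
  obtain ⟨hj', rfl⟩ := List.getElem?_eq_some_iff.1 hj
  exact ⟨i, j, hij, G.biPref_getElem?_minus u hi', G.biPref_getElem?_minus u hj'⟩

theorem listedBefore_plus_plus {u v w : V} (h : G.Prefers u v w) :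
    ListedBefore (G.biPref u) (v, Form.plus) (w, Form.plus) := by
  obtain ⟨i, j, hij, hi, hj⟩ := h
  obtain ⟨hi', rfl⟩ := List.getElem?_eq_some_iff.1 hi
  obtain ⟨hj', rfl⟩ := List.getElem?_eq_some_iff.1 hj
  exact ⟨_, _, Nat.add_lt_add_left hij _, G.biPref_getElem?_plus u hi',
    G.biPref_getElem?_plus u hj'⟩

theorem listedBefore_minus_plus {u v w : V} (hv : G.graph.Adj u v) (hw : G.graph.Adj u w) :
    ListedBefore (G.biPref u) (v, Form.minus) (w, Form.plus) := by
  obtain ⟨i, hi⟩ := List.mem_iff_getElem?.1 ((G.mem_pref u v).2 hv)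
  obtain ⟨j, hj⟩ := List.mem_iff_getElem?.1 ((G.mem_pref u w).2 hw)
  obtain ⟨hi', rfl⟩ := List.getElem?_eq_some_iff.1 hi
  obtain ⟨hj', rfl⟩ := List.getElem?_eq_some_iff.1 hj
  exact ⟨i, _, by omega, G.biPref_getElem?_minus u hi', G.biPref_getElem?_plus u hj'⟩

theorem prefers_of_listedBefore_minus {u v w : V} (hv : G.graph.Adj u v) (hw : G.graph.Adj u w)
    (h : ListedBefore (G.biPref u) (v, Form.minus) (w, Form.minus)) : G.Prefers u v w := by
  have hne : v ≠ w := by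
    rintro rfl
    exact ListedBefore.irrefl (G.nodup_biPref u) h
  rcases ListedBefore.total ((G.mem_pref u v).2 hv) ((G.mem_pref u w).2 hw) hne with h' | h'
  · exact h'
  · exact absurd (G.listedBefore_minus_minus h') (ListedBefore.asymm (G.nodup_biPref u) h)

theorem prefers_of_listedBefore_plus {u v w : V} (hv : G.graph.Adj u v) (hw : G.graph.Adj u w)
    (h : ListedBefore (G.biPref u) (v, Form.plus) (w, Form.plus)) : G.Prefers u v w := by
  have hne : v ≠ w := by
    rintro rfl
    exact ListedBefore.irrefl (G.nodup_biPref u) h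
  rcases ListedBefore.total ((G.mem_pref u v).2 hv) ((G.mem_pref u w).2 hw) hne with h' | h'
  · exact h'
  · exact absurd (G.listedBefore_plus_plus h') (ListedBefore.asymm (G.nodup_biPref u) h)

theorem not_listedBefore_plus_minus {u v w : V} (hv : G.graph.Adj u v) (hw : G.graph.Adj u w) :
    ¬ ListedBefore (G.biPref u) (v, Form.plus) (w, Form.minus) :=
  ListedBefore.asymm (G.nodup_biPref u) (G.listedBefore_minus_plus hw hv)

theorem Prefers.not_rev {G : Roommates V} {u v w : V} (h : G.Prefers u v w) : ¬ G.Prefers u w v :=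
  ListedBefore.asymm (G.nodup_pref u) h

/-! ### Stable matchings of the bidirected instance and strongly dominant matchings. -/

/-- `R` consists of the first endpoints of matching darts. By `key`, a vertex outside `R` leaves the
protection against its outgoing darts to the other endpoint, since no partner it may have is ranked
above a minus form. -/
theorem stronglyDominant_projection {M' : Set G.BiEdge} (hM : G.BiStable M') :
    G.StronglyDominant (G.projection M') := by
  obtain ⟨hmat, hst⟩ := hM
  -- the first endpoint of a matching edge is matched to a minus form, the second to a plus form
  have key : ∀ e : G.BiEdge, (∀ f ∈ M', f.fst ≠ e.fst) →
      ∃ f ∈ M', (f.fst = e.snd) ∨ (f.snd = e.snd ∧ G.Prefers e.snd f.fst e.fst) := by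
    intro e he
    rcases hst e (fun h => he e h rfl) with ⟨x, ⟨f, hf, ⟨h1, rfl⟩ | ⟨h1, rfl⟩⟩, hx⟩ |
      ⟨x, ⟨f, hf, ⟨h1, rfl⟩ | ⟨h1, rfl⟩⟩, hx⟩
    · exact absurd h1 (he f hf)
    · exact absurd hx (G.not_listedBefore_plus_minus (h1 ▸ f.adj.symm) e.adj)
    · exact ⟨f, hf, Or.inl h1⟩
    · exact ⟨f, hf, Or.inr ⟨h1, G.prefers_of_listedBefore_plus (h1 ▸ f.adj.symm) e.adj.symm hx⟩⟩
  have ne2 : ∀ e ∈ M', ∀ f ∈ M', e.fst ≠ f.snd := by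
    intro e he f hf h
    have := hmat e.fst e he f hf (Or.inl rfl) (Or.inr h.symm)
    subst this
    exact e.adj.ne h
  refine ⟨?_, {u | ∀ f ∈ M', f.fst ≠ u}, {u | ∃ f ∈ M', f.fst = u}, ?_, ?_, ?_, ?_, ?_⟩
  · rintro u ⟨e, he, hu⟩
    have huniq : ∀ f ∈ M', (f.fst = u ∨ f.snd = u) → e = f := fun f hf h => hmat u e he f hf hu h
    rcases hu with rfl | rfl
    · refine ⟨e.snd, ⟨e, he, Or.inl ⟨rfl, rfl⟩⟩, ?_⟩
      rintro w ⟨f, hf, ⟨h1, rfl⟩ | ⟨rfl, h2⟩⟩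
      · rw [huniq f hf (Or.inl h1)]
      · exact absurd h2.symm (ne2 e he f hf)
    · refine ⟨e.fst, ⟨e, he, Or.inr ⟨rfl, rfl⟩⟩, ?_⟩
      rintro w ⟨f, hf, ⟨h1, rfl⟩ | ⟨rfl, h2⟩⟩
      · exact absurd h1 (ne2 f hf e he)
      · rw [huniq f hf (Or.inr h2)]
  · have : {u | ∀ f ∈ M', f.fst ≠ u} = {u | ∃ f ∈ M', f.fst = u}ᶜ := by
      ext u
      simp
    rw [this]
    exact isCompl_compl.symm
  · rintro u v ⟨e, he, ⟨rfl, rfl⟩ | ⟨rfl, rfl⟩⟩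
    · exact Or.inr ⟨⟨e, he, rfl⟩, fun f hf => ne2 f hf e he⟩
    · exact Or.inl ⟨fun f hf => ne2 f hf e he, ⟨e, he, rfl⟩⟩
  · rintro u ⟨e, he, rfl⟩
    exact ⟨e, he, Or.inl rfl⟩
  · have aux : ∀ u v, G.Blocks (G.projection M') u v → ∃ f ∈ M', f.fst = u := by
      rintro u v ⟨huv, h1, h2⟩
      by_contra! hu
      obtain ⟨f, hf, hfv | ⟨hfv, hp⟩⟩ := key ⟨(u, v), huv⟩ hu
      · simp only at hfv
        -- Here `v ∈ R`, so the dart from `u` to `v` gives no contradiction; the parallel dart from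
        -- `v` to `u` does. It is not matched, since `v` would strictly prefer `u` to `u`, and any
        -- protection against it contradicts blocking at `v` or at `u`.
        rcases hst ⟨(v, u), huv.symm⟩ (fun h => by
            have := hmat v f hf _ h (Or.inl hfv) (Or.inl rfl)
            subst this
            exact Prefers.not_rev (h2 u ⟨_, hf, Or.inl ⟨rfl, rfl⟩⟩)
              (h2 u ⟨_, hf, Or.inl ⟨rfl, rfl⟩⟩)) with ⟨x, ⟨g, hg, ⟨h3, rfl⟩ | ⟨h3, rfl⟩⟩, hx⟩ |
          ⟨x, ⟨g, hg, ⟨h3, rfl⟩ | ⟨h3, rfl⟩⟩, hx⟩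
        · simp only at h3
          have := h2 g.snd ⟨g, hg, Or.inl ⟨h3, rfl⟩⟩
          exact Prefers.not_rev this
            (G.prefers_of_listedBefore_minus (h3 ▸ g.adj) huv.symm hx)
        · exact ne2 f hf g hg (hfv.trans h3.symm)
        · exact hu g hg h3
        · simp only at h3
          have := h1 g.fst ⟨g, hg, Or.inr ⟨rfl, h3⟩⟩
          exact Prefers.not_rev this
            (G.prefers_of_listedBefore_plus (h3 ▸ g.adj.symm) huv hx)
      · exact Prefers.not_rev hp (h2 f.fst ⟨f, hf, Or.inr ⟨rfl, hfv⟩⟩)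
    rintro u v h
    exact ⟨aux u v h, aux v u ⟨h.1.symm, h.2.2, h.2.1⟩⟩
  · have aux : ∀ u, (∀ f ∈ M', f.fst ≠ u) → ∀ v, (∀ f ∈ M', f.fst ≠ v) → G.graph.Adj u v →
        ∃ w, (G.projection M').Adj v w ∧ G.Prefers v w u := by
      intro u hu v hv huv
      obtain ⟨f, hf, hfv | ⟨hfv, hp⟩⟩ := key ⟨(u, v), huv⟩ hu
      · exact absurd hfv (hv f hf)
      · exact ⟨f.fst, ⟨f, hf, Or.inr ⟨rfl, hfv⟩⟩, hp⟩
    intro u hu v hv huv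
    exact ⟨huv, aux v hv u hu huv.symm, aux u hu v hv huv⟩

/-- Orient each matching edge from `R` to `L`. An unmatched dart into `R` is dominated because its
head holds a minus form, one inside `L` by negativity, and one from `R` to `L` because its edge does
not block. -/
theorem exists_biStable_of_stronglyDominant {M : G.graph.Subgraph} (hM : G.StronglyDominant M) :
    ∃ M' : Set G.BiEdge, G.BiStable M' ∧ G.projection M' = M := by
  obtain ⟨hmat, L, R, hLR, hedge, hR, hblock, hneg⟩ := hM
  have disj : ∀ u, u ∈ L → u ∈ R → False := fun u h1 h2 => Set.disjoint_left.1 hLR.disjoint h1 h2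
  have cov : ∀ u, u ∈ L ∨ u ∈ R := fun u => by
    have h : u ∈ L ⊔ R := hLR.sup_eq_top ▸ Set.mem_univ u
    exact h
  have uniq : ∀ {u v w}, M.Adj u v → M.Adj u w → v = w := fun {u v w} h1 h2 =>
    (hmat (M.edge_vert h1)).unique h1 h2
  refine ⟨{e | e.fst ∈ R ∧ M.Adj e.fst e.snd}, ⟨?_, ?_⟩, ?_⟩
  · have hL : ∀ e : G.BiEdge, e.fst ∈ R → M.Adj e.fst e.snd → e.snd ∈ L := fun e h1 h2 => by
      rcases hedge _ _ h2 with h | h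
      · exact absurd h1 (disj _ h.1)
      · exact h.2
    rintro u e ⟨he1, he2⟩ f ⟨hf1, hf2⟩ heu hfu
    have heL := hL e he1 he2
    have hfL := hL f hf1 hf2
    rcases heu with rfl | rfl <;> rcases hfu with h | h
    · refine SimpleGraph.Dart.ext _ _ (Prod.ext h.symm ?_)
      exact uniq he2 (h ▸ hf2)
    · exact absurd he1 (disj _ (h ▸ hfL))
    · exact absurd hf1 (disj _ (h ▸ heL))
    · refine SimpleGraph.Dart.ext _ _ (Prod.ext ?_ h.symm)
      exact uniq he2.symm (h ▸ hf2.symm)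
  · have matchR : ∀ v w, v ∈ R → M.Adj v w →
        G.BiMatched {e | e.fst ∈ R ∧ M.Adj e.fst e.snd} v (w, Form.minus) := fun v w hv hw =>
      ⟨⟨(v, w), M.adj_sub hw⟩, ⟨hv, hw⟩, Or.inl ⟨rfl, rfl⟩⟩
    have matchL : ∀ v w, v ∈ L → M.Adj v w →
        G.BiMatched {e | e.fst ∈ R ∧ M.Adj e.fst e.snd} v (w, Form.plus) := fun v w hv hw =>
      ⟨⟨(w, v), M.adj_sub hw.symm⟩, ⟨by
        rcases hedge _ _ hw with h | h
        · exact h.2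
        · exact absurd h.1 (disj _ hv), hw.symm⟩, Or.inr ⟨rfl, rfl⟩⟩
    rintro ⟨⟨u, v⟩, huv⟩ he
    simp only [Set.mem_ofPred_eq, not_and] at he huv ⊢
    rcases cov v with hv | hv
    · rcases cov u with hu | hu
      · obtain ⟨-, -, w, hw, hp⟩ := hneg u hu v hv huv
        exact Or.inr ⟨_, matchL v w hv hw, G.listedBefore_plus_plus hp⟩
      · have hnm := he hu
        have hnb : ¬ G.Blocks M u v := fun h => disj v hv (hblock u v h).2
        simp only [Blocks, not_and_or, not_forall] at hnb
        rcases hnb with h | ⟨w, hw, h⟩ | ⟨w, hw, h⟩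
        · exact absurd huv h
        · refine Or.inl ⟨_, matchR u w hu hw, G.listedBefore_minus_minus ?_⟩
          refine (ListedBefore.total ((G.mem_pref u w).2 (M.adj_sub hw)) ((G.mem_pref u v).2 huv)
            ?_).resolve_right h
          rintro rfl
          exact hnm hw
        · refine Or.inr ⟨_, matchL v w hv hw, G.listedBefore_plus_plus ?_⟩
          refine (ListedBefore.total ((G.mem_pref v w).2 (M.adj_sub hw))
            ((G.mem_pref v u).2 huv.symm) ?_).resolve_right h
          rintro rfl
          exact hnm hw.symm
    · obtain ⟨w, hw, -⟩ := hmat (hR v hv)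
      exact Or.inr ⟨_, matchR v w hv hw, G.listedBefore_minus_plus (M.adj_sub hw) huv.symm⟩
  · have hadj : ∀ u v, (G.projection {e | e.fst ∈ R ∧ M.Adj e.fst e.snd}).Adj u v ↔ M.Adj u v := by
      intro u v
      constructor
      · rintro ⟨e, ⟨-, he⟩, ⟨rfl, rfl⟩ | ⟨rfl, rfl⟩⟩
        · exact he
        · exact he.symm
      · intro h
        rcases hedge _ _ h with ⟨h1, h2⟩ | ⟨h1, h2⟩
        · exact ⟨⟨(v, u), M.adj_sub h.symm⟩, ⟨h2, h.symm⟩, Or.inr ⟨rfl, rfl⟩⟩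
        · exact ⟨⟨(u, v), M.adj_sub h⟩, ⟨h1, h⟩, Or.inl ⟨rfl, rfl⟩⟩
    refine SimpleGraph.Subgraph.ext ?_ (funext₂ fun u v => propext (hadj u v))
    ext u
    constructor
    · rintro ⟨e, ⟨-, he⟩, rfl | rfl⟩
      · exact M.edge_vert he
      · exact M.edge_vert he.symm
    · intro hu
      obtain ⟨w, hw, -⟩ := hmat hu
      exact (G.projection _).edge_vert ((hadj u w).2 hw)

end Roommates

/-! ### Verification conditions for the random access machine. -/

namespace RAM

/-- All registers and all memory cells hold numbers up to `W`. -/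
def State.Bounded (W : ℕ) (s : State) : Prop :=
  (∀ x, s.reg x ≤ W) ∧ ∀ b i, s.mem b i ≤ W

theorem State.Bounded.setReg {W : ℕ} {s : State} (h : s.Bounded W) (x : ℕ) {k : ℕ} (hk : k ≤ W) :
    (s.setReg x k).Bounded W := by
  refine ⟨fun y => ?_, h.2⟩
  simp only [State.setReg, Function.update_apply]
  split_ifs
  · exact hk
  · exact h.1 y

theorem State.Bounded.setMem {W : ℕ} {s : State} (h : s.Bounded W) (b i : ℕ) {k : ℕ}
    (hk : k ≤ W) : (s.setMem b i k).Bounded W := by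
  refine ⟨h.1, fun b' i' => ?_⟩
  simp only [State.setMem, Function.update_apply]
  split_ifs with hb
  · simp only [Function.update_apply]
    split_ifs
    · exact hk
    · exact h.2 _ _
  · exact h.2 _ _

@[simp] theorem State.reg_setReg (s : State) (x k y : ℕ) :
    (s.setReg x k).reg y = if y = x then k else s.reg y := by
  simp [State.setReg, Function.update_apply]

@[simp] theorem State.mem_setReg (s : State) (x k : ℕ) : (s.setReg x k).mem = s.mem := rfl

@[simp] theorem State.reg_setMem (s : State) (b i k : ℕ) : (s.setMem b i k).reg = s.reg := rfl

@[simp] theorem State.mem_setMem (s : State) (b i k b' : ℕ) :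
    (s.setMem b i k).mem b' = if b' = b then Function.update (s.mem b) i k else s.mem b' := by
  simp [State.setMem, Function.update_apply]

/-- Weakest precondition: started at time `t` in the state `s`, which must hold numbers up to `W`
only, the program `p` halts at a time and in a state satisfying `Q`. -/
def WP (W : ℕ) (p : Prog) (Q : ℕ → State → Prop) (t : ℕ) (s : State) : Prop :=
  s.Bounded W → ∃ t' s', Exec W p s t' s' ∧ s'.Bounded W ∧ Q (t + t') s'

theorem WP.conseq {W : ℕ} {p : Prog} {Q Q' : ℕ → State → Prop} {t : ℕ} {s : State}
    (h : WP W p Q t s) (hQ : ∀ t s, s.Bounded W → Q t s → Q' t s) : WP W p Q' t s := by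
  intro hb
  obtain ⟨t', s', h1, h2, h3⟩ := h hb
  exact ⟨t', s', h1, h2, hQ _ _ h2 h3⟩

theorem WP.seq {W : ℕ} {p q : Prog} {Q : ℕ → State → Prop} {t : ℕ} {s : State}
    (h : WP W p (WP W q Q) t s) : WP W (.seq p q) Q t s := by
  intro hb
  obtain ⟨t₁, s₁, h1, h2, h3⟩ := h hb
  obtain ⟨t₂, s₂, h4, h5, h6⟩ := h3 h2
  exact ⟨t₁ + t₂, s₂, .seq _ _ _ _ _ _ _ h1 h4, h5, by rwa [← Nat.add_assoc]⟩

theorem WP.ite {W : ℕ} {c : Test} {p q : Prog} {Q : ℕ → State → Prop} {t : ℕ} {s : State}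
    (hp : c.Holds s → WP W p Q (t + 1) s) (hq : ¬ c.Holds s → WP W q Q (t + 1) s) :
    WP W (.ite c p q) Q t s := by
  intro hb
  by_cases hc : c.Holds s
  · obtain ⟨t', s', h1, h2, h3⟩ := hp hc hb
    exact ⟨1 + t', s', .ite_true _ _ _ _ _ _ hc h1, h2, by rwa [← Nat.add_assoc]⟩
  · obtain ⟨t', s', h1, h2, h3⟩ := hq hc hb
    exact ⟨1 + t', s', .ite_false _ _ _ _ _ _ hc h1, h2, by rwa [← Nat.add_assoc]⟩

/-- The rule for loops: an invariant that bounds the time also gives termination. -/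
theorem WP.loop {W : ℕ} {c : Test} {p : Prog} {Q : ℕ → State → Prop} (I : ℕ → State → Prop)
    (K : ℕ) {t : ℕ} {s : State} (hI : I t s) (hK : ∀ t s, I t s → t ≤ K)
    (hstep : ∀ t s, s.Bounded W → I t s → c.Holds s → WP W p I (t + 1) s)
    (hexit : ∀ t s, s.Bounded W → I t s → ¬ c.Holds s → Q (t + 1) s) :
    WP W (.loop c p) Q t s := by
  -- Each round takes at least one step, the test, so the time left before `K` decreases and serves
  -- as the termination measure.
  obtain ⟨m, hm⟩ : ∃ m, m = K - t := ⟨_, rfl⟩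
  induction m using Nat.strong_induction_on generalizing t s with
  | _ m ih =>
    intro hb
    by_cases hc : c.Holds s
    · obtain ⟨t₁, s₁, h1, h2, h3⟩ := hstep t s hb hI hc hb
      have h4 := hK _ _ h3
      obtain ⟨t₂, s₂, h5, h6, h7⟩ := ih (K - (t + 1 + t₁)) (by omega) h3 rfl h2
      exact ⟨1 + t₁ + t₂, s₂, .loop_true _ _ _ _ _ _ _ hc h1 h5, h6,
        by rwa [show t + (1 + t₁ + t₂) = t + 1 + t₁ + t₂ by omega]⟩
    · exact ⟨1, s, .loop_false _ _ _ hc, hb, hexit t s hb hI hc⟩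

/-- Verification condition for a program and a postcondition, with loops left as they are. -/
def vc (W : ℕ) : Prog → (ℕ → State → Prop) → ℕ → State → Prop
  | .skip, Q, t, s => Q (t + 1) s
  | .const x k, Q, t, s => k ≤ W ∧ Q (t + 1) (s.setReg x k)
  | .move x y, Q, t, s => Q (t + 1) (s.setReg x (s.reg y))
  | .add x y z, Q, t, s => s.reg y + s.reg z ≤ W ∧ Q (t + 1) (s.setReg x (s.reg y + s.reg z))
  | .sub x y z, Q, t, s => Q (t + 1) (s.setReg x (s.reg y - s.reg z))
  | .load x b y, Q, t, s => Q (t + 1) (s.setReg x (s.mem b (s.reg y)))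
  | .store b y x, Q, t, s => Q (t + 1) (s.setMem b (s.reg y) (s.reg x))
  | .seq p q, Q, t, s => vc W p (vc W q Q) t s
  | .ite c p q, Q, t, s => (c.Holds s → vc W p Q (t + 1) s) ∧ (¬ c.Holds s → vc W q Q (t + 1) s)
  | .loop c p, Q, t, s => WP W (.loop c p) Q t s

/-- Only constants and sums can exceed the word size. Every other instruction yields a number at
most one already present in a bounded state, so `vc` imposes a bound in these two cases alone. -/
theorem WP.of_vc {W : ℕ} {p : Prog} {Q : ℕ → State → Prop} {t : ℕ} {s : State}
    (h : vc W p Q t s) : WP W p Q t s := by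
  induction p generalizing Q t s with
  | skip => exact fun hb => ⟨1, s, .skip s, hb, h⟩
  | const x k => exact fun hb => ⟨1, _, .const s x k h.1, hb.setReg x h.1, h.2⟩
  | move x y => exact fun hb => ⟨1, _, .move s x y (hb.1 _), hb.setReg x (hb.1 _), h⟩
  | add x y z => exact fun hb => ⟨1, _, .add s x y z h.1, hb.setReg x h.1, h.2⟩
  | sub x y z =>
    intro hb
    have h1 : s.reg y - s.reg z ≤ W := (Nat.sub_le _ _).trans (hb.1 _)
    exact ⟨1, _, .sub s x y z h1, hb.setReg x h1, h⟩
  | load x b y => exact fun hb => ⟨1, _, .load s x b y (hb.2 _ _), hb.setReg x (hb.2 _ _), h⟩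
  | store b y x => exact fun hb => ⟨1, _, .store s b y x (hb.1 _), hb.setMem _ _ (hb.1 _), h⟩
  | seq p q ihp ihq => exact WP.seq ((ihp h).conseq fun _ _ _ h' => ihq h')
  | ite c p q ihp ihq => exact WP.ite (fun hc => ihp (h.1 hc)) (fun hc => ihq (h.2 hc))
  | loop c p _ => exact h

end RAM

/-! ### Irving's algorithm on half-edges. -/

/-- A roommates instance given by half-edges. The vertices are `1, …, n`. The half-edges at the vertex
`v` are the numbers from `first v` to `last v`, best half-edge first, and the last one is a loop:
being matched along it amounts to being unmatched. The number `0` is the owner of all numbers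
that are not half-edges. -/
structure HalfEdges where
  n : ℕ
  first : ℕ → ℕ
  last : ℕ → ℕ
  twin : ℕ → ℕ
  owner : ℕ → ℕ
  first_le_last : ∀ v, 1 ≤ v → v ≤ n → first v ≤ last v
  owner_eq_iff : ∀ v, 1 ≤ v → v ≤ n → ∀ h, owner h = v ↔ first v ≤ h ∧ h ≤ last v
  owner_le : ∀ h, owner h ≤ n
  owner_twin : ∀ h, owner h ≠ 0 → owner (twin h) ≠ 0
  twin_twin : ∀ h, owner h ≠ 0 → twin (twin h) = h
  twin_last : ∀ v, 1 ≤ v → v ≤ n → twin (last v) = last v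
  twin_succ_last : ∀ v, 1 ≤ v → v ≤ n → twin (last v + 1) = 0
  owner_zero : owner 0 = 0

namespace HalfEdges

variable (H : HalfEdges)

/-- The numbers that are vertices. -/
def IsVertex (v : ℕ) : Prop := 1 ≤ v ∧ v ≤ H.n

/-- The other endpoint of a half-edge. -/
def opp (h : ℕ) : ℕ := H.owner (H.twin h)

/-- `μ` matches every vertex `v` along the half-edge `μ v`, and no half-edge blocks it. -/
structure Stable (μ : ℕ → ℕ) : Prop where
  owner_eq : ∀ v, H.IsVertex v → H.owner (μ v) = v
  twin_eq : ∀ v, H.IsVertex v → H.twin (μ v) = μ (H.opp (μ v))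
  not_blocks : ∀ h, H.owner h ≠ 0 → μ (H.owner h) ≤ h ∨ μ (H.opp h) ≤ H.twin h

/-- The half-edges that both endpoints rank no worse than their cutoffs. -/
def InTable (b : ℕ → ℕ) (h : ℕ) : Prop :=
  H.owner h ≠ 0 ∧ h ≤ b (H.owner h) ∧ H.twin h ≤ b (H.opp h)

/-- The vertex `u` proposes along `a u` and is accepted. -/
def Accepted (a b : ℕ → ℕ) (u : ℕ) : Prop := b (H.opp (a u)) = H.twin (a u)

/-- `μ` respects the cutoffs `b`. -/
def Below (μ b : ℕ → ℕ) : Prop := ∀ v, H.IsVertex v → μ v ≤ b v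

variable {H}

theorem isVertex_owner {h : ℕ} (hh : H.owner h ≠ 0) : H.IsVertex (H.owner h) :=
  ⟨Nat.one_le_iff_ne_zero.2 hh, H.owner_le h⟩

theorem isVertex_opp {h : ℕ} (hh : H.owner h ≠ 0) : H.IsVertex (H.opp h) :=
  isVertex_owner (H.owner_twin h hh)

theorem IsVertex.ne_zero {v : ℕ} (hv : H.IsVertex v) : v ≠ 0 := by
  have := hv.1
  omega

theorem IsVertex.owner_eq_iff {v : ℕ} (hv : H.IsVertex v) (h : ℕ) :
    H.owner h = v ↔ H.first v ≤ h ∧ h ≤ H.last v :=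
  H.owner_eq_iff v hv.1 hv.2 h

theorem IsVertex.owner_ne {v h : ℕ} (hv : H.IsVertex v) (hh : H.owner h = v) : H.owner h ≠ 0 :=
  hh ▸ hv.ne_zero

theorem opp_twin {h : ℕ} (hh : H.owner h ≠ 0) : H.opp (H.twin h) = H.owner h := by
  rw [opp, H.twin_twin h hh]

theorem twin_inj {g h : ℕ} (hg : H.owner g ≠ 0) (hh : H.owner h ≠ 0)
    (e : H.twin g = H.twin h) : g = h := by
  rw [← H.twin_twin g hg, e, H.twin_twin h hh]

theorem InTable.twin {b : ℕ → ℕ} {h : ℕ} (hh : H.InTable b h) : H.InTable b (H.twin h) := by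
  refine ⟨H.owner_twin h hh.1, hh.2.2, ?_⟩
  rw [opp_twin hh.1, H.twin_twin h hh.1]
  exact hh.2.1

theorem InTable.mono {b b' : ℕ → ℕ} {h : ℕ} (hb : ∀ v, H.IsVertex v → b' v ≤ b v)
    (hh : H.InTable b' h) : H.InTable b h :=
  ⟨hh.1, hh.2.1.trans (hb _ (isVertex_owner hh.1)), hh.2.2.trans (hb _ (isVertex_opp hh.1))⟩

theorem Stable.inTable {μ b : ℕ → ℕ} (hμ : H.Stable μ) (hb : H.Below μ b) {v : ℕ}
    (hv : H.IsVertex v) : H.InTable b (μ v) := by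
  have h1 := hμ.owner_eq v hv
  have h0 := hv.owner_ne h1
  refine ⟨h0, ?_, ?_⟩
  · rw [h1]
    exact hb v hv
  · rw [hμ.twin_eq v hv]
    exact hb _ (isVertex_opp h0)

/-! ### Proposals -/

variable (H) in
/-- The invariant of the proposal phase, for pointers `a` and cutoffs `b`. -/
structure Proposing (a b : ℕ → ℕ) : Prop where
  first_le : ∀ v, H.IsVertex v → H.first v ≤ a v
  le_last : ∀ v, H.IsVertex v → a v ≤ H.last v + 1
  owner_cutoff : ∀ v, H.IsVertex v → H.owner (b v) = v
  cutoff_zero : b 0 = 0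
  below : ∀ μ, H.Stable μ → H.Below μ b
  minimal : ∀ h, H.InTable b h → a (H.owner h) ≤ h

/-- A pointer past its list rests on a number with twin `0`, and the cutoff of the fictitious vertex
`0` is `0`. So an exhausted vertex counts as accepted, and only a genuine half-edge can fail the
test. -/
theorem Proposing.owner_of_ne {a b : ℕ → ℕ} (hp : H.Proposing a b) {x : ℕ} (hx : H.IsVertex x)
    (h : b (H.opp (a x)) ≠ H.twin (a x)) : a x ≤ H.last x := by
  rcases (hp.le_last x hx).lt_or_eq with h1 | h1
  · omega
  · exfalso
    apply h
    rw [opp, h1, H.twin_succ_last x hx.1 hx.2, H.owner_zero, hp.cutoff_zero]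

theorem Proposing.owner_eq {a b : ℕ → ℕ} (hp : H.Proposing a b) {x : ℕ} (hx : H.IsVertex x)
    (h : a x ≤ H.last x) : H.owner (a x) = x :=
  (hx.owner_eq_iff _).2 ⟨hp.first_le x hx, h⟩

/-- The half-edge `a x` lies beyond the cutoff of its other end, hence outside the table, so
skipping it preserves `minimal`. -/
theorem Proposing.advance {a b : ℕ → ℕ} (hp : H.Proposing a b) {x : ℕ} (hx : H.IsVertex x)
    (h : b (H.opp (a x)) < H.twin (a x)) : H.Proposing (Function.update a x (a x + 1)) b := by
  have h1 := hp.owner_of_ne hx h.ne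
  refine ⟨fun v hv => ?_, fun v hv => ?_, hp.owner_cutoff, hp.cutoff_zero, hp.below, fun g hg => ?_⟩
  · have := hp.first_le v hv
    rw [Function.update_apply]
    split_ifs with hvx
    · subst hvx
      omega
    · exact this
  · have := hp.le_last v hv
    rw [Function.update_apply]
    split_ifs with hvx
    · subst hvx
      omega
    · exact this
  · have h2 := hp.minimal g hg
    rw [Function.update_apply]
    split_ifs with hgx
    · rw [hgx] at h2
      have : g ≠ a x := by
        rintro rfl
        exact absurd hg.2.2 (not_le.2 h)
      omega
    · exact h2

/-- By `minimal`, no stable matching gives `x` anything better than `a x`. Since `a x` does not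
block, its other end is matched at least as well as along `a x`, and the cutoff may be lowered to
the twin. -/
theorem Proposing.accept {a b : ℕ → ℕ} (hp : H.Proposing a b) {x : ℕ} (hx : H.IsVertex x)
    (h : H.twin (a x) < b (H.opp (a x))) :
    H.Proposing a (Function.update b (H.opp (a x)) (H.twin (a x))) := by
  have hax := hp.owner_eq hx (hp.owner_of_ne hx h.ne')
  have h0 := hx.owner_ne hax
  have hv := isVertex_opp h0
  have hle : ∀ v, Function.update b (H.opp (a x)) (H.twin (a x)) v ≤ b v := fun v => by
    rw [Function.update_apply]
    split_ifs with hvx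
    · rw [hvx]
      exact h.le
    · exact le_rfl
  refine ⟨hp.first_le, hp.le_last, fun v hv' => ?_, ?_, fun μ hμ v hv' => ?_, fun g hg => ?_⟩
  · rw [Function.update_apply]
    split_ifs with hvx
    · rw [hvx]
      rfl
    · exact hp.owner_cutoff v hv'
  · rw [Function.update_of_ne hv.ne_zero.symm, hp.cutoff_zero]
  · rw [Function.update_apply]
    split_ifs with hvx
    · rw [hvx]
      rcases hμ.not_blocks (a x) h0 with h1 | h1
      · rw [hax] at h1
        have h2 := hp.minimal _ (hμ.inTable (hp.below μ hμ) hx)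
        rw [hμ.owner_eq x hx] at h2
        have h3 : μ x = a x := le_antisymm h1 h2
        rw [← h3, hμ.twin_eq x hx]
      · exact h1
    · exact hp.below μ hμ v hv'
  · exact hp.minimal g (hg.mono fun v _ => hle v)

theorem Proposing.isVertex_opp_cutoff {a b : ℕ → ℕ} (hp : H.Proposing a b) {v : ℕ}
    (hv : H.IsVertex v) : H.IsVertex (H.opp (b v)) :=
  isVertex_opp (hv.owner_ne (hp.owner_cutoff v hv))

/-- Lowering the cutoff of `v` rejects only the vertex whose half-edge was that cutoff, namely `opp
(b v)`. An exhausted vertex points at `0` and is unaffected. -/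
theorem Proposing.accepted_update {a b : ℕ → ℕ} (hp : H.Proposing a b) {x u : ℕ}
    (hx : H.IsVertex x) (h : H.twin (a x) < b (H.opp (a x))) (hu : H.IsVertex u)
    (hacc : u ≠ x → H.Accepted a b u) (hne : u ≠ H.opp (b (H.opp (a x)))) :
    H.Accepted a (Function.update b (H.opp (a x)) (H.twin (a x))) u := by
  have hax := hp.owner_eq hx (hp.owner_of_ne hx h.ne')
  have hv := isVertex_opp (hx.owner_ne hax)
  rw [Accepted, Function.update_apply]
  by_cases hux : u = x
  · rw [hux, if_pos rfl]
  · have hu' := hacc hux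
    rw [Accepted] at hu'
    rw [if_neg, hu']
    intro he
    apply hne
    rw [← he, hu']
    have : H.owner (a u) = u := by
      apply hp.owner_eq hu
      by_contra hlt
      have h1 : a u = H.last u + 1 := by
        have := hp.le_last u hu
        omega
      rw [opp, h1, H.twin_succ_last u hu.1 hu.2, H.owner_zero] at he
      exact hv.ne_zero he.symm
    rw [opp_twin (hu.owner_ne this), this]

/-- A stable matching would be squeezed between pointer and cutoff: `a u ≤ μ u ≤ b u`. -/
theorem Proposing.not_stable {a b : ℕ → ℕ} (hp : H.Proposing a b) {u : ℕ} (hu : H.IsVertex u)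
    (h : b u < a u) (μ : ℕ → ℕ) : ¬ H.Stable μ := by
  intro hμ
  have h1 := hp.minimal _ (hμ.inTable (hp.below μ hμ) hu)
  rw [hμ.owner_eq u hu] at h1
  have := hp.below μ hμ u hu
  omega

/-! ### Rotations -/

variable (H) in
/-- The invariant of the rotation phase: `a u` is the first half-edge of `u` in the table, it is the
cutoff of its other endpoint, and `c u` bounds the other half-edges of `u` in the table. -/
structure Reduced (a b c : ℕ → ℕ) : Prop where
  owner_first : ∀ u, H.IsVertex u → H.owner (a u) = u
  owner_cutoff : ∀ u, H.IsVertex u → H.owner (b u) = u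
  le_cutoff : ∀ u, H.IsVertex u → a u ≤ b u
  accepted : ∀ u, H.IsVertex u → H.Accepted a b u
  lt_second : ∀ u, H.IsVertex u → a u < c u
  second_le : ∀ u, H.IsVertex u → c u ≤ H.last u + 1
  minimal : ∀ h, H.InTable b h → h = a (H.owner h) ∨ c (H.owner h) ≤ h
  sound : (∃ μ, H.Stable μ) → ∃ μ, H.Stable μ ∧ H.Below μ b

/-- `Reduced` asks only for lower bounds on the second choices, so the second pointers may start
right behind the first ones and be advanced when needed. The hypothesis `a u ≤ b u` excludes
exhausted vertices. -/
theorem Proposing.reduced {a b c : ℕ → ℕ} (hp : H.Proposing a b)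
    (hle : ∀ u, H.IsVertex u → a u ≤ b u) (hacc : ∀ u, H.IsVertex u → H.Accepted a b u)
    (hc : ∀ u, H.IsVertex u → c u = a u + 1) : H.Reduced a b c := by
  have hlast : ∀ u, H.IsVertex u → a u ≤ H.last u := fun u hu =>
    (hle u hu).trans ((hu.owner_eq_iff _).1 (hp.owner_cutoff u hu)).2
  refine ⟨fun u hu => hp.owner_eq hu (hlast u hu), hp.owner_cutoff, hle, hacc,
    fun u hu => by rw [hc u hu]; omega, fun u hu => by rw [hc u hu]; exact Nat.succ_le_succ (hlast u hu),
    fun h hh => ?_, fun ⟨μ, hμ⟩ => ⟨μ, hμ, hp.below μ hμ⟩⟩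
  have := hp.minimal h hh
  have := hc _ (isVertex_owner hh.1)
  omega

/-- The holder of the second choice of `u`: its successor on the way to a rotation. -/
def next (H : HalfEdges) (b c : ℕ → ℕ) (u : ℕ) : ℕ := H.opp (b (H.opp (c u)))

namespace Reduced

variable {a b c : ℕ → ℕ} (hr : H.Reduced a b c)
include hr

theorem owner_first_ne {u : ℕ} (hu : H.IsVertex u) : H.owner (a u) ≠ 0 :=
  hu.owner_ne (hr.owner_first u hu)

theorem owner_cutoff_ne {u : ℕ} (hu : H.IsVertex u) : H.owner (b u) ≠ 0 :=
  hu.owner_ne (hr.owner_cutoff u hu)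

theorem first_injective {u v : ℕ} (hu : H.IsVertex u) (hv : H.IsVertex v) (h : a u = a v) :
    u = v := by
  rw [← hr.owner_first u hu, h, hr.owner_first v hv]

/-- An accepted half-edge is the twin of the cutoff at its target, so distinct vertices have
distinct targets. An injective self-map of the finite vertex set is surjective. -/
theorem exists_proposer {v : ℕ} (hv : H.IsVertex v) : ∃ u, H.IsVertex u ∧ H.opp (a u) = v := by
  have hinj : ∀ u ∈ Finset.Icc 1 H.n, ∀ w ∈ Finset.Icc 1 H.n,
      H.opp (a u) = H.opp (a w) → u = w := by
    intro u hu w hw h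
    have hu := Finset.mem_Icc.1 hu
    have hw := Finset.mem_Icc.1 hw
    have h1 := hr.accepted u hu
    have h2 := hr.accepted w hw
    rw [Accepted] at h1 h2
    rw [h, h2] at h1
    exact hr.first_injective hu hw
      (twin_inj (hr.owner_first_ne hu) (hr.owner_first_ne hw) h1.symm)
  obtain ⟨u, hu, h⟩ := Finset.surj_on_of_inj_on_of_card_le (s := Finset.Icc 1 H.n)
    (t := Finset.Icc 1 H.n) (fun u _ => H.opp (a u))
    (fun u hu => Finset.mem_Icc.2 (isVertex_opp (hr.owner_first_ne (Finset.mem_Icc.1 hu))))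
    (fun u w hu hw h => hinj u hu w hw h) le_rfl v (Finset.mem_Icc.2 hv)
  exact ⟨u, Finset.mem_Icc.1 hu, h.symm⟩

theorem isVertex_opp_cutoff {v : ℕ} (hv : H.IsVertex v) : H.IsVertex (H.opp (b v)) :=
  isVertex_opp (hr.owner_cutoff_ne hv)

theorem twin_cutoff {v : ℕ} (hv : H.IsVertex v) : H.twin (b v) = a (H.opp (b v)) := by
  obtain ⟨u, hu, rfl⟩ := hr.exists_proposer hv
  have h := hr.accepted u hu
  rw [Accepted] at h
  rw [h, opp_twin (hr.owner_first_ne hu), hr.owner_first u hu,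
    H.twin_twin _ (hr.owner_first_ne hu)]

theorem opp_first_opp_cutoff {v : ℕ} (hv : H.IsVertex v) : H.opp (a (H.opp (b v))) = v := by
  rw [← hr.twin_cutoff hv, opp_twin (hr.owner_cutoff_ne hv), hr.owner_cutoff v hv]

theorem opp_cutoff_opp_first {u : ℕ} (hu : H.IsVertex u) : H.opp (b (H.opp (a u))) = u := by
  have h := hr.accepted u hu
  rw [Accepted] at h
  rw [h, opp_twin (hr.owner_first_ne hu), hr.owner_first u hu]

theorem inTable_cutoff {v : ℕ} (hv : H.IsVertex v) : H.InTable b (b v) := by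
  refine ⟨hr.owner_cutoff_ne hv, ?_, ?_⟩
  · rw [hr.owner_cutoff v hv]
  · rw [hr.twin_cutoff hv]
    exact hr.le_cutoff _ (hr.isVertex_opp_cutoff hv)

theorem first_le {h : ℕ} (hh : H.InTable b h) : a (H.owner h) ≤ h := by
  have := hr.lt_second _ (isVertex_owner hh.1)
  rcases hr.minimal h hh with h1 | h1 <;> omega

theorem second_le_cutoff {u : ℕ} (hu : H.IsVertex u) (h : a u < b u) : c u ≤ b u := by
  have h1 := hr.minimal _ (hr.inTable_cutoff hu)
  rw [hr.owner_cutoff u hu] at h1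
  omega

theorem owner_second {u : ℕ} (hu : H.IsVertex u) (h : a u < b u) : H.owner (c u) = u := by
  have h1 := (hu.owner_eq_iff _).1 (hr.owner_first u hu)
  have h2 := (hu.owner_eq_iff _).1 (hr.owner_cutoff u hu)
  have h3 := hr.second_le_cutoff hu h
  have h4 := hr.lt_second u hu
  exact (hu.owner_eq_iff _).2 ⟨by omega, by omega⟩

theorem inTable_second {u : ℕ} (hu : H.IsVertex u) (h : a u < b u)
    (hc : H.twin (c u) ≤ b (H.opp (c u))) : H.InTable b (c u) := by
  have h1 := hr.owner_second hu h
  refine ⟨hu.owner_ne h1, ?_, hc⟩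
  rw [h1]
  exact hr.second_le_cutoff hu h

theorem advance {x : ℕ} (hx : H.IsVertex x) (h : a x < b x)
    (hc : b (H.opp (c x)) < H.twin (c x)) : H.Reduced a b (Function.update c x (c x + 1)) := by
  refine ⟨hr.owner_first, hr.owner_cutoff, hr.le_cutoff, hr.accepted, fun u hu => ?_, fun u hu => ?_,
    fun g hg => ?_, hr.sound⟩
  · have := hr.lt_second u hu
    rw [Function.update_apply]
    split_ifs with hux
    · subst hux
      omega
    · exact this
  · rw [Function.update_apply]
    split_ifs with hux
    · subst hux
      have := hr.second_le_cutoff hu h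
      have := ((hu.owner_eq_iff _).1 (hr.owner_cutoff u hu)).2
      omega
    · exact hr.second_le u hu
  · rcases hr.minimal g hg with h1 | h1
    · exact Or.inl h1
    · right
      rw [Function.update_apply]
      split_ifs with hgx
      · rw [hgx] at h1
        have : g ≠ c x := by
          rintro rfl
          exact absurd hg.2.2 (not_le.2 hc)
        omega
      · exact h1

theorem isVertex_next {u : ℕ} (hu : H.IsVertex u) (h : a u < b u) : H.IsVertex (H.next b c u) :=
  hr.isVertex_opp_cutoff (isVertex_opp (hu.owner_ne (hr.owner_second hu h)))

/-- Each cutoff is the twin of a first half-edge; equality would make `c u` equal to `a u`. -/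
theorem twin_second_lt {u : ℕ} (hu : H.IsVertex u) (h : a u < b u) (hc : H.InTable b (c u)) :
    H.twin (c u) < b (H.opp (c u)) := by
  refine lt_of_le_of_ne hc.2.2 fun he => ?_
  have hv := isVertex_opp hc.1
  have h1 := hr.twin_cutoff hv
  rw [← he, H.twin_twin _ hc.1] at h1
  have h2 : H.opp (H.twin (c u)) = u := by rw [opp_twin hc.1, hr.owner_second hu h]
  rw [h2] at h1
  have := hr.lt_second u hu
  omega

/-- Let `v` be the other end of `c u`, and `w` the holder of the cutoff of `v`. If `w` had a single
half-edge, then `b v` would be the first half-edge of `v`; but the twin of `c u` is in the table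
strictly before `b v`. Hence the walk never gets stuck. -/
theorem next_lt {u : ℕ} (hu : H.IsVertex u) (h : a u < b u) (hc : H.InTable b (c u)) :
    a (H.next b c u) < b (H.next b c u) := by
  have hv := isVertex_opp hc.1
  have hw := hr.isVertex_opp_cutoff hv
  refine lt_of_le_of_ne (hr.le_cutoff _ hw) fun he => ?_
  have h1 := hr.twin_cutoff hv
  have h2 := hr.twin_cutoff hw
  rw [next] at he
  rw [← he, ← h1, H.twin_twin _ (hr.owner_cutoff_ne hv), opp_twin (hr.owner_cutoff_ne hv),
    hr.owner_cutoff _ hv] at h2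
  have h3 := hr.first_le hc.twin
  have h4 := hr.twin_second_lt hu h hc
  change a (H.opp (c u)) ≤ _ at h3
  omega

theorem cutoff_injective {v w : ℕ} (hv : H.IsVertex v) (hw : H.IsVertex w)
    (h : H.opp (b v) = H.opp (b w)) : v = w := by
  rw [← hr.opp_first_opp_cutoff hv, h, hr.opp_first_opp_cutoff hw]

/-- A blocking half-edge would belong to the table and precede the first entry of its owner. -/
theorem stable_cutoff (h : ∀ u, H.IsVertex u → a u = b u) : H.Stable b := by
  refine ⟨hr.owner_cutoff, fun v hv => ?_, fun g hg => ?_⟩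
  · rw [hr.twin_cutoff hv, h _ (hr.isVertex_opp_cutoff hv)]
  · by_contra! hcon
    have h1 := hr.first_le ⟨hg, hcon.1.le, hcon.2.le⟩
    rw [h _ (isVertex_owner hg)] at h1
    omega

end Reduced

end HalfEdges

/-! ### Elimination of a rotation. -/

namespace HalfEdges

variable {H : HalfEdges}

variable (H) in
/-- A rotation: a cycle of vertices with at least two half-edges in the table, each of which is
followed by the holder of its second choice. -/
structure IsRotation (a b c : ℕ → ℕ) (C : Set ℕ) : Prop where
  isVertex : ∀ u ∈ C, H.IsVertex u
  lt : ∀ u ∈ C, a u < b u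
  inTable : ∀ u ∈ C, H.InTable b (c u)
  next_mem : ∀ u ∈ C, H.next b c u ∈ C
  next_surj : ∀ w ∈ C, ∃ u ∈ C, H.next b c u = w
  next_inj : ∀ u ∈ C, ∀ w ∈ C, H.next b c u = H.next b c w → u = w
  connected : ∀ A ⊆ C, (∀ u ∈ C, H.next b c u ∈ A → u ∈ A) → A.Nonempty → A = C

variable (H) in
/-- The pointers and cutoffs `a'`, `b'`, `c'` arise from `a`, `b`, `c` by matching all vertices of `C`
along their second choices. -/
structure Eliminates (a b c : ℕ → ℕ) (C : Set ℕ) (a' b' c' : ℕ → ℕ) : Prop where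
  first_mem : ∀ u ∈ C, a' u = c u
  second_mem : ∀ u ∈ C, c' u = c u + 1
  cutoff_mem : ∀ u ∈ C, b' (H.opp (c u)) = H.twin (c u)
  first_not_mem : ∀ u, u ∉ C → a' u = a u
  second_not_mem : ∀ u, u ∉ C → c' u = c u
  cutoff_not_mem : ∀ v, (∀ u ∈ C, H.opp (c u) ≠ v) → b' v = b v

namespace Reduced

variable {a b c a' b' c' : ℕ → ℕ} {C : Set ℕ} (hr : H.Reduced a b c)
include hr

theorem stable_eq_cutoff {μ : ℕ → ℕ} (hμ : H.Stable μ) {v : ℕ} (hv : H.IsVertex v)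
    (h : μ (H.opp (b v)) = a (H.opp (b v))) : μ v = b v := by
  have h1 := hμ.twin_eq _ (hr.isVertex_opp_cutoff hv)
  rw [h, ← hr.twin_cutoff hv, H.twin_twin _ (hr.owner_cutoff_ne hv),
    opp_twin (hr.owner_cutoff_ne hv), hr.owner_cutoff v hv] at h1
  exact h1.symm

/-- Without its first choice, `u` gets at best `c u`. As `c u` does not block, its other end does at
least as well as along `c u`. -/
theorem stable_twin_second {μ : ℕ → ℕ} (hμ : H.Stable μ) (hb : H.Below μ b) {u : ℕ}
    (hu : H.IsVertex u) (hlt : a u < b u) (hc : H.InTable b (c u)) (h : μ u ≠ a u) :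
    μ (H.opp (c u)) ≤ H.twin (c u) := by
  have howner := hr.owner_second hu hlt
  rcases hμ.not_blocks (c u) hc.1 with h1 | h1
  · rw [howner] at h1
    have h2 := hr.minimal _ (hμ.inTable hb hu)
    rw [hμ.owner_eq u hu] at h2
    have h3 : μ u = c u := le_antisymm h1 (h2.resolve_left h)
    rw [← h3, hμ.twin_eq u hu]
  · exact h1

/-- Suppose that the successor of `u` gets its first choice. Then the vertex between them sits at
its cutoff, whereas it would do strictly better if `u` missed its first choice. So the members with
their first choices are closed under predecessors, and `connected` applies. -/
theorem rotation_all_or_none {μ : ℕ → ℕ} (hμ : H.Stable μ) (hb : H.Below μ b)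
    (hC : H.IsRotation a b c C) : (∀ u ∈ C, μ u = a u) ∨ ∀ u ∈ C, μ u ≠ a u := by
  by_cases hne : ({u | u ∈ C ∧ μ u = a u} : Set ℕ).Nonempty
  · left
    intro u hu
    have hA := hC.connected {u | u ∈ C ∧ μ u = a u} (fun u hu => hu.1) (fun u hu hw => by
      refine ⟨hu, ?_⟩
      by_contra hcon
      have hv := isVertex_opp (hC.inTable u hu).1
      have h1 := hr.stable_twin_second hμ hb (hC.isVertex u hu) (hC.lt u hu) (hC.inTable u hu) hcon
      have h2 := hr.twin_second_lt (hC.isVertex u hu) (hC.lt u hu) (hC.inTable u hu)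
      have h3 := hr.stable_eq_cutoff hμ hv hw.2
      omega) hne
    rw [← hA] at hu
    exact hu.2
  · right
    intro u hu h
    exact hne ⟨u, hu, h⟩

/-- Moving all vertices of a rotation from their first to their second choices keeps stability. -/
theorem exists_stable_second {μ : ℕ → ℕ} (hμ : H.Stable μ) (hb : H.Below μ b)
    (hC : H.IsRotation a b c C) (hall : ∀ u ∈ C, μ u = a u) :
    ∃ μ', H.Stable μ' ∧ H.Below μ' b ∧ ∀ u ∈ C, μ' u = c u := by
  classical
  have hsurj := hC.next_surj
  choose! g hgC hg using hsurj
  have hgn : ∀ u ∈ C, g (H.next b c u) = u := fun u hu =>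
    hC.next_inj _ (hgC _ (hC.next_mem u hu)) u hu (hg _ (hC.next_mem u hu))
  have hV := hC.isVertex
  have hvV : ∀ u ∈ C, H.IsVertex (H.opp (c u)) := fun u hu => isVertex_opp (hC.inTable u hu).1
  have how : ∀ u ∈ C, H.owner (c u) = u := fun u hu => hr.owner_second (hV u hu) (hC.lt u hu)
  have hD : ∀ x, H.IsVertex x → H.opp (b x) ∈ C → H.opp (c (g (H.opp (b x)))) = x :=
    fun x hx hxC => hr.cutoff_injective (hvV _ (hgC _ hxC)) hx (hg _ hxC)
  -- A member that is also the first choice of a member would be matched both at its first half-edge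
  -- and at its cutoff, against `a x < b x`.
  have hdisj : ∀ x ∈ C, H.opp (b x) ∉ C := fun x hx hxC => by
    have h1 := hr.stable_eq_cutoff hμ (hV x hx) (hall _ hxC)
    have := hall x hx
    have := hC.lt x hx
    omega
  -- Members take their second choices. A vertex whose cutoff is held by a member `w` loses `w` and
  -- receives the predecessor `g w`, whose second choice it is. All others stay.
  obtain ⟨μ', hμ'⟩ : ∃ μ' : ℕ → ℕ, ∀ x, μ' x = if x ∈ C then c x else
      if H.opp (b x) ∈ C then H.twin (c (g (H.opp (b x)))) else μ x := ⟨_, fun _ => rfl⟩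
  have e1 : ∀ x ∈ C, μ' x = c x := fun x hx => by rw [hμ', if_pos hx]
  have e2 : ∀ x, H.opp (b x) ∈ C → μ' x = H.twin (c (g (H.opp (b x)))) := fun x hx => by
    rw [hμ', if_neg (fun h => hdisj x h hx), if_pos hx]
  have e3 : ∀ x, x ∉ C → H.opp (b x) ∉ C → μ' x = μ x := fun x h1 h2 => by
    rw [hμ', if_neg h1, if_neg h2]
  have hlt : ∀ x, H.IsVertex x → H.opp (b x) ∈ C → μ' x < b x := fun x hx hxC => by
    have h1 := hr.twin_second_lt (hV _ (hgC _ hxC)) (hC.lt _ (hgC _ hxC)) (hC.inTable _ (hgC _ hxC))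
    rw [hD x hx hxC] at h1
    rw [e2 x hxC]
    exact h1
  have hle : ∀ x, H.IsVertex x → x ∉ C → μ' x ≤ μ x := fun x hx h1 => by
    by_cases h2 : H.opp (b x) ∈ C
    · have h3 := hr.stable_eq_cutoff hμ hx (hall _ h2)
      have := hlt x hx h2
      omega
    · exact (e3 x h1 h2).le
  have hbelow : H.Below μ' b := fun x hx => by
    by_cases h1 : x ∈ C
    · rw [e1 x h1]
      exact hr.second_le_cutoff hx (hC.lt x h1)
    · exact (hle x hx h1).trans (hb x hx)
  -- The only table entry that a member prefers to its second choice is its first choice, and the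
  -- vertex at the other end of that has improved strictly beyond it. Between nonmembers nothing new
  -- can block, by `hle`.
  have hnb : ∀ h, H.owner h ≠ 0 → H.owner h ∈ C →
      μ' (H.owner h) ≤ h ∨ μ' (H.opp h) ≤ H.twin h := by
    intro h h0 hhC
    by_contra! hcon
    have hvh := isVertex_opp h0
    have h1 := hbelow _ hvh
    have h2 := hbelow _ (isVertex_owner h0)
    have hT : H.InTable b h := ⟨h0, by omega, by omega⟩
    rw [e1 _ hhC] at hcon
    rcases hr.minimal h hT with h3 | h3
    · have h4 := hr.opp_cutoff_opp_first (hV _ hhC)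
      have h5 := hr.accepted _ (hV _ hhC)
      rw [Accepted] at h5
      rw [← h3] at h4 h5
      have := hlt _ hvh (by rw [h4]; exact hhC)
      omega
    · omega
  refine ⟨μ', ⟨fun x hx => ?_, fun x hx => ?_, fun h h0 => ?_⟩, hbelow, e1⟩
  · by_cases h1 : x ∈ C
    · rw [e1 x h1, how x h1]
    · by_cases h2 : H.opp (b x) ∈ C
      · rw [e2 x h2]
        exact hD x hx h2
      · rw [e3 x h1 h2, hμ.owner_eq x hx]
  · by_cases h1 : x ∈ C
    · have h2 : H.opp (b (H.opp (c x))) ∈ C := hC.next_mem x h1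
      rw [e1 x h1, e2 _ h2]
      change _ = H.twin (c (g (H.next b c x)))
      rw [hgn x h1]
    · by_cases h2 : H.opp (b x) ∈ C
      · have h3 := hC.inTable _ (hgC _ h2)
        rw [e2 x h2, H.twin_twin _ h3.1, opp_twin h3.1, how _ (hgC _ h2), e1 _ (hgC _ h2)]
      · rw [e3 x h1 h2]
        have h0 : H.owner (μ x) ≠ 0 := hx.owner_ne (hμ.owner_eq x hx)
        have hy := isVertex_opp h0
        have h3 : H.opp (μ (H.opp (μ x))) = x := by
          rw [← hμ.twin_eq x hx, opp_twin h0, hμ.owner_eq x hx]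
        rw [e3, hμ.twin_eq x hx]
        · intro h4
          rw [hall _ h4] at h3
          apply h2
          rw [← h3, hr.opp_cutoff_opp_first hy]
          exact h4
        · intro h4
          rw [hr.stable_eq_cutoff hμ hy (hall _ h4)] at h3
          exact h1 (h3 ▸ h4)
  · by_cases h1 : H.owner h ∈ C
    · exact hnb h h0 h1
    · by_cases h2 : H.opp h ∈ C
      · have h3 := hnb (H.twin h) (H.owner_twin h h0) h2
        rw [opp_twin h0, H.twin_twin h h0] at h3
        exact h3.symm
      · have h3 := hle _ (isVertex_owner h0) h1
        have h4 := hle _ (isVertex_opp h0) h2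
        have h5 := hμ.not_blocks h h0
        omega

variable (hC : H.IsRotation a b c C) (he : H.Eliminates a b c C a' b' c')
include hC he

omit hr in
theorem eliminates_cutoff_le (v : ℕ) : b' v ≤ b v := by
  by_cases h : ∃ u ∈ C, H.opp (c u) = v
  · obtain ⟨u, hu, rfl⟩ := h
    rw [he.cutoff_mem u hu]
    exact (hC.inTable u hu).2.2
  · push Not at h
    exact (he.cutoff_not_mem v h).le

/-- If the members miss their first choices, the given matching already respects the new cutoffs;
otherwise the shifted matching does. -/
theorem eliminates_sound : (∃ μ, H.Stable μ) → ∃ μ, H.Stable μ ∧ H.Below μ b' := by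
  intro hst
  obtain ⟨μ, hμ, hb⟩ := hr.sound hst
  have key : ∃ μ, H.Stable μ ∧ H.Below μ b ∧ ∀ u ∈ C, μ (H.opp (c u)) ≤ H.twin (c u) := by
    rcases hr.rotation_all_or_none hμ hb hC with h | h
    · obtain ⟨μ', h1, h2, h3⟩ := hr.exists_stable_second hμ hb hC h
      refine ⟨μ', h1, h2, fun u hu => ?_⟩
      have := h1.twin_eq u (hC.isVertex u hu)
      rw [h3 u hu] at this
      exact this.ge
    · exact ⟨μ, hμ, hb, fun u hu => hr.stable_twin_second hμ hb (hC.isVertex u hu) (hC.lt u hu)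
        (hC.inTable u hu) (h u hu)⟩
  obtain ⟨ν, h1, h2, h3⟩ := key
  refine ⟨ν, h1, fun v hv => ?_⟩
  by_cases h : ∃ u ∈ C, H.opp (c u) = v
  · obtain ⟨u, hu, rfl⟩ := h
    rw [he.cutoff_mem u hu]
    exact h3 u hu
  · push Not at h
    rw [he.cutoff_not_mem v h]
    exact h2 v hv

/-- The old first choice of a member leaves the table: its other end is the second choice of the
predecessor, whose proposal has lowered the cutoff strictly. -/
theorem eliminates_minimal {h : ℕ} (hh : H.InTable b' h) :
    h = a' (H.owner h) ∨ c' (H.owner h) ≤ h := by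
  have hb := eliminates_cutoff_le hC he
  have h1 := hr.minimal h (hh.mono fun v _ => hb v)
  by_cases hu : H.owner h ∈ C
  · rw [he.first_mem _ hu, he.second_mem _ hu]
    rcases h1 with h1 | h1
    · exfalso
      obtain ⟨u, huC, hnext⟩ := hC.next_surj _ hu
      have hV := hC.isVertex _ hu
      have h2 : H.opp (c u) = H.opp (a (H.owner h)) :=
        hr.cutoff_injective (isVertex_opp (hC.inTable u huC).1)
          (isVertex_opp (hr.owner_first_ne hV))
          (by rw [hr.opp_cutoff_opp_first hV]; exact hnext)
      rw [← h1] at h2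
      have h3 := hh.2.2
      rw [← h2, he.cutoff_mem u huC] at h3
      have h4 := hr.accepted _ hV
      rw [Accepted, ← h1, ← h2] at h4
      have h5 := hr.twin_second_lt (hC.isVertex u huC) (hC.lt u huC) (hC.inTable u huC)
      omega
    · omega
  · rw [he.first_not_mem _ hu, he.second_not_mem _ hu]
    exact h1

omit hC in
theorem eliminates_lt_second {u : ℕ} (hu : H.IsVertex u) : a' u < c' u := by
  by_cases huC : u ∈ C
  · rw [he.first_mem u huC, he.second_mem u huC]
    omega
  · rw [he.first_not_mem u huC, he.second_not_mem u huC]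
    exact hr.lt_second u hu

theorem eliminates_not_stable {u : ℕ} (hu : H.IsVertex u) (hlt : b' u < a' u) :
    ¬ ∃ μ, H.Stable μ := by
  intro hst
  obtain ⟨μ, hμ, hb⟩ := hr.eliminates_sound hC he hst
  have h1 := hr.eliminates_minimal hC he (hμ.inTable hb hu)
  rw [hμ.owner_eq u hu] at h1
  have := hr.eliminates_lt_second he hu
  have := hb u hu
  omega

theorem eliminates_reduced (hle : ∀ u, H.IsVertex u → a' u ≤ b' u) : H.Reduced a' b' c' := by
  refine ⟨fun u hu => ?_, fun v hv => ?_, hle, fun u hu => ?_,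
    fun u hu => hr.eliminates_lt_second he hu, fun u hu => ?_,
    fun h hh => hr.eliminates_minimal hC he hh, hr.eliminates_sound hC he⟩
  · by_cases huC : u ∈ C
    · rw [he.first_mem u huC]
      exact hr.owner_second hu (hC.lt u huC)
    · rw [he.first_not_mem u huC]
      exact hr.owner_first u hu
  · by_cases h : ∃ u ∈ C, H.opp (c u) = v
    · obtain ⟨u, hu, rfl⟩ := h
      rw [he.cutoff_mem u hu]
      rfl
    · push Not at h
      rw [he.cutoff_not_mem v h]
      exact hr.owner_cutoff v hv
  · by_cases huC : u ∈ C
    · rw [Accepted, he.first_mem u huC]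
      exact he.cutoff_mem u huC
    · rw [Accepted, he.first_not_mem u huC, he.cutoff_not_mem]
      · exact hr.accepted u hu
      · intro w hw h
        apply huC
        have h1 := hr.opp_cutoff_opp_first hu
        rw [← h] at h1
        rw [← h1]
        exact hC.next_mem w hw
  · by_cases huC : u ∈ C
    · rw [he.second_mem u huC]
      exact Nat.succ_le_succ ((hu.owner_eq_iff _).1 (hr.owner_second hu (hC.lt u huC))).2
    · rw [he.second_not_mem u huC]
      exact hr.second_le u hu

omit hr in
theorem eliminates_single {u : ℕ} (h : a u = b u) (hle : a' u ≤ b' u) : a' u = b' u := by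
  have huC : u ∉ C := fun hu => by
    have := hC.lt u hu
    omega
  have h1 := he.first_not_mem u huC
  have h2 := eliminates_cutoff_le hC he u
  omega

/-- The other end of `c u` keeps its cutoff, for otherwise `next u` would lie in `C`. The link can
thus break only if the cutoff of `u` itself falls below `c u`. The new cutoff was a table entry of
`u`, and the only one before `c u` is `a u`, so `u` has a single half-edge left. -/
theorem eliminates_link {u : ℕ} (hu : H.IsVertex u) (huC : u ∉ C) (hlt : a u < b u)
    (hc : H.InTable b (c u)) (hnext : H.next b c u ∉ C) :
    a' u = b' u ∨ (H.InTable b' (c' u) ∧ H.next b' c' u = H.next b c u) := by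
  have hD : ∀ w ∈ C, H.opp (c w) ≠ H.opp (c u) := fun w hw h => by
    apply hnext
    rw [next, ← h]
    exact hC.next_mem w hw
  have how := hr.owner_second hu hlt
  rw [he.second_not_mem u huC, next, he.second_not_mem u huC, he.cutoff_not_mem _ hD]
  by_cases h : c u ≤ b' u
  · right
    refine ⟨⟨hc.1, by rwa [how], ?_⟩, rfl⟩
    rw [he.cutoff_not_mem _ hD]
    exact hc.2.2
  · left
    have h1 := hr.second_le_cutoff hu hlt
    by_cases h2 : ∃ w ∈ C, H.opp (c w) = u
    · obtain ⟨w, hw, hwu⟩ := h2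
      have h3 := he.cutoff_mem w hw
      have h4 := hr.minimal _ (hC.inTable w hw).twin
      change H.twin (c w) = a (H.opp (c w)) ∨ c (H.opp (c w)) ≤ H.twin (c w) at h4
      rw [hwu] at h3 h4
      rw [he.first_not_mem u huC]
      omega
    · push Not at h2
      have := he.cutoff_not_mem u h2
      omega

end Reduced

end HalfEdges

/-! ### The path of the search for rotations. -/

namespace HalfEdges

variable {H : HalfEdges}

theorem Eliminates.empty (H : HalfEdges) (a b c : ℕ → ℕ) : H.Eliminates a b c ∅ a b c :=
  ⟨by simp, by simp, by simp, by simp, by simp, by simp⟩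

theorem Eliminates.insert {a b c a' b' c' : ℕ → ℕ} {C : Set ℕ} (he : H.Eliminates a b c C a' b' c')
    {x : ℕ} (hx : x ∉ C) (hne : ∀ u ∈ C, H.opp (c u) ≠ H.opp (c x)) :
    H.Eliminates a b c (insert x C) (Function.update a' x (c x))
      (Function.update b' (H.opp (c x)) (H.twin (c x))) (Function.update c' x (c x + 1)) := by
  have hmem : ∀ u ∈ C, u ≠ x := fun u hu h => hx (h ▸ hu)
  refine ⟨?_, ?_, ?_, ?_, ?_, ?_⟩
  · rintro u (rfl | hu)
    · simp
    · rw [Function.update_of_ne (hmem u hu), he.first_mem u hu]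
  · rintro u (rfl | hu)
    · simp
    · rw [Function.update_of_ne (hmem u hu), he.second_mem u hu]
  · rintro u (rfl | hu)
    · simp
    · rw [Function.update_of_ne (hne u hu), he.cutoff_mem u hu]
  · intro u hu
    rw [Set.mem_insert_iff, not_or] at hu
    rw [Function.update_of_ne hu.1, he.first_not_mem u hu.2]
  · intro u hu
    rw [Set.mem_insert_iff, not_or] at hu
    rw [Function.update_of_ne hu.1, he.second_not_mem u hu.2]
  · intro v hv
    rw [Function.update_of_ne (hv x (Set.mem_insert _ _)).symm,
      he.cutoff_not_mem v fun u hu => hv u (Set.mem_insert_of_mem _ hu)]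

variable (H) in
/-- The vertices `stk 1, …, stk p` form a path of the walk towards a rotation, except that some
of them may have only one half-edge left in the table. The vertices with `on v ≠ 0` are on the
path or have only one half-edge left. -/
structure IsPath (a b c stk on : ℕ → ℕ) (p : ℕ) : Prop where
  isVertex : ∀ j, 1 ≤ j → j ≤ p → H.IsVertex (stk j)
  on_eq : ∀ j, 1 ≤ j → j ≤ p → on (stk j) = 1
  of_on : ∀ v, H.IsVertex v → on v ≠ 0 → (∃ j, 1 ≤ j ∧ j ≤ p ∧ stk j = v) ∨ a v = b v
  inj : ∀ i j, 1 ≤ i → i ≤ p → 1 ≤ j → j ≤ p → stk i = stk j → i = j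
  link : ∀ j, 1 ≤ j → j < p → a (stk j) = b (stk j) ∨
    (H.InTable b (c (stk j)) ∧ H.next b c (stk j) = stk (j + 1))

/-- The entries of the stack at positions above `k`, up to `p`. -/
def segment (stk : ℕ → ℕ) (k p : ℕ) : Set ℕ := {u | ∃ j, k < j ∧ j ≤ p ∧ stk j = u}

theorem segment_pred {stk : ℕ → ℕ} {k p : ℕ} (hk : 1 ≤ k) (hkp : k ≤ p) :
    segment stk (k - 1) p = insert (stk k) (segment stk k p) := by
  ext u
  constructor
  · rintro ⟨j, h1, h2, rfl⟩
    rcases (show k ≤ j by omega).eq_or_lt with h | h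
    · exact Or.inl (h ▸ rfl)
    · exact Or.inr ⟨j, h, h2, rfl⟩
  · rintro (rfl | ⟨j, h1, h2, rfl⟩)
    · exact ⟨k, by omega, hkp, rfl⟩
    · exact ⟨j, by omega, h2, rfl⟩

namespace IsPath

variable {a b c stk on : ℕ → ℕ} {p : ℕ} (hp : H.IsPath a b c stk on p)
include hp

theorem push {w : ℕ} (hw : H.IsVertex w) (hon : on w = 0)
    (hlink : 1 ≤ p → a (stk p) = b (stk p) ∨
      (H.InTable b (c (stk p)) ∧ H.next b c (stk p) = w)) :
    H.IsPath a b c (Function.update stk (p + 1) w) (Function.update on w 1) (p + 1) := by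
  have hs : ∀ j, j ≤ p → Function.update stk (p + 1) w j = stk j := fun j hj =>
    Function.update_of_ne (by omega) _ _
  have hne : ∀ j, 1 ≤ j → j ≤ p → stk j ≠ w := fun j h1 h2 h => by
    have := hp.on_eq j h1 h2
    rw [h, hon] at this
    omega
  have hcase : ∀ j, j ≤ p + 1 → j ≤ p ∨ j = p + 1 := fun j hj => by omega
  refine ⟨fun j h1 h2 => ?_, fun j h1 h2 => ?_, fun v hv hvon => ?_, fun i j h1 h2 h3 h4 h5 => ?_,
    fun j h1 h2 => ?_⟩
  · rcases hcase j h2 with h | rfl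
    · rw [hs j h]
      exact hp.isVertex j h1 h
    · simpa using hw
  · rcases hcase j h2 with h | rfl
    · rw [hs j h, Function.update_of_ne (hne j h1 h)]
      exact hp.on_eq j h1 h
    · simp
  · by_cases hvw : v = w
    · exact Or.inl ⟨p + 1, by omega, le_rfl, by simp [hvw]⟩
    · rw [Function.update_of_ne hvw] at hvon
      rcases hp.of_on v hv hvon with ⟨j, h1, h2, h3⟩ | h
      · exact Or.inl ⟨j, h1, by omega, by rw [hs j h2, h3]⟩
      · exact Or.inr h
  · rcases hcase i h2 with hi | rfl <;> rcases hcase j h4 with hj | rfl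
    · rw [hs i hi, hs j hj] at h5
      exact hp.inj i j h1 hi h3 hj h5
    · rw [hs i hi, Function.update_self] at h5
      exact absurd h5 (hne i h1 hi)
    · rw [hs j hj, Function.update_self] at h5
      exact absurd h5.symm (hne j h3 hj)
    · rfl
  · rw [hs j (by omega)]
    rcases (show j ≤ p by omega).lt_or_eq with h | rfl
    · rw [hs (j + 1) (by omega)]
      exact hp.link j h1 h
    · rw [Function.update_self]
      exact hlink h1

theorem pop (h : a (stk p) = b (stk p)) : H.IsPath a b c stk on (p - 1) := by
  refine ⟨fun j h1 h2 => hp.isVertex j h1 (by omega), fun j h1 h2 => hp.on_eq j h1 (by omega),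
    fun v hv hvon => ?_, fun i j h1 h2 h3 h4 h5 => hp.inj i j h1 (by omega) h3 (by omega) h5,
    fun j h1 h2 => hp.link j h1 (by omega)⟩
  rcases hp.of_on v hv hvon with ⟨j, h1, h2, rfl⟩ | h'
  · by_cases hj : j ≤ p - 1
    · exact Or.inl ⟨j, h1, hj, rfl⟩
    · obtain rfl : j = p := by omega
      exact Or.inr h
  · exact Or.inr h'

theorem advance (h1 : 1 ≤ p) (m : ℕ) :
    H.IsPath a b (Function.update c (stk p) m) stk on p := by
  refine ⟨hp.isVertex, hp.on_eq, hp.of_on, hp.inj, fun j h2 h3 => ?_⟩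
  have hne : stk j ≠ stk p := fun h => by
    have := hp.inj j p h2 h3.le h1 le_rfl h
    omega
  have hu : Function.update c (stk p) m (stk j) = c (stk j) := Function.update_of_ne hne _ _
  rw [next, hu]
  exact hp.link j h2 h3

variable (hr : H.Reduced a b c)
include hr

/-- The vertex at which the walk closes has two half-edges by `next_lt`, and this property passes
along the links. So the exceptional entries of the path do not occur on the cycle. -/
theorem segment_link (hp1 : 1 ≤ p) (hlt : a (stk p) < b (stk p)) (hc : H.InTable b (c (stk p)))
    {k : ℕ} (hk1 : 1 ≤ k) (hw : stk k = H.next b c (stk p)) {j : ℕ} (hkj : k ≤ j) (hjp : j ≤ p) :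
    a (stk j) < b (stk j) ∧
      (j < p → H.InTable b (c (stk j)) ∧ H.next b c (stk j) = stk (j + 1)) := by
  have hstep : ∀ i, k ≤ i → i < p → a (stk i) < b (stk i) →
      H.InTable b (c (stk i)) ∧ H.next b c (stk i) = stk (i + 1) := by
    intro i h1 h2 h3
    rcases hp.link i (by omega) h2 with h4 | h4
    · omega
    · exact h4
  suffices h : a (stk j) < b (stk j) from ⟨h, fun h' => hstep j hkj h' h⟩
  induction j, hkj using Nat.le_induction with
  | base =>
    rw [hw]
    exact hr.next_lt (hp.isVertex p hp1 le_rfl) hlt hc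
  | succ i hi ih =>
    have h1 := ih (by omega)
    have h2 := hstep i hi (by omega) h1
    rw [← h2.2]
    exact hr.next_lt (hp.isVertex i (by omega) (by omega)) h1 h2.1

theorem isRotation (hp1 : 1 ≤ p) (hlt : a (stk p) < b (stk p)) (hc : H.InTable b (c (stk p)))
    {k : ℕ} (hk1 : 1 ≤ k) (hkp : k ≤ p) (hw : stk k = H.next b c (stk p)) :
    H.IsRotation a b c (segment stk (k - 1) p) := by
  have hl : ∀ j, k ≤ j → j ≤ p → _ := fun j h1 h2 =>
    hp.segment_link hr hp1 hlt hc hk1 hw h1 h2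
  have hmem : ∀ j, k ≤ j → j ≤ p → stk j ∈ segment stk (k - 1) p := fun j h1 h2 =>
    ⟨j, by omega, h2, rfl⟩
  refine ⟨?_, ?_, ?_, ?_, ?_, ?_, ?_⟩
  · rintro _ ⟨j, h1, h2, rfl⟩
    exact hp.isVertex j (by omega) h2
  · rintro _ ⟨j, h1, h2, rfl⟩
    exact (hl j (by omega) h2).1
  · rintro _ ⟨j, h1, h2, rfl⟩
    rcases h2.lt_or_eq with h | rfl
    · exact ((hl j (by omega) h2).2 h).1
    · exact hc
  · rintro _ ⟨j, h1, h2, rfl⟩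
    rcases h2.lt_or_eq with h | rfl
    · rw [((hl j (by omega) h2).2 h).2]
      exact hmem _ (by omega) (by omega)
    · rw [← hw]
      exact hmem _ le_rfl hkp
  · rintro _ ⟨j, h1, h2, rfl⟩
    rcases (show k ≤ j by omega).eq_or_lt with rfl | h
    · exact ⟨_, hmem p hkp le_rfl, hw.symm⟩
    · refine ⟨_, hmem (j - 1) (by omega) (by omega), ?_⟩
      rw [((hl (j - 1) (by omega) (by omega)).2 (by omega)).2, Nat.sub_add_cancel (by omega)]
  · rintro _ ⟨i, h1, h2, rfl⟩ _ ⟨j, h3, h4, rfl⟩ h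
    rcases h2.lt_or_eq with hi | rfl <;> rcases h4.lt_or_eq with hj | rfl
    · rw [((hl i (by omega) h2).2 hi).2, ((hl j (by omega) h4).2 hj).2] at h
      have := hp.inj _ _ (by omega) (by omega) (by omega) (by omega) h
      rw [show i = j by omega]
    · rw [((hl i (by omega) h2).2 hi).2, ← hw] at h
      have := hp.inj _ _ (by omega) (by omega) (by omega) (by omega) h
      omega
    · rw [((hl j (by omega) h4).2 hj).2, ← hw] at h
      have := hp.inj _ _ (by omega) (by omega) (by omega) (by omega) h
      omega
    · rfl
  · intro A hA hback hne
    -- A set closed under predecessors contains, with any entry, all entries of the cycle below it.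
    -- From position `k` it wraps around to `p`, and hence is the whole cycle.
    have hdesc : ∀ d j, k ≤ j → j + d ≤ p → stk (j + d) ∈ A → stk j ∈ A := by
      intro d
      induction d with
      | zero => exact fun j _ _ h => h
      | succ d ih =>
        intro j h1 h2 h3
        apply ih j h1 (by omega)
        apply hback _ (hmem _ (by omega) (by omega))
        rw [((hl (j + d) (by omega) (by omega)).2 (by omega)).2]
        exact h3
    obtain ⟨u, hu⟩ := hne
    obtain ⟨j, h1, h2, rfl⟩ := hA hu
    have hkA : stk k ∈ A := hdesc (j - k) k le_rfl (by omega) (by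
      rwa [show k + (j - k) = j by omega])
    have hpA : stk p ∈ A := hback _ (hmem p hkp le_rfl) (hw ▸ hkA)
    refine Set.Subset.antisymm hA ?_
    rintro _ ⟨i, h3, h4, rfl⟩
    exact hdesc (p - i) i (by omega) (by omega) (by rwa [show i + (p - i) = p by omega])

/-- The path below the rotation is kept instead of being rebuilt, which the linear time bound needs.
Marked vertices off the path had a single half-edge, and still do. -/
theorem eliminate {k : ℕ} (hk1 : 1 ≤ k) (hkp : k ≤ p)
    {a' b' c' on' : ℕ → ℕ} (hC : H.IsRotation a b c (segment stk (k - 1) p))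
    (he : H.Eliminates a b c (segment stk (k - 1) p) a' b' c')
    (hle : ∀ u, H.IsVertex u → a' u ≤ b' u)
    (hon : ∀ u ∈ segment stk (k - 1) p, on' u = 0)
    (hon' : ∀ u, u ∉ segment stk (k - 1) p → on' u = on u) :
    H.IsPath a' b' c' stk on' (k - 1) := by
  have hnot : ∀ j, 1 ≤ j → j ≤ k - 1 → stk j ∉ segment stk (k - 1) p := by
    rintro j h1 h2 ⟨i, h3, h4, h5⟩
    have := hp.inj i j (by omega) h4 h1 (by omega) h5
    omega
  refine ⟨fun j h1 h2 => hp.isVertex j h1 (by omega), fun j h1 h2 => ?_, fun v hv hvon => ?_,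
    fun i j h1 h2 h3 h4 h5 => hp.inj i j h1 (by omega) h3 (by omega) h5, fun j h1 h2 => ?_⟩
  · rw [hon' _ (hnot j h1 h2)]
    exact hp.on_eq j h1 (by omega)
  · by_cases hvC : v ∈ segment stk (k - 1) p
    · exact absurd (hon v hvC) hvon
    · rw [hon' v hvC] at hvon
      rcases hp.of_on v hv hvon with ⟨j, h1, h2, rfl⟩ | h
      · refine Or.inl ⟨j, h1, ?_, rfl⟩
        by_contra hcon
        exact hvC ⟨j, by omega, h2, rfl⟩
      · exact Or.inr (Reduced.eliminates_single hC he h (hle v hv))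
  · have hV := hp.isVertex j h1 (by omega)
    rcases (hr.le_cutoff _ hV).eq_or_lt with h | h
    · exact Or.inl (Reduced.eliminates_single hC he h (hle _ hV))
    · rcases hp.link j h1 (by omega) with h3 | ⟨h3, h4⟩
      · omega
      · rw [← h4]
        refine hr.eliminates_link hC he hV (hnot j h1 (by omega)) h h3 ?_
        rw [h4]
        exact hnot _ (by omega) (by omega)

end IsPath

end HalfEdges

/-! ### Potentials. -/

/-- Both sides are sums because subtraction on `ℕ` truncates; linear arithmetic then yields decrease
and increase alike. -/
theorem Finset.sum_update_add {s : Finset ℕ} {x : ℕ} (hx : x ∈ s) (F : ℕ → ℕ → ℕ) (f : ℕ → ℕ)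
    (k : ℕ) : ∑ v ∈ s, F v (Function.update f x k v) + F x (f x) = ∑ v ∈ s, F v (f v) + F x k := by
  rw [← Finset.add_sum_erase s _ hx, ← Finset.add_sum_erase s (fun v => F v (f v)) hx,
    Finset.sum_congr rfl (g := fun v => F v (f v)) fun v hv => by
      rw [Function.update_of_ne (Finset.ne_of_mem_erase hv)]]
  simp only [Function.update_self]
  omega

namespace HalfEdges

/-- The number of half-edges. -/
def size (H : HalfEdges) : ℕ := ∑ v ∈ Finset.Icc 1 H.n, (H.last v + 1 - H.first v)

/-- The number of half-edges before the cutoffs. -/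
def cutoffPotential (H : HalfEdges) (b : ℕ → ℕ) : ℕ := ∑ v ∈ Finset.Icc 1 H.n, (b v - H.first v)

/-- The number of half-edges after the pointers. -/
def pointerPotential (H : HalfEdges) (a : ℕ → ℕ) : ℕ :=
  ∑ v ∈ Finset.Icc 1 H.n, (H.last v + 1 - a v)

variable {H : HalfEdges}

theorem cutoffPotential_le {b : ℕ → ℕ} (hb : ∀ v, H.IsVertex v → b v ≤ H.last v) :
    H.cutoffPotential b ≤ H.size :=
  Finset.sum_le_sum fun v hv => by
    have := hb v (Finset.mem_Icc.1 hv)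
    omega

theorem pointerPotential_le {a : ℕ → ℕ} (ha : ∀ v, H.IsVertex v → H.first v ≤ a v) :
    H.pointerPotential a ≤ H.size :=
  Finset.sum_le_sum fun v hv => by
    have := ha v (Finset.mem_Icc.1 hv)
    omega

theorem cutoffPotential_update {b : ℕ → ℕ} {v k : ℕ} (hv : H.IsVertex v) (hk : H.first v ≤ k)
    (hlt : k < b v) : H.cutoffPotential (Function.update b v k) + 1 ≤ H.cutoffPotential b := by
  have := Finset.sum_update_add (Finset.mem_Icc.2 hv) (fun v m => m - H.first v) b k
  simp only [cutoffPotential]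
  omega

theorem pointerPotential_update {a : ℕ → ℕ} {v k : ℕ} (hv : H.IsVertex v) (hk : a v < k)
    (hle : a v ≤ H.last v) :
    H.pointerPotential (Function.update a v k) + 1 ≤ H.pointerPotential a := by
  have := Finset.sum_update_add (Finset.mem_Icc.2 hv) (fun v m => H.last v + 1 - m) a k
  simp only [pointerPotential]
  omega

end HalfEdges

/-! ### The proposal phase on the machine. -/

namespace RAM

/-- The programs of a list one after the other. -/
def block : List Prog → Prog
  | [] => .skip
  | p :: ps => .seq p (block ps)

theorem vc_block_nil (W : ℕ) (Q : ℕ → State → Prop) (t : ℕ) (s : State) :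
    vc W (block []) Q t s = Q (t + 1) s := rfl

theorem vc_block_cons (W : ℕ) (p : Prog) (ps : List Prog) (Q : ℕ → State → Prop) (t : ℕ)
    (s : State) : vc W (block (p :: ps)) Q t s = vc W p (vc W (block ps) Q) t s := rfl

/-- Set register `x` to zero if the comparison holds. -/
def zeroIf (c : Test) (x : ℕ) : Prog := .ite c (.const x 0) .skip

open Classical in
-- Both branches take two steps, so they merge into one state with a conditional value and the
-- verification condition does not double.
theorem vc_zeroIf (W : ℕ) (c : Test) (x : ℕ) (Q : ℕ → State → Prop) (t : ℕ) (s : State) :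
    vc W (zeroIf c x) Q t s ↔
      Q (t + 2) (s.setReg x (if c.Holds s then 0 else s.reg x)) := by
  have hself : s.setReg x (s.reg x) = s := by
    simp [State.setReg]
  by_cases hc : c.Holds s
  · simp [zeroIf, vc, hc]
  · simp [zeroIf, vc, hc, hself]

/-! Banks: 0 input, 1 output, 2 twins, 3 owners, 4 cutoffs, 5 first pointers, 6 second pointers,
7 stack, 8 stack marks. Registers: 0 and 1 hold the constants zero and one, 2 holds the
number of vertices plus one, or zero after a failure. -/

open HalfEdges

/-- The constants and the half-edge structure are in place, and nothing has been output. -/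
structure Loaded (H : HalfEdges) (s : State) : Prop where
  zero : s.reg 0 = 0
  one : s.reg 1 = 1
  twin : s.mem 2 = H.twin
  owner : s.mem 3 = H.owner
  output : s.mem 1 = fun _ => 0

@[simp] theorem loaded_setReg {H : HalfEdges} {s : State} {x k : ℕ} (hx : 2 ≤ x) :
    Loaded H (s.setReg x k) ↔ Loaded H s := by
  have h0 : 0 ≠ x := by omega
  have h1 : 1 ≠ x := by omega
  constructor
  · rintro ⟨h2, h3, h4, h5, h6⟩
    exact ⟨by simpa [h0] using h2, by simpa [h1] using h3, h4, h5, h6⟩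
  · rintro ⟨h2, h3, h4, h5, h6⟩
    exact ⟨by simpa [h0] using h2, by simpa [h1] using h3, h4, h5, h6⟩

@[simp] theorem loaded_setMem {H : HalfEdges} {s : State} {b i k : ℕ} (hb : 4 ≤ b) :
    Loaded H (s.setMem b i k) ↔ Loaded H s := by
  have h1 : 1 ≠ b := by omega
  have h2 : 2 ≠ b := by omega
  have h3 : 3 ≠ b := by omega
  constructor
  · rintro ⟨h4, h5, h6, h7, h8⟩
    exact ⟨h4, h5, by simpa [h2] using h6, by simpa [h3] using h7, by simpa [h1] using h8⟩
  · rintro ⟨h4, h5, h6, h7, h8⟩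
    exact ⟨h4, h5, by simpa [h2] using h6, by simpa [h3] using h7, by simpa [h1] using h8⟩

@[simp] theorem owner_twin_eq_opp (H : HalfEdges) (h : ℕ) : H.owner (H.twin h) = H.opp h := rfl

/-- The vertex in register 4 proposes. -/
def proposeStep : Prog :=
  block [.load 6 5 4, .load 7 2 6, .load 8 3 7, .load 9 4 8,
    .ite (.lt 9 7) (block [.add 6 6 1, .store 5 4 6])
      (.ite (.eq 9 7) (.const 5 0) (block [.store 4 8 7, .load 6 2 9, .load 4 3 6]))]

/-- The proposal phase. -/
def propose : Prog :=
  block [.const 3 1, .loop (.lt 3 2)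
    (block [.move 4 3, .const 5 1, .loop (.lt 0 5) proposeStep, .add 3 3 1])]

/-- The invariant of the proposal phase: all vertices up to `i` but perhaps `x` are accepted. -/
structure ProposeInv (H : HalfEdges) (i : ℕ) (x : Option ℕ) (s : State) : Prop where
  loaded : Loaded H s
  limit : s.reg 2 = H.n + 1
  index : s.reg 3 = i
  marks : s.mem 8 = fun _ => 0
  proposing : H.Proposing (s.mem 5) (s.mem 4)
  accepted : ∀ u, H.IsVertex u → u ≤ i → (∀ y ∈ x, u ≠ y) → H.Accepted (s.mem 5) (s.mem 4) u

/-- Every round that continues a chain of proposals lowers a cutoff or advances a pointer, and so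
releases 20 steps, which cover the round. -/
def proposeCost (H : HalfEdges) (s : State) : ℕ :=
  20 * (H.cutoffPotential (s.mem 4) + H.pointerPotential (s.mem 5))

theorem wp_proposeChain {H : HalfEdges} {W T i t : ℕ} {s : State}
    (hW : ∀ v, H.IsVertex v → H.last v + 1 < W)
    (hx : H.IsVertex (s.reg 4)) (hinv : ProposeInv H i (some (s.reg 4)) s) (h5 : s.reg 5 = 1)
    (hT : t + proposeCost H s + 20 ≤ T) :
    WP W (.loop (.lt 0 5) proposeStep)
      (fun t s => ProposeInv H i none s ∧ t + proposeCost H s ≤ T) t s := by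
  refine WP.loop (fun t s => H.IsVertex (s.reg 4) ∧
    ((s.reg 5 = 1 ∧ ProposeInv H i (some (s.reg 4)) s ∧ t + proposeCost H s + 20 ≤ T) ∨
      (s.reg 5 = 0 ∧ ProposeInv H i none s ∧ t + proposeCost H s + 1 ≤ T))) T
    ⟨hx, Or.inl ⟨h5, hinv, hT⟩⟩ ?_ ?_ ?_
  · rintro t s ⟨-, ⟨-, -, h⟩ | ⟨-, -, h⟩⟩ <;> omega
  · rintro t s - ⟨hx, ⟨h5, hinv, hT⟩ | ⟨h5, hinv, hT⟩⟩ hc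
    · refine WP.of_vc ?_
      obtain ⟨hl, hlim, hi, hm, hp, hacc⟩ := hinv
      obtain ⟨hz, ho, htw, how, hout⟩ := id hl
      have hlast := hp.le_last _ hx
      have hWx := hW _ hx
      have hacc' : ∀ u, H.IsVertex u → u ≤ i → u ≠ s.reg 4 → H.Accepted (s.mem 5) (s.mem 4) u :=
        fun u h1 h2 h3 => hacc u h1 h2 (by simpa using h3)
      simp only [proposeStep, vc_block_cons, vc_block_nil, vc, Test.Holds]
      refine ⟨fun hc => ?_, fun hc => ⟨fun hc' => ?_, fun hc' => ?_⟩⟩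
      · simp [htw, how] at hc
        have h1 := hp.owner_of_ne hx hc.ne
        refine ⟨by simp [ho]; omega, by simpa using hx, Or.inl ⟨by simpa using h5,
          ⟨by simpa using hl, by simpa using hlim, by simpa using hi, by simpa using hm, ?_, ?_⟩,
          ?_⟩⟩
        · simpa [ho] using hp.advance hx hc
        · intro u h2 h3 h4
          simp at h4 ⊢
          rw [Accepted, Function.update_of_ne h4]
          exact hacc' u h2 h3 h4
        · have := pointerPotential_update hx (Nat.lt_add_one _) h1
          simp [proposeCost, ho] at hT ⊢
          omega
      -- Equality ends the chain in all its cases: the vertex already holds this cutoff, it has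
      -- reached its own loop with no proposal received, or it is exhausted and compares `0` with
      -- `0`.
      · simp [htw, how] at hc hc'
        refine ⟨Nat.zero_le _, by simpa using hx, Or.inr ⟨by simp,
          ⟨by simpa using hl, by simpa using hlim, by simpa using hi, by simpa using hm,
          by simpa using hp, ?_⟩, ?_⟩⟩
        · intro u h2 h3 h4
          simp
          by_cases h5 : u = s.reg 4
          · rw [h5]
            exact hc'
          · exact hacc' u h2 h3 h5
        · simp [proposeCost] at hT ⊢
          omega
      -- The displaced vertex is the other end of the old cutoff. If nobody had proposed yet, that
      -- cutoff was a loop and the chain goes on with the recipient itself.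
      · simp [htw, how] at hc hc'
        have hlt : H.twin (s.mem 5 (s.reg 4)) < s.mem 4 (H.opp (s.mem 5 (s.reg 4))) :=
          lt_of_le_of_ne hc (Ne.symm hc')
        have hax := hp.owner_eq hx (hp.owner_of_ne hx hc')
        have hv := isVertex_opp (hx.owner_ne hax)
        refine ⟨by simpa [htw, how] using hp.isVertex_opp_cutoff hv, Or.inl ⟨by simpa using h5,
          ⟨by simpa using hl, by simpa using hlim, by simpa using hi, by simpa using hm, ?_, ?_⟩,
          ?_⟩⟩
        · simpa [htw, how] using hp.accept hx hlt
        · intro u h2 h3 h4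
          simp [htw, how] at h4 ⊢
          exact hp.accepted_update hx hlt h2 (hacc' u h2 h3) h4
        · have := cutoffPotential_update hv ((hv.owner_eq_iff _).1 rfl).1 hlt
          simp [proposeCost, htw, how] at hT ⊢
          omega
    · simp [Test.Holds, h5, hinv.loaded.zero] at hc
  · rintro t s - ⟨hx, ⟨h5, hinv, hT⟩ | ⟨h5, hinv, hT⟩⟩ hc
    · simp [Test.Holds, h5, hinv.loaded.zero] at hc
    · exact ⟨hinv, by omega⟩

end RAM

namespace RAM

open HalfEdges

theorem wp_propose {H : HalfEdges} {W T t : ℕ} {s : State}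
    (hW : ∀ v, H.IsVertex v → H.last v + 1 < W) (hn : H.n + 1 ≤ W)
    (hl : Loaded H s) (h2 : s.reg 2 = H.n + 1) (h8 : s.mem 8 = fun _ => 0)
    (hp : H.Proposing (s.mem 5) (s.mem 4)) (hT : t + proposeCost H s + 40 * H.n + 10 ≤ T) :
    WP W propose (fun t s => Loaded H s ∧ s.reg 2 = H.n + 1 ∧ (s.mem 8 = fun _ => 0) ∧
      H.Proposing (s.mem 5) (s.mem 4) ∧
      (∀ u, H.IsVertex u → H.Accepted (s.mem 5) (s.mem 4) u) ∧ t ≤ T) t s := by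
  refine WP.of_vc ?_
  simp only [propose, vc_block_cons, vc]
  refine ⟨by omega, ?_⟩
  refine WP.loop (fun t s => Loaded H s ∧ s.reg 2 = H.n + 1 ∧ (s.mem 8 = fun _ => 0) ∧
    H.Proposing (s.mem 5) (s.mem 4) ∧ 1 ≤ s.reg 3 ∧ s.reg 3 ≤ H.n + 1 ∧
    (∀ u, H.IsVertex u → u < s.reg 3 → H.Accepted (s.mem 5) (s.mem 4) u) ∧
    t + proposeCost H s + 40 * (H.n + 1 - s.reg 3) + 5 ≤ T) T ?_ ?_ ?_ ?_
  · refine ⟨by simpa using hl, by simpa using h2, by simpa using h8, by simpa using hp, by simp,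
      by simp, ?_, ?_⟩
    · intro u hu h
      have := hu.1
      simp at h
      omega
    · simp [proposeCost] at hT ⊢
      omega
  · rintro t s ⟨-, -, -, -, -, -, -, h⟩
    omega
  · rintro t s - ⟨hl, h2, h8, hp, h31, h3n, hacc, hT⟩ hc
    simp only [Test.Holds] at hc
    refine WP.of_vc ?_
    simp only [vc_block_cons, vc]
    refine ⟨by omega, ?_⟩
    -- The chain may use everything except 40 steps for each later vertex and a margin for the end
    -- of the round.
    refine WP.conseq (wp_proposeChain (H := H) (i := s.reg 3)
      (T := T - 40 * (H.n + 1 - s.reg 3 - 1) - 10) hW ?_ ?_ ?_ ?_) ?_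
    · simp
      exact ⟨h31, by omega⟩
    · refine ⟨by simpa using hl, by simpa using h2, by simp, by simpa using h8, by simpa using hp,
        fun u hu h4 h5 => ?_⟩
      simp at h5 ⊢
      exact hacc u hu (by omega)
    · simp
    · simp [proposeCost] at hT ⊢
      omega
    · rintro t' s' - ⟨⟨hl', h2', h3', h8', hp', hacc'⟩, hT'⟩
      have ho := hl'.one
      refine ⟨by omega, by simpa using hl', by simpa using h2', by simpa using h8',
        by simpa using hp', by simp; omega, ?_, ?_, ?_⟩
      · simp
        omega
      · intro u hu h
        simp at h ⊢
        exact hacc' u hu (by omega) (by simp)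
      · simp [proposeCost] at hT' ⊢
        omega
  · rintro t s - ⟨hl, h2, h8, hp, h31, h3n, hacc, hT⟩ hc
    simp only [Test.Holds] at hc
    exact ⟨hl, h2, h8, hp, fun u hu => hacc u hu (by have := hu.2; omega), by omega⟩

/-- Initialize the second pointers, and fail if some vertex has no half-edge left. -/
def initSecond : Prog :=
  block [.const 3 1, .move 15 2, .loop (.lt 3 15)
    (block [.load 11 5 3, .load 12 4 3, zeroIf (.lt 12 11) 2, .add 11 11 1,
      .store 6 3 11, .add 3 3 1])]

theorem wp_initSecond {H : HalfEdges} {W T t : ℕ} {s : State}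
    (hW : ∀ v, H.IsVertex v → H.last v + 1 < W) (hn : H.n + 1 ≤ W)
    (hl : Loaded H s) (h2 : s.reg 2 = H.n + 1) (h8 : s.mem 8 = fun _ => 0)
    (hp : H.Proposing (s.mem 5) (s.mem 4))
    (hacc : ∀ u, H.IsVertex u → H.Accepted (s.mem 5) (s.mem 4) u) (hT : t + 20 * H.n + 10 ≤ T) :
    WP W initSecond (fun t s => Loaded H s ∧ (s.mem 8 = fun _ => 0) ∧ t ≤ T ∧
      ((s.reg 2 = H.n + 1 ∧ H.Reduced (s.mem 5) (s.mem 4) (s.mem 6)) ∨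
        (s.reg 2 = 0 ∧ ¬ ∃ μ, H.Stable μ))) t s := by
  refine WP.of_vc ?_
  simp only [initSecond, vc_block_cons, vc]
  refine ⟨by omega, ?_⟩
  -- Register 15 keeps the loop bound, since register 2 is cleared on failure while the loop runs
  -- on.
  refine WP.loop (fun t s => Loaded H s ∧ s.reg 15 = H.n + 1 ∧ (s.mem 8 = fun _ => 0) ∧
    H.Proposing (s.mem 5) (s.mem 4) ∧ 1 ≤ s.reg 3 ∧ s.reg 3 ≤ H.n + 1 ∧
    (∀ u, H.IsVertex u → H.Accepted (s.mem 5) (s.mem 4) u) ∧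
    ((s.reg 2 = H.n + 1 ∧ (∀ u, H.IsVertex u → u < s.reg 3 → s.mem 5 u ≤ s.mem 4 u) ∧
      ∀ u, H.IsVertex u → u < s.reg 3 → s.mem 6 u = s.mem 5 u + 1) ∨
        (s.reg 2 = 0 ∧ ¬ ∃ μ, H.Stable μ)) ∧
    t + 20 * (H.n + 1 - s.reg 3) + 5 ≤ T) T ?_ ?_ ?_ ?_
  · refine ⟨by simpa using hl, by simpa using h2, by simpa using h8, by simpa using hp, by simp,
      by simp, by simpa using hacc, Or.inl ⟨by simpa using h2, ?_, ?_⟩, ?_⟩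
    · intro u hu h
      have := hu.1
      simp at h
      omega
    · intro u hu h
      have := hu.1
      simp at h
      omega
    · simp
      omega
  · rintro t s ⟨-, -, -, -, -, -, -, -, h⟩
    omega
  · rintro t s - ⟨hl, h15, h8, hp, h31, h3n, hacc, hst, hT⟩ hc
    simp only [Test.Holds] at hc
    have ho := hl.one
    have hi : H.IsVertex (s.reg 3) := ⟨h31, by omega⟩
    have hle := hp.le_last _ hi
    -- An exhausted pointer is `last + 1`, and the second pointer is stored one beyond it; hence the
    -- strict inequality in `hW`.
    have hWi := hW _ hi
    refine WP.of_vc ?_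
    simp only [vc_block_cons, vc_block_nil, zeroIf, vc, Test.Holds]
    refine ⟨fun hc' => ⟨Nat.zero_le _, ?_⟩, fun hc' => ?_⟩
    · simp at hc'
      refine ⟨by simp; omega, by simp; omega, by simpa using hl, by simpa using h15,
        by simpa using h8, by simpa using hp, by simp; omega, by simp; omega, by simpa using hacc,
        Or.inr ⟨by simp, fun ⟨μ, hμ⟩ => hp.not_stable hi hc' μ hμ⟩, by simp; omega⟩
    · simp at hc'
      refine ⟨by simp; omega, by simp; omega, by simpa using hl, by simpa using h15,
        by simpa using h8, by simpa using hp, by simp; omega, by simp; omega, by simpa using hacc,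
        ?_, by simp; omega⟩
      rcases hst with ⟨h4, h5, h6⟩ | ⟨h4, h5⟩
      · refine Or.inl ⟨by simpa using h4, ?_, ?_⟩
        · intro u hu h
          simp [ho] at h ⊢
          rcases (show u < s.reg 3 ∨ u = s.reg 3 by omega) with h7 | rfl
          · exact h5 u hu h7
          · exact hc'
        · intro u hu h
          simp [ho] at h ⊢
          rcases (show u < s.reg 3 ∨ u = s.reg 3 by omega) with h7 | rfl
          · rw [Function.update_of_ne h7.ne]
            exact h6 u hu h7
          · simp
      · exact Or.inr ⟨by simpa using h4, h5⟩
  · rintro t s - ⟨hl, h15, h8, hp, h31, h3n, hacc, hst, hT⟩ hc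
    simp only [Test.Holds] at hc
    refine ⟨hl, h8, by omega, ?_⟩
    rcases hst with ⟨h4, h5, h6⟩ | h4
    · have hlt : ∀ u, H.IsVertex u → u < s.reg 3 := fun u hu => by
        have := hu.2
        omega
      exact Or.inl ⟨h4, hp.reduced (fun u hu => h5 u hu (hlt u hu)) hacc
        fun u hu => h6 u hu (hlt u hu)⟩
    · exact Or.inr h4

end RAM

/-! ### The rotation phase on the machine. -/

namespace HalfEdges

variable {H : HalfEdges}

/-- Members are popped one at a time, from the top of the stack. Injectivity of `next` makes the
other ends of their second choices distinct, so the data read for the next member are still those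
from before the elimination. -/
theorem Eliminates.pop {a b c a' b' c' stk on : ℕ → ℕ} {k p p' : ℕ}
    (hp : H.IsPath a b c stk on p) (hC : H.IsRotation a b c (segment stk (k - 1) p))
    (hk : 1 ≤ k) (hkp : k ≤ p') (hpp : p' ≤ p)
    (he : H.Eliminates a b c (segment stk p' p) a' b' c') :
    stk p' ∉ segment stk p' p ∧ c' (stk p') = c (stk p') ∧ a' (stk p') = a (stk p') ∧
      b' (H.opp (c (stk p'))) = b (H.opp (c (stk p'))) ∧
      H.Eliminates a b c (segment stk (p' - 1) p) (Function.update a' (stk p') (c (stk p')))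
        (Function.update b' (H.opp (c (stk p'))) (H.twin (c (stk p'))))
        (Function.update c' (stk p') (c (stk p') + 1)) := by
  have hx : stk p' ∉ segment stk p' p := by
    rintro ⟨j, h1, h2, h3⟩
    have := hp.inj j p' (by omega) h2 (by omega) hpp h3
    omega
  have hxC : stk p' ∈ segment stk (k - 1) p := ⟨p', by omega, hpp, rfl⟩
  have hne : ∀ u ∈ segment stk p' p, H.opp (c u) ≠ H.opp (c (stk p')) := by
    rintro u ⟨j, h1, h2, rfl⟩ h
    have h3 := hC.next_inj _ ⟨j, by omega, h2, rfl⟩ _ hxC (by rw [next, next, h])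
    exact hx (h3 ▸ ⟨j, h1, h2, rfl⟩)
  refine ⟨hx, he.second_not_mem _ hx, he.first_not_mem _ hx, he.cutoff_not_mem _ hne, ?_⟩
  rw [segment_pred (by omega) hpp]
  exact he.insert hx hne

variable (H) in
/-- The register value `r` tells whether all first pointers are within the cutoffs. -/
def Status (a b : ℕ → ℕ) (r : ℕ) : Prop :=
  (r = H.n + 1 ∧ ∀ u, H.IsVertex u → a u ≤ b u) ∨ (r = 0 ∧ ∃ u, H.IsVertex u ∧ b u < a u)

/-- Pointers rise and cutoffs fall, so a failure persists, and a new one can appear only at `x` or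
at `v`. Two comparisons therefore replace a scan of all vertices. -/
theorem Status.update {a b : ℕ → ℕ} {r x v h t : ℕ} (hs : H.Status a b r) (hx : H.IsVertex x)
    (hv : H.IsVertex v) (hh : a x ≤ h) (ht : t ≤ b v) {r' : ℕ}
    (hr : r' = if Function.update b v t x < h ∨ t < a v then 0 else r) :
    H.Status (Function.update a x h) (Function.update b v t) r' := by
  have ha : ∀ u, a u ≤ Function.update a x h u := fun u => by
    rw [Function.update_apply]
    split_ifs with hu
    · rwa [hu]
    · exact le_rfl
  have hb : ∀ u, Function.update b v t u ≤ b u := fun u => by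
    rw [Function.update_apply]
    split_ifs with hu
    · rwa [hu]
    · exact le_rfl
  split_ifs at hr with hcase
  · refine Or.inr ⟨hr, ?_⟩
    rcases hcase with h1 | h1
    · exact ⟨x, hx, by rwa [Function.update_self]⟩
    · refine ⟨v, hv, ?_⟩
      rw [Function.update_self]
      exact h1.trans_le (ha v)
  · push Not at hcase
    rcases hs with ⟨h1, h2⟩ | ⟨h1, u, h2, h3⟩
    · refine Or.inl ⟨hr.trans h1, fun u hu => ?_⟩
      by_cases hux : u = x
      · rw [hux, Function.update_self]
        exact hcase.1
      · rw [Function.update_of_ne hux]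
        by_cases huv : u = v
        · rw [huv, Function.update_self]
          exact hcase.2
        · rw [Function.update_of_ne huv]
          exact h2 u hu
    · exact Or.inr ⟨hr.trans h1, u, h2, (hb u).trans_lt (h3.trans_le (ha u))⟩

/-- The number of vertices without a mark. -/
def markPotential (H : HalfEdges) (on : ℕ → ℕ) : ℕ := ∑ v ∈ Finset.Icc 1 H.n, (1 - on v)

theorem markPotential_le (H : HalfEdges) (on : ℕ → ℕ) : H.markPotential on ≤ H.n := by
  refine (Finset.sum_le_card_nsmul _ _ 1 fun v _ => by omega).trans ?_
  simp

theorem markPotential_mark {on : ℕ → ℕ} {v : ℕ} (hv : H.IsVertex v) (h : on v = 0) :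
    H.markPotential (Function.update on v 1) + 1 = H.markPotential on := by
  have := Finset.sum_update_add (Finset.mem_Icc.2 hv) (fun _ m => 1 - m) on 1
  simp only [markPotential]
  omega

theorem markPotential_unmark {on : ℕ → ℕ} {v : ℕ} (hv : H.IsVertex v) :
    H.markPotential (Function.update on v 0) ≤ H.markPotential on + 1 := by
  have := Finset.sum_update_add (Finset.mem_Icc.2 hv) (fun _ m => 1 - m) on 0
  simp only [markPotential]
  omega

end HalfEdges

namespace RAM

open HalfEdges

/-- Pop the vertices of a rotation, down to the one in register 13, and match them along their
second choices. -/
def rotate : Prog :=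
  block [.const 5 1, .loop (.lt 0 5)
    (block [.load 4 7 10, .sub 10 10 1, .store 8 4 0, .load 6 6 4, .load 7 2 6, .load 8 3 7,
      .store 4 8 7, .load 11 5 8, zeroIf (.lt 7 11) 2, .store 5 4 6, .load 12 4 4,
      zeroIf (.lt 12 6) 2, .add 6 6 1, .store 6 4 6,
      zeroIf (.eq 4 13) 5])]

/-- The potential of the rotation phase. -/
def rotationCost (H : HalfEdges) (s : State) : ℕ :=
  150 * H.cutoffPotential (s.mem 4) + 30 * H.pointerPotential (s.mem 6) +
    50 * H.markPotential (s.mem 8) + 20 * s.reg 10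

/-- The invariant of `rotate`. -/
structure RotateInv (H : HalfEdges) (a b c stk on : ℕ → ℕ) (i k p : ℕ) (s : State) : Prop where
  loaded : Loaded H s
  index : s.reg 3 = i
  stack : s.mem 7 = stk
  target : s.reg 13 = stk k
  height : s.reg 10 ≤ p
  eliminates : H.Eliminates a b c (segment stk (s.reg 10) p) (s.mem 5) (s.mem 4) (s.mem 6)
  status : H.Status (s.mem 5) (s.mem 4) (s.reg 2)
  marks_mem : ∀ u ∈ segment stk (s.reg 10) p, s.mem 8 u = 0
  marks_not_mem : ∀ u, u ∉ segment stk (s.reg 10) p → s.mem 8 u = on u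

theorem rotateInv_step {H : HalfEdges} {W T i k p t : ℕ} {a b c stk on : ℕ → ℕ} {s : State}
    (hW : ∀ v, H.IsVertex v → H.last v + 1 < W)
    (hr : H.Reduced a b c) (hp : H.IsPath a b c stk on p) (hk : 1 ≤ k)
    (hC : H.IsRotation a b c (segment stk (k - 1) p))
    (h5 : s.reg 5 = 1) (hkp : k ≤ s.reg 10) (hinv : RotateInv H a b c stk on i k p s)
    (hT : t + rotationCost H s + 40 * (p - s.reg 10) + 5 ≤ T) :
    WP W (block [.load 4 7 10, .sub 10 10 1, .store 8 4 0, .load 6 6 4, .load 7 2 6, .load 8 3 7,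
      .store 4 8 7, .load 11 5 8, zeroIf (.lt 7 11) 2, .store 5 4 6, .load 12 4 4,
      zeroIf (.lt 12 6) 2, .add 6 6 1, .store 6 4 6,
      zeroIf (.eq 4 13) 5])
      (fun t s => RotateInv H a b c stk on i k p s ∧
        ((s.reg 5 = 1 ∧ k ≤ s.reg 10) ∨ (s.reg 5 = 0 ∧ s.reg 10 = k - 1)) ∧
        t + rotationCost H s + 40 * (p - s.reg 10) + 5 ≤ T) (t + 1) s := by
  obtain ⟨hl, hi, hstk, htar, hpp, he, hst, hm1, hm2⟩ := hinv
  obtain ⟨hz, ho, htw, how, hout⟩ := id hl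
  obtain ⟨hx, hcx, hax, hbv, he'⟩ := Eliminates.pop hp hC hk hkp hpp he
  have hxC : stk (s.reg 10) ∈ segment stk (k - 1) p := ⟨s.reg 10, by omega, hpp, rfl⟩
  have hxV := hC.isVertex _ hxC
  have hxlt := hC.lt _ hxC
  have hxT := hC.inTable _ hxC
  have htlt := hr.twin_second_lt hxV hxlt hxT
  have hvV := isVertex_opp hxT.1
  have hown := (hxV.owner_eq_iff _).1 (hr.owner_second hxV hxlt)
  have hWx := hW _ hxV
  have hac := hr.lt_second _ hxV
  have hpop := segment_pred (stk := stk) (k := s.reg 10) (p := p) (by omega) hpp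
  have hc1 := cutoffPotential_update (b := s.mem 4) hvV ((hvV.owner_eq_iff _).1 rfl).1
    (show H.twin (c (stk (s.reg 10))) < _ by rwa [hbv])
  have hc2 := pointerPotential_update (a := s.mem 6) (k := c (stk (s.reg 10)) + 1) hxV (by omega)
    (by omega)
  have hc3 := markPotential_unmark (on := s.mem 8) hxV
  -- The round is summarized by the final contents of the banks and registers, so that the symbolic
  -- execution below has only equations to verify.
  have hfin : ∀ r f T' s', s'.mem 8 = Function.update (s.mem 8) (stk (s.reg 10)) 0 →
      s'.mem 5 = Function.update (s.mem 5) (stk (s.reg 10)) (c (stk (s.reg 10))) →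
      s'.mem 4 = Function.update (s.mem 4) (H.opp (c (stk (s.reg 10))))
        (H.twin (c (stk (s.reg 10)))) →
      s'.mem 6 = Function.update (s.mem 6) (stk (s.reg 10)) (c (stk (s.reg 10)) + 1) →
      s'.reg 10 = s.reg 10 - 1 → s'.reg 2 = r → s'.reg 5 = f → Loaded H s' → s'.reg 3 = i →
      s'.mem 7 = stk → s'.reg 13 = stk k →
      (r = if s'.mem 4 (stk (s.reg 10)) < c (stk (s.reg 10)) ∨
        H.twin (c (stk (s.reg 10))) < s.mem 5 (H.opp (c (stk (s.reg 10)))) then 0 else s.reg 2) →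
      (f = if stk (s.reg 10) = stk k then 0 else 1) → T' ≤ t + 30 →
      RotateInv H a b c stk on i k p s' ∧
        ((s'.reg 5 = 1 ∧ k ≤ s'.reg 10) ∨ (s'.reg 5 = 0 ∧ s'.reg 10 = k - 1)) ∧
        T' + rotationCost H s' + 40 * (p - s'.reg 10) + 5 ≤ T := by
    intro r f T' s' e8 e5 e4 e6 e10 e2 e5' hl' e3 e7 e13 er ef hT'
    refine ⟨⟨hl', e3, e7, e13, by omega, ?_, ?_, ?_, ?_⟩, ?_, ?_⟩
    · rw [e5, e4, e6, e10]
      exact he'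
    · rw [e5, e4, e2]
      rw [e4] at er
      exact hst.update hxV hvV (by omega) (by omega) er
    · rw [e8, e10, hpop]
      rintro u (rfl | hu)
      · simp
      · rw [Function.update_of_ne (ne_of_mem_of_not_mem hu hx)]
        exact hm1 u hu
    · rw [e8, e10, hpop]
      intro u hu
      rw [Set.mem_insert_iff, not_or] at hu
      rw [Function.update_of_ne hu.1]
      exact hm2 u hu.2
    · rw [e5', e10, ef]
      split_ifs with h
      · right
        have := hp.inj _ _ (by omega) hpp hk (by omega) h
        omega
      · left
        have : s.reg 10 ≠ k := fun h' => h (by rw [h'])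
        omega
    · rw [rotationCost] at hT ⊢
      rw [e4, e6, e8, e10]
      omega
  refine WP.of_vc ?_
  simp only [vc_block_cons, vc_block_nil, vc_zeroIf, vc, Test.Holds]
  refine ⟨by simp [hstk, htw, how, hcx, ho]; omega, ?_⟩
  refine hfin _ _ _ _ ?_ ?_ ?_ ?_ ?_ rfl rfl ?_ ?_ ?_ ?_ ?_ ?_ ?_
  · simp [hstk, hz]
  · simp [hstk, hcx]
  · simp [hstk, htw, how, hcx]
  · simp [hstk, hcx, ho]
  · simp [ho]
  · simpa using hl
  · simpa using hi
  · simpa using hstk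
  · simpa using htar
  · simp [hstk, htw, how, hcx, ite_or]
  · simp [hstk, htar, h5]
  · omega

end RAM

namespace RAM

open HalfEdges

theorem vc_rotate {H : HalfEdges} {W T i k p t : ℕ} {a b c stk on : ℕ → ℕ} {s : State}
    (hW : ∀ v, H.IsVertex v → H.last v + 1 < W) (hW1 : 1 ≤ W)
    (hr : H.Reduced a b c) (hp : H.IsPath a b c stk on p) (hk : 1 ≤ k) (hkp : k ≤ p)
    (hC : H.IsRotation a b c (segment stk (k - 1) p)) (h10 : s.reg 10 = p)
    (hinv : RotateInv H a b c stk on i k p s) (hT : t + rotationCost H s + 6 ≤ T)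
    {Q : ℕ → State → Prop} (hQ : ∀ t s, RotateInv H a b c stk on i k p s → s.reg 10 = k - 1 →
      t + rotationCost H s + 40 ≤ T → Q t s) : vc W rotate Q t s := by
  simp only [rotate, vc_block_cons, vc]
  refine ⟨hW1, ?_⟩
  -- A pop releases at least 150 units: 150 from the cutoff, 30 from the pointer and 20 from the
  -- height, less at most 50 for the mark. This covers the round and puts 40 aside; as `k ≤ p`, at
  -- least one pop occurs, which leaves 40 on exit.
  refine WP.loop (fun t s => RotateInv H a b c stk on i k p s ∧
    ((s.reg 5 = 1 ∧ k ≤ s.reg 10) ∨ (s.reg 5 = 0 ∧ s.reg 10 = k - 1)) ∧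
    t + rotationCost H s + 40 * (p - s.reg 10) + 5 ≤ T) T ?_ ?_ ?_ ?_
  · obtain ⟨h1, h2, h3, h4, h5, h6, h7, h8, h9⟩ := hinv
    refine ⟨⟨by simpa using h1, by simpa using h2, by simpa using h3, by simpa using h4,
      by simpa using h5, by simpa using h6, by simpa using h7, by simpa using h8,
      by simpa using h9⟩, Or.inl ⟨by simp, by simpa [h10] using hkp⟩, ?_⟩
    simp [rotationCost, h10] at hT ⊢
    omega
  · rintro t s ⟨-, -, h⟩
    omega
  · rintro t s - ⟨hinv, ⟨h5, h10⟩ | ⟨h5, h10⟩, hT⟩ hc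
    · exact rotateInv_step hW hr hp hk hC h5 h10 hinv hT
    · simp [Test.Holds, h5, hinv.loaded.zero] at hc
  · rintro t s - ⟨hinv, ⟨h5, h10⟩ | ⟨h5, h10⟩, hT⟩ hc
    · simp [Test.Holds, h5, hinv.loaded.zero] at hc
    · exact hQ _ _ hinv h10 (by omega)

/-- One step of the rotation phase: extend or shorten the path, or eliminate a rotation. -/
def rotationStep : Prog :=
  .ite (.lt 0 10)
    (block [.load 4 7 10, .load 11 5 4, .load 12 4 4,
      .ite (.lt 11 12)
        (block [.load 6 6 4, .load 7 2 6, .load 8 3 7, .load 9 4 8,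
          .ite (.lt 9 7) (block [.add 6 6 1, .store 6 4 6])
            (block [.load 7 2 9, .load 13 3 7, .load 14 8 13,
              .ite (.eq 14 0) (block [.add 10 10 1, .store 7 10 13, .store 8 13 1]) rotate])])
        (.sub 10 10 1)])
    (block [.load 11 5 3, .load 12 4 3,
      .ite (.lt 11 12) (block [.const 10 1, .store 7 10 3, .store 8 3 1]) (.add 3 3 1)])

/-- The rotation phase. -/
def rotations : Prog := block [.const 3 1, .const 10 0, .loop (.lt 3 2) rotationStep]

/-- The invariant of the rotation phase: either it is in progress, or it has failed. -/
def RotationsInv (H : HalfEdges) (T t : ℕ) (s : State) : Prop :=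
  Loaded H s ∧
    ((s.reg 2 = H.n + 1 ∧ 1 ≤ s.reg 3 ∧ s.reg 3 ≤ H.n + 1 ∧
        H.Reduced (s.mem 5) (s.mem 4) (s.mem 6) ∧
        H.IsPath (s.mem 5) (s.mem 4) (s.mem 6) (s.mem 7) (s.mem 8) (s.reg 10) ∧
        (∀ u, H.IsVertex u → u < s.reg 3 → s.mem 5 u = s.mem 4 u) ∧
        t + rotationCost H s + 20 * (H.n + 1 - s.reg 3) + 5 ≤ T) ∨
      (s.reg 2 = 0 ∧ (¬ ∃ μ, H.Stable μ) ∧ t + 2 ≤ T))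

theorem wp_rotationStep {H : HalfEdges} {W T t : ℕ} {s : State}
    (hW : ∀ v, H.IsVertex v → H.last v + 1 < W) (hn : H.n + 1 ≤ W) (hTW : T ≤ W)
    (hl : Loaded H s) (h2 : s.reg 2 = H.n + 1) (h31 : 1 ≤ s.reg 3) (h3n : s.reg 3 ≤ H.n)
    (hr : H.Reduced (s.mem 5) (s.mem 4) (s.mem 6))
    (hp : H.IsPath (s.mem 5) (s.mem 4) (s.mem 6) (s.mem 7) (s.mem 8) (s.reg 10))
    (hdone : ∀ u, H.IsVertex u → u < s.reg 3 → s.mem 5 u = s.mem 4 u)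
    (hT : t + rotationCost H s + 20 * (H.n + 1 - s.reg 3) + 5 ≤ T) :
    WP W rotationStep (RotationsInv H T) (t + 1) s := by
  obtain ⟨hz, ho, htw, how, hout⟩ := id hl
  have hi : H.IsVertex (s.reg 3) := ⟨h31, h3n⟩
  refine WP.of_vc ?_
  simp only [rotationStep, vc_block_cons, vc_block_nil, vc, Test.Holds]
  refine ⟨fun hc1 => ⟨fun hc2 => ⟨fun hc3 => ?_, fun hc3 => ⟨fun hc4 => ?_, fun hc4 => ?_⟩⟩,
    fun hc2 => ?_⟩, fun hc1 => ⟨fun hc2 => ?_, fun hc2 => ?_⟩⟩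
  · simp [htw, how, hz] at hc1 hc2 hc3
    have hx := hp.isVertex _ hc1 le_rfl
    have hWx := hW _ hx
    have hown := (hx.owner_eq_iff _).1 (hr.owner_second hx hc2)
    have := pointerPotential_update (a := s.mem 6) hx (Nat.lt_add_one _) hown.2
    refine ⟨by simp [ho]; omega, by simpa using hl, Or.inl ⟨by simpa using h2, by simpa using h31,
      by simp; omega, ?_, ?_, by simpa using hdone, ?_⟩⟩
    · simpa [ho] using hr.advance hx hc2 hc3
    · simpa [ho] using hp.advance hc1 _
    · simp [rotationCost, ho] at hT ⊢
      omega
  · simp [htw, how, hz] at hc1 hc2 hc3 hc4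
    have hx := hp.isVertex _ hc1 le_rfl
    have hxT := hr.inTable_second hx hc2 hc3
    have hw := hr.isVertex_next hx hc2
    have := markPotential_mark hw hc4
    refine ⟨?_, by simpa using hl, Or.inl ⟨by simpa using h2, by simpa using h31,
      by simp; omega, by simpa using hr, ?_, by simpa using hdone, ?_⟩⟩
    -- The stack height fits into a word because the potential contains it 20 times and `T ≤ W`.
    · simp [ho]
      simp [rotationCost] at hT
      omega
    · simpa [next, ho, htw, how] using hp.push hw hc4 fun _ => Or.inr ⟨hxT, rfl⟩
    · simp [rotationCost, ho, htw, how] at hT ⊢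
      simp [next] at this
      omega
  · simp [htw, how, hz] at hc1 hc2 hc3 hc4
    have hx := hp.isVertex _ hc1 le_rfl
    have hxT := hr.inTable_second hx hc2 hc3
    have hw := hr.isVertex_next hx hc2
    have hwlt := hr.next_lt hx hc2 hxT
    -- A marked vertex off the path has a single half-edge, which `next_lt` excludes here. So the
    -- walk has returned to a vertex of the path.
    rcases hp.of_on _ hw hc4 with ⟨k, hk1, hkp, hk⟩ | h
    swap
    · omega
    have hC := hp.isRotation hr hc1 hc2 hxT hk1 hkp hk
    -- The 18 extra steps cover the instructions before `rotate`; the 40 that it leaves over repay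
    -- them.
    refine vc_rotate (i := s.reg 3) (k := k)
      (T := T + 18 - 20 * (H.n + 1 - s.reg 3)) hW (by omega) hr hp hk1 hkp hC ?_ ?_ ?_ ?_
    · simp
    · refine ⟨by simpa using hl, by simp, by simp, ?_, by simp, ?_, ?_, ?_, ?_⟩
      · simpa [next, htw, how] using hk.symm
      · have : segment (s.mem 7) (s.reg 10) (s.reg 10) = ∅ := by
          ext u
          simp only [Set.mem_empty_iff_false, iff_false]
          rintro ⟨j, h1, h2, -⟩
          omega
        simpa [this] using Eliminates.empty H (s.mem 5) (s.mem 4) (s.mem 6)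
      · exact Or.inl ⟨by simpa using h2, by simpa using hr.le_cutoff⟩
      · rintro u ⟨j, h1, h2, -⟩
        simp at h1
        omega
      · simp
    · simp [rotationCost] at hT ⊢
      omega
    · rintro t' s' ⟨hl', h3', h7', -, -, he', hst', hm1', hm2'⟩ h10' hT'
      simp only [vc_block_nil]
      rw [h10'] at he' hm1' hm2'
      refine ⟨hl', ?_⟩
      rcases hst' with ⟨h2', hle⟩ | ⟨h2', u, hu, hlt⟩
      · refine Or.inl ⟨h2', by omega, by omega, hr.eliminates_reduced hC he' hle, ?_, ?_, by omega⟩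
        · rw [h10', h7']
          exact hp.eliminate hr hk1 hkp hC he' hle hm1' hm2'
        · intro u hu h
          exact Reduced.eliminates_single hC he' (hdone u hu (by omega)) (hle u hu)
      · exact Or.inr ⟨h2', hr.eliminates_not_stable hC he' hu hlt, by omega⟩
  · simp [hz] at hc1 hc2
    have hx := hp.isVertex _ hc1 le_rfl
    refine ⟨by simpa using hl, Or.inl ⟨by simpa using h2, by simpa using h31,
      by simp; omega, by simpa using hr, ?_, by simpa using hdone, ?_⟩⟩
    · simpa [ho] using hp.pop (le_antisymm (hr.le_cutoff _ hx) hc2)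
    · simp [rotationCost, ho] at hT ⊢
      omega
  · simp [hz] at hc1 hc2
    -- On an empty path, a mark would mean a single half-edge.
    have hon : s.mem 8 (s.reg 3) = 0 := by
      by_contra h
      rcases hp.of_on _ hi h with ⟨j, h4, h5, -⟩ | h4 <;> omega
    have := markPotential_mark hi hon
    rw [hc1] at hp
    refine ⟨by omega, by simpa using hl, Or.inl ⟨by simpa using h2, by simpa using h31,
      by simp; omega, by simpa using hr, ?_, by simpa using hdone, ?_⟩⟩
    · simpa [ho] using hp.push hi hon (by omega)
    · simp [rotationCost, ho] at hT ⊢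
      omega
  · simp [hz] at hc1 hc2
    refine ⟨by simp [ho]; omega, by simpa using hl, Or.inl ⟨by simpa using h2, by simp; omega,
      by simp; omega, by simpa using hr, by simpa using hp, ?_, ?_⟩⟩
    · intro u hu h
      simp [ho] at h ⊢
      rcases (show u < s.reg 3 ∨ u = s.reg 3 by omega) with h4 | rfl
      · exact hdone u hu h4
      · exact le_antisymm (hr.le_cutoff _ hi) hc2
    · simp [rotationCost, ho] at hT ⊢
      omega

theorem wp_rotations {H : HalfEdges} {W T t : ℕ} {s : State}
    (hW : ∀ v, H.IsVertex v → H.last v + 1 < W) (hn : H.n + 1 ≤ W) (hTW : T ≤ W)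
    (hl : Loaded H s) (h8 : s.mem 8 = fun _ => 0)
    (hst : (s.reg 2 = H.n + 1 ∧ H.Reduced (s.mem 5) (s.mem 4) (s.mem 6)) ∨
      (s.reg 2 = 0 ∧ ¬ ∃ μ, H.Stable μ)) (hT : t + 180 * H.size + 70 * H.n + 20 ≤ T) :
    WP W rotations (fun t s => Loaded H s ∧ t ≤ T ∧
      ((s.reg 2 = H.n + 1 ∧ H.Stable (s.mem 4)) ∨ (s.reg 2 = 0 ∧ ¬ ∃ μ, H.Stable μ))) t s := by
  refine WP.of_vc ?_
  simp only [rotations, vc_block_cons, vc]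
  refine ⟨by omega, by omega, ?_⟩
  refine WP.loop (RotationsInv H T) T ?_ ?_ ?_ ?_
  · refine ⟨by simpa using hl, ?_⟩
    rcases hst with ⟨h2, hr⟩ | ⟨h2, hns⟩
    · refine Or.inl ⟨by simpa using h2, by simp, by simp, by simpa using hr, ?_, ?_, ?_⟩
      · exact ⟨fun j h1 h3 => by simp at h3; omega, fun j h1 h3 => by simp at h3; omega,
          fun v _ hv => by simp [h8] at hv, fun i j h1 h3 => by simp at h3; omega,
          fun j h1 h3 => by simp at h3⟩
      · intro u hu h
        have := hu.1
        simp at h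
        omega
      · have h3 := cutoffPotential_le (H := H) (b := s.mem 4) fun v hv =>
          ((hv.owner_eq_iff _).1 (hr.owner_cutoff v hv)).2
        have h4 := pointerPotential_le (H := H) (a := s.mem 6) fun v hv =>
          ((hv.owner_eq_iff _).1 (hr.owner_first v hv)).1.trans (hr.lt_second v hv).le
        have h5 := H.markPotential_le (s.mem 8)
        simp [rotationCost]
        omega
    · exact Or.inr ⟨by simpa using h2, hns, by omega⟩
  · rintro t s ⟨-, ⟨-, -, -, -, -, -, h⟩ | ⟨-, -, h⟩⟩ <;> omega
  · rintro t s - ⟨hl, ⟨h2, h31, h3n, hr, hp, hdone, hT⟩ | ⟨h2, -⟩⟩ hc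
    · simp only [Test.Holds] at hc
      exact wp_rotationStep hW hn hTW hl h2 h31 (by omega) hr hp hdone hT
    · simp [Test.Holds, h2] at hc
  · rintro t s - ⟨hl, ⟨h2, h31, h3n, hr, hp, hdone, hT⟩ | ⟨h2, hns, hT⟩⟩ hc
    · simp only [Test.Holds] at hc
      refine ⟨hl, by omega, Or.inl ⟨h2, hr.stable_cutoff fun u hu => hdone u hu ?_⟩⟩
      have := hu.2
      omega
    · exact ⟨hl, by omega, Or.inr ⟨h2, hns⟩⟩

end RAM

/-! ### Output and the complete solver. -/

namespace RAM

open HalfEdges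

/-- Output the stable matching given by the cutoffs. -/
def writeOutput : Prog :=
  .ite (.lt 0 2)
    (block [.store 1 0 1, .const 3 1, .loop (.lt 3 2)
      (block [.load 6 4 3, .load 7 2 6, .load 8 3 7,
        .ite (.eq 8 3) (.store 1 3 0) (.store 1 3 8), .add 3 3 1])])
    .skip

/-- The output cell of a vertex matched by `μ` holds its partner, or zero if it is unmatched. -/
def Outputs (H : HalfEdges) (s : State) (μ : ℕ → ℕ) (v : ℕ) : Prop :=
  s.output v = if H.opp (μ v) = v then 0 else H.opp (μ v)

/-- The correct final states. -/
def Solved (H : HalfEdges) (s : State) : Prop :=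
  (s.output 0 = 1 ∧ ∃ μ, H.Stable μ ∧ ∀ v, H.IsVertex v → Outputs H s μ v) ∨
    (s.output 0 = 0 ∧ ¬ ∃ μ, H.Stable μ)

theorem wp_writeOutput {H : HalfEdges} {W T t : ℕ} {s : State} (hn : H.n + 1 ≤ W)
    (hl : Loaded H s)
    (hst : (s.reg 2 = H.n + 1 ∧ H.Stable (s.mem 4)) ∨ (s.reg 2 = 0 ∧ ¬ ∃ μ, H.Stable μ))
    (hT : t + 20 * H.n + 20 ≤ T) :
    WP W writeOutput (fun t s => Solved H s ∧ t ≤ T) t s := by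
  obtain ⟨hz, ho, htw, how, hout⟩ := hl
  refine WP.of_vc ?_
  simp only [writeOutput, vc_block_cons, vc, Test.Holds]
  refine ⟨fun hc => ⟨by omega, ?_⟩, fun hc => ?_⟩
  · obtain ⟨h2, hμ⟩ : s.reg 2 = H.n + 1 ∧ H.Stable (s.mem 4) := hst.resolve_right fun h => by omega
    obtain ⟨μ, hμ'⟩ : ∃ μ, μ = s.mem 4 := ⟨_, rfl⟩
    rw [← hμ'] at hμ
    refine WP.loop (fun t s => s.reg 0 = 0 ∧ s.reg 1 = 1 ∧ s.mem 2 = H.twin ∧ s.mem 3 = H.owner ∧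
      s.mem 4 = μ ∧ s.reg 2 = H.n + 1 ∧ 1 ≤ s.reg 3 ∧ s.reg 3 ≤ H.n + 1 ∧ s.output 0 = 1 ∧
      (∀ v, H.IsVertex v → v < s.reg 3 → Outputs H s μ v) ∧
      t + 20 * (H.n + 1 - s.reg 3) + 5 ≤ T) T ?_ ?_ ?_ ?_
    · refine ⟨by simpa using hz, by simpa using ho, by simpa using htw, by simpa using how,
        by simpa using hμ'.symm, by simpa using h2, by simp, by simp, by simp [State.output, hz, ho],
        ?_, ?_⟩
      · intro v hv h
        have := hv.1
        simp at h
        omega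
      · simp
        omega
    · rintro t s ⟨-, -, -, -, -, -, -, -, -, -, h⟩
      omega
    · rintro t s - ⟨hz, ho, htw, how, h4, h2, h31, h3n, hout, hdone, hT⟩ hc
      simp only [Test.Holds] at hc
      refine WP.of_vc ?_
      simp only [vc_block_cons, vc_block_nil, vc, Test.Holds]
      have hnext : ∀ k s', s'.output = Function.update s.output (s.reg 3) k →
          (k = if H.opp (μ (s.reg 3)) = s.reg 3 then 0 else H.opp (μ (s.reg 3))) →
          ∀ v, H.IsVertex v → v < s.reg 3 + 1 → Outputs H s' μ v := by
        intro k s' e1 e2 v hv hlt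
        rw [Outputs, e1]
        rcases (show v < s.reg 3 ∨ v = s.reg 3 by omega) with h | rfl
        · rw [Function.update_of_ne h.ne]
          exact hdone v hv h
        · rw [Function.update_self, e2]
      refine ⟨fun hc' => ?_, fun hc' => ?_⟩
      · simp [h4, htw, how] at hc'
        refine ⟨by simp; omega, by simpa using hz, by simpa using ho, by simpa using htw,
          by simpa using how, by simpa using h4, by simpa using h2, by simp; omega,
          by simp; omega, ?_, ?_, ?_⟩
        · simp only [State.output] at hout ⊢
          simp
          rw [Function.update_of_ne (by omega)]
          exact hout
        · intro v hv h
          simp [ho] at h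
          refine hnext 0 _ ?_ (by rw [if_pos hc']) v hv (Nat.lt_succ_of_le h)
          ext
          simp [State.output, hz]
        · simp [ho]
          omega
      · simp [h4, htw, how] at hc'
        refine ⟨by simp; omega, by simpa using hz, by simpa using ho, by simpa using htw,
          by simpa using how, by simpa using h4, by simpa using h2, by simp; omega,
          by simp; omega, ?_, ?_, ?_⟩
        · simp only [State.output] at hout ⊢
          simp
          rw [Function.update_of_ne (by omega)]
          exact hout
        · intro v hv h
          simp [ho] at h
          refine hnext _ _ ?_ (by rw [if_neg hc']) v hv (Nat.lt_succ_of_le h)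
          ext
          simp [State.output, h4, htw, how]
        · simp [ho]
          omega
    · rintro t s - ⟨hz, ho, htw, how, h4, h2, h31, h3n, hout, hdone, hT⟩ hc
      simp only [Test.Holds] at hc
      refine ⟨Or.inl ⟨hout, μ, hμ, fun v hv => hdone v hv ?_⟩, by omega⟩
      have := hv.2
      omega
  · refine ⟨Or.inr ⟨by simp [State.output, hout], ?_⟩, by omega⟩
    exact (hst.resolve_left fun h => by omega).2

/-- The solver for half-edge structures. -/
def solve : Prog := block [propose, initSecond, rotations, writeOutput]

theorem wp_solve {H : HalfEdges} {W T t : ℕ} {s : State}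
    (hW : ∀ v, H.IsVertex v → H.last v + 1 < W) (hn : H.n + 1 ≤ W) (hTW : T ≤ W)
    (hl : Loaded H s) (h2 : s.reg 2 = H.n + 1) (h8 : s.mem 8 = fun _ => 0)
    (h5 : ∀ v, H.IsVertex v → s.mem 5 v = H.first v)
    (h4 : ∀ v, H.IsVertex v → s.mem 4 v = H.last v) (h40 : s.mem 4 0 = 0)
    (hT : t + 220 * H.size + 150 * H.n + 80 ≤ T) :
    WP W solve (fun t s => Solved H s ∧ t ≤ T) t s := by
  have hp : H.Proposing (s.mem 5) (s.mem 4) := by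
    refine ⟨fun v hv => (h5 v hv).ge, fun v hv => ?_, fun v hv => ?_, h40, fun μ hμ v hv => ?_,
      fun h hh => ?_⟩
    · have := H.first_le_last v hv.1 hv.2
      rw [h5 v hv]
      omega
    · rw [h4 v hv]
      exact (hv.owner_eq_iff _).2 ⟨H.first_le_last v hv.1 hv.2, le_rfl⟩
    · rw [h4 v hv]
      exact ((hv.owner_eq_iff _).1 (hμ.owner_eq v hv)).2
    · have hv := isVertex_owner hh.1
      rw [h5 _ hv]
      exact ((hv.owner_eq_iff _).1 rfl).1
  have hc1 := cutoffPotential_le (H := H) (b := s.mem 4) fun v hv => (h4 v hv).le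
  have hc2 := pointerPotential_le (H := H) (a := s.mem 5) fun v hv => (h5 v hv).ge
  refine WP.seq (WP.conseq (wp_propose (T := t + 40 * H.size + 40 * H.n + 10) hW hn hl h2 h8 hp
    (by rw [proposeCost]; omega)) ?_)
  rintro t₁ s₁ - ⟨hl, h2, h8, hp, hacc, ht₁⟩
  refine WP.seq (WP.conseq (wp_initSecond (T := t + 40 * H.size + 60 * H.n + 20) hW hn hl h2 h8 hp
    hacc (by omega)) ?_)
  rintro t₂ s₂ - ⟨hl, h8, ht₂, hst⟩
  refine WP.seq (WP.conseq (wp_rotations (T := t + 220 * H.size + 130 * H.n + 40) hW hn (by omega)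
    hl h8 hst (by omega)) ?_)
  rintro t₃ s₃ - ⟨hl, ht₃, hst⟩
  refine WP.seq (WP.conseq (wp_writeOutput (T := t + 220 * H.size + 150 * H.n + 60) hn hl hst
    (by omega)) ?_)
  rintro t₄ s₄ - ⟨hs, ht₄⟩
  refine WP.of_vc ?_
  simp only [vc_block_nil]
  exact ⟨hs, by omega⟩

end RAM

/-! ### Adjacency lists and the numbering of the bidirected half-edges. -/

/-- A simple graph on the vertices `0, …, n - 1` by ordered lists of neighbours: `nbr u k` is the
neighbour of `u` at position `k`, and `rev u k` is the position of `u` in its list. -/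
structure PortGraph where
  n : ℕ
  deg : ℕ → ℕ
  nbr : ℕ → ℕ → ℕ
  rev : ℕ → ℕ → ℕ
  nbr_lt : ∀ u k, u < n → k < deg u → nbr u k < n
  rev_lt : ∀ u k, u < n → k < deg u → rev u k < deg (nbr u k)
  nbr_rev : ∀ u k, u < n → k < deg u → nbr (nbr u k) (rev u k) = u
  nbr_inj : ∀ u j k, u < n → j < deg u → k < deg u → nbr u j = nbr u k → j = k
  nbr_ne : ∀ u k, u < n → k < deg u → nbr u k ≠ u

namespace PortGraph

/-- The address of the first neighbour of `u` in the input word. -/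
def start (P : PortGraph) : ℕ → ℕ
  | 0 => 2
  | u + 1 => P.start u + P.deg u + 1

variable (P : PortGraph)

theorem rev_rev {u k : ℕ} (hu : u < P.n) (hk : k < P.deg u) :
    P.rev (P.nbr u k) (P.rev u k) = k := by
  have h1 := P.nbr_lt u k hu hk
  have h2 := P.rev_lt u k hu hk
  have h3 := P.rev_lt _ _ h1 h2
  have h4 := P.nbr_rev _ _ h1 h2
  have h5 := P.nbr_rev u k hu hk
  rw [h5] at h3 h4
  exact P.nbr_inj u _ _ hu h3 hk h4

theorem start_le {u u' : ℕ} (h : u < u') : P.start u + P.deg u + 1 ≤ P.start u' := by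
  induction u', h using Nat.le_induction with
  | base => exact le_rfl
  | succ v hv ih =>
    rw [start]
    omega

theorem two_le_start (u : ℕ) : 2 ≤ P.start u := by
  induction u with
  | zero => exact le_rfl
  | succ u ih =>
    rw [start]
    omega

theorem start_inj {u u' k k' : ℕ} (hk : k ≤ P.deg u) (hk' : k' ≤ P.deg u')
    (h : P.start u + k = P.start u' + k') : u = u' ∧ k = k' := by
  rcases lt_trichotomy u u' with h1 | rfl | h1
  · have := P.start_le h1
    omega
  · exact ⟨rfl, by omega⟩
  · have := P.start_le h1
    omega

/-- Doubling the input addresses reserves `2 * deg u + 2` numbers for `u`: two for each neighbour,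
one for the loop, and an unused one that serves as the number past the list. -/
theorem two_start_inj {u u' x x' : ℕ} (hx : x ≤ 2 * P.deg u + 1) (hx' : x' ≤ 2 * P.deg u' + 1)
    (h : 2 * P.start u + x = 2 * P.start u' + x') : u = u' ∧ x = x' := by
  rcases lt_trichotomy u u' with h1 | rfl | h1
  · have := P.start_le h1
    omega
  · exact ⟨rfl, by omega⟩
  · have := P.start_le h1
    omega

/-- `tw` and `ow` are the twins and owners of the half-edges of the bidirected graph. The
half-edges at `u`, from `2 * start u` on, are the minus forms of its neighbours, the plus forms
of its neighbours, and a loop. -/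
structure Represents (tw ow : ℕ → ℕ) : Prop where
  owner_eq : ∀ u x, u < P.n → x ≤ 2 * P.deg u → ow (2 * P.start u + x) = u + 1
  owner_ne : ∀ h, ow h ≠ 0 → ∃ u x, u < P.n ∧ x ≤ 2 * P.deg u ∧ h = 2 * P.start u + x
  twin_minus : ∀ u k, u < P.n → k < P.deg u →
    tw (2 * P.start u + k) = 2 * P.start (P.nbr u k) + (P.deg (P.nbr u k) + P.rev u k)
  twin_plus : ∀ u k, u < P.n → k < P.deg u →
    tw (2 * P.start u + (P.deg u + k)) = 2 * P.start (P.nbr u k) + P.rev u k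
  twin_last : ∀ u, u < P.n → tw (2 * P.start u + 2 * P.deg u) = 2 * P.start u + 2 * P.deg u
  twin_ne : ∀ h, tw h ≠ 0 → ∃ u x, u < P.n ∧ x ≤ 2 * P.deg u ∧ h = 2 * P.start u + x

variable {P}

/-- The half-edge structure of the bidirected graph. -/
def Represents.toHalfEdges {tw ow : ℕ → ℕ} (hR : P.Represents tw ow) : HalfEdges where
  n := P.n
  first v := 2 * P.start (v - 1)
  last v := 2 * P.start (v - 1) + 2 * P.deg (v - 1)
  twin := tw
  owner := ow
  first_le_last v _ _ := by omega
  owner_eq_iff v h1 h2 h := by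
    constructor
    · intro hh
      obtain ⟨u, x, hu, hx, rfl⟩ := hR.owner_ne h (by omega)
      rw [hR.owner_eq u x hu hx] at hh
      subst hh
      simp only [Nat.add_sub_cancel]
      omega
    · rintro ⟨h3, h4⟩
      have := hR.owner_eq (v - 1) (h - 2 * P.start (v - 1)) (by omega) (by omega)
      rw [Nat.add_sub_cancel' h3] at this
      omega
  owner_le h := by
    by_cases h0 : ow h = 0
    · omega
    · obtain ⟨u, x, hu, hx, rfl⟩ := hR.owner_ne h h0
      rw [hR.owner_eq u x hu hx]
      omega
  owner_twin h h0 := by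
    obtain ⟨u, x, hu, hx, rfl⟩ := hR.owner_ne h h0
    rcases lt_or_ge x (P.deg u) with h1 | h1
    · rw [hR.twin_minus u x hu h1]
      have := P.rev_lt u x hu h1
      rw [hR.owner_eq _ _ (P.nbr_lt u x hu h1) (by omega)]
      omega
    · rcases hx.lt_or_eq with h2 | rfl
      · obtain ⟨k, rfl⟩ := Nat.exists_eq_add_of_le h1
        have hk : k < P.deg u := by omega
        rw [hR.twin_plus u k hu hk]
        have := P.rev_lt u k hu hk
        rw [hR.owner_eq _ _ (P.nbr_lt u k hu hk) (by omega)]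
        omega
      · rw [hR.twin_last u hu]
        exact h0
  twin_twin h h0 := by
    obtain ⟨u, x, hu, hx, rfl⟩ := hR.owner_ne h h0
    rcases lt_or_ge x (P.deg u) with h1 | h1
    · rw [hR.twin_minus u x hu h1, hR.twin_plus _ _ (P.nbr_lt u x hu h1) (P.rev_lt u x hu h1),
        P.nbr_rev u x hu h1, P.rev_rev hu h1]
    · rcases hx.lt_or_eq with h2 | rfl
      · obtain ⟨k, rfl⟩ := Nat.exists_eq_add_of_le h1
        have hk : k < P.deg u := by omega
        rw [hR.twin_plus u k hu hk, hR.twin_minus _ _ (P.nbr_lt u k hu hk) (P.rev_lt u k hu hk),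
          P.nbr_rev u k hu hk, P.rev_rev hu hk]
      · rw [hR.twin_last u hu, hR.twin_last u hu]
  twin_last v h1 h2 := hR.twin_last (v - 1) (by omega)
  twin_succ_last v h1 h2 := by
    by_contra h0
    obtain ⟨u, x, hu, hx, h⟩ := hR.twin_ne _ h0
    have := P.two_start_inj (u := v - 1) (x := 2 * P.deg (v - 1) + 1) le_rfl (by omega) h
    obtain ⟨rfl, h4⟩ := this
    omega
  owner_zero := by
    by_contra h0
    obtain ⟨u, x, hu, hx, h⟩ := hR.owner_ne _ h0
    have := P.two_le_start u
    omega

theorem Represents.size_le {tw ow : ℕ → ℕ} (hR : P.Represents tw ow) :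
    hR.toHalfEdges.size ≤ 2 * P.start P.n := by
  have key : ∀ m, ∑ v ∈ Finset.Icc 1 m, (2 * P.start (v - 1) + 2 * P.deg (v - 1) + 1 -
      2 * P.start (v - 1)) ≤ 2 * P.start m := by
    intro m
    induction m with
    | zero => simp
    | succ m ih =>
      rw [Finset.sum_Icc_succ_top (by omega), start, Nat.add_sub_cancel]
      omega
  exact key P.n

variable (P) in
/-- The contents of the input bank for a graph. -/
structure IsInput (inp : ℕ → ℕ) : Prop where
  zero : inp 0 = P.n
  deg : ∀ u, u < P.n → inp (P.start u - 1) = P.deg u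
  nbr : ∀ u k, u < P.n → k < P.deg u → inp (P.start u + k) = P.nbr u k

variable (P) in
/-- The input addresses that hold neighbours. -/
def IsEntry (j : ℕ) : Prop := ∃ u k, u < P.n ∧ k < P.deg u ∧ j = P.start u + k

theorem IsEntry.lt {j : ℕ} (hj : P.IsEntry j) : j < P.start P.n := by
  obtain ⟨u, k, hu, hk, rfl⟩ := hj
  have := P.start_le hu
  omega

theorem not_isEntry (u : ℕ) : ¬ P.IsEntry (P.start u + P.deg u) := by
  rintro ⟨v, k, hv, hk, h⟩
  obtain ⟨rfl, rfl⟩ := P.start_inj le_rfl hk.le h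
  omega

theorem IsEntry.ne_zero {j : ℕ} (hj : P.IsEntry j) : j ≠ 0 := by
  obtain ⟨u, k, -, -, rfl⟩ := hj
  have := P.two_le_start u
  omega

end PortGraph

/-! ### Numbering the half-edges and grouping entries by neighbour. -/

namespace RAM

open PortGraph

/-! Further banks: 9 last entry for a neighbour, 10 previous entry for the same neighbour, 11 vertex of
an entry, 12 and 13 its half-edges in minus and plus form, 14 entries of the current vertex by
neighbour. Register 12 holds the number of vertices. -/

/-- The registers and banks that stay as they are during the preprocessing. -/
structure Prepared (P : PortGraph) (inp : ℕ → ℕ) (s : State) : Prop where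
  zero : s.reg 0 = 0
  one : s.reg 1 = 1
  limit : s.reg 2 = P.n + 1
  count : s.reg 12 = P.n
  input : s.mem 0 = inp
  output : s.mem 1 = fun _ => 0
  marks : s.mem 8 = fun _ => 0

@[simp] theorem prepared_setReg {P : PortGraph} {inp : ℕ → ℕ} {s : State} {x k : ℕ} (hx : 3 ≤ x)
    (hx' : 12 ≠ x) : Prepared P inp (s.setReg x k) ↔ Prepared P inp s := by
  have h0 : 0 ≠ x := by omega
  have h1 : 1 ≠ x := by omega
  have h2 : 2 ≠ x := by omega
  constructor
  · rintro ⟨h3, h4, h5, h6, h7, h8, h9⟩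
    exact ⟨by simpa [h0] using h3, by simpa [h1] using h4, by simpa [h2] using h5,
      by simpa [hx'] using h6, h7, h8, h9⟩
  · rintro ⟨h3, h4, h5, h6, h7, h8, h9⟩
    exact ⟨by simpa [h0] using h3, by simpa [h1] using h4, by simpa [h2] using h5,
      by simpa [hx'] using h6, h7, h8, h9⟩

@[simp] theorem prepared_setMem {P : PortGraph} {inp : ℕ → ℕ} {s : State} {b i k : ℕ} (hb : 2 ≤ b)
    (hb' : 8 ≠ b) : Prepared P inp (s.setMem b i k) ↔ Prepared P inp s := by
  have h0 : 0 ≠ b := by omega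
  have h1 : 1 ≠ b := by omega
  constructor
  · rintro ⟨h3, h4, h5, h6, h7, h8, h9⟩
    exact ⟨h3, h4, h5, h6, by simpa [h0] using h7, by simpa [h1] using h8, by simpa [hb'] using h9⟩
  · rintro ⟨h3, h4, h5, h6, h7, h8, h9⟩
    exact ⟨h3, h4, h5, h6, by simpa [h0] using h7, by simpa [h1] using h8, by simpa [hb'] using h9⟩

/-- The tables of the entries at addresses below `p`. -/
structure EntryTables (P : PortGraph) (inp : ℕ → ℕ) (p : ℕ) (head next src minus plus : ℕ → ℕ) :
    Prop where
  src_eq : ∀ u k, u < P.n → k < P.deg u → P.start u + k < p → src (P.start u + k) = u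
  minus_eq : ∀ u k, u < P.n → k < P.deg u → P.start u + k < p →
    minus (P.start u + k) = 2 * P.start u + k
  plus_eq : ∀ u k, u < P.n → k < P.deg u → P.start u + k < p →
    plus (P.start u + k) = 2 * P.start u + (P.deg u + k)
  le_head : ∀ j, P.IsEntry j → j < p → j ≤ head (inp j)
  head_entry : ∀ v, head v ≠ 0 → P.IsEntry (head v) ∧ head v < p ∧ inp (head v) = v
  le_next : ∀ j, P.IsEntry j → j < p → ∀ i, P.IsEntry i → inp i = inp j → i < j → i ≤ next j
  next_entry : ∀ j, P.IsEntry j → j < p → next j ≠ 0 →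
    P.IsEntry (next j) ∧ next j < j ∧ inp (next j) = inp j

/-- Addresses are read in increasing order, so the new entry becomes the head for its neighbour and
the old head its successor. The linked lists are specified by inequalities between addresses; zero
ends a list because no entry has address zero. -/
theorem EntryTables.step {P : PortGraph} {inp head next src minus plus : ℕ → ℕ} {u k : ℕ}
    (h : EntryTables P inp (P.start u + k) head next src minus plus) (hu : u < P.n)
    (hk : k < P.deg u) :
    EntryTables P inp (P.start u + k + 1)
      (Function.update head (inp (P.start u + k)) (P.start u + k))
      (Function.update next (P.start u + k) (head (inp (P.start u + k))))
      (Function.update src (P.start u + k) u)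
      (Function.update minus (P.start u + k) (2 * P.start u + k))
      (Function.update plus (P.start u + k) (2 * P.start u + (P.deg u + k))) := by
  have hE : P.IsEntry (P.start u + k) := ⟨u, k, hu, hk, rfl⟩
  generalize hp : P.start u + k = p at h hE ⊢
  obtain ⟨h1, h2, h3, h4, h5, h6, h7⟩ := h
  have hcase : ∀ j, j < p + 1 → j < p ∨ j = p := fun j hj => by omega
  have hinj : ∀ u' k', u' < P.n → k' < P.deg u' → P.start u' + k' = p → u' = u ∧ k' = k :=
    fun u' k' _ h8 h9 => P.start_inj h8.le hk.le (h9.trans hp.symm)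
  refine ⟨fun u' k' hu' hk' hlt => ?_, fun u' k' hu' hk' hlt => ?_, fun u' k' hu' hk' hlt => ?_,
    fun j hj hlt => ?_, fun v hv => ?_, fun j hj hlt i hi hij hilt => ?_, fun j hj hlt hne => ?_⟩
  · rcases hcase _ hlt with h8 | h8
    · rw [Function.update_of_ne h8.ne]
      exact h1 u' k' hu' hk' h8
    · rw [h8, Function.update_self, (hinj u' k' hu' hk' h8).1]
  · rcases hcase _ hlt with h8 | h8
    · rw [Function.update_of_ne h8.ne]
      exact h2 u' k' hu' hk' h8
    · obtain ⟨rfl, rfl⟩ := hinj u' k' hu' hk' h8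
      rw [h8, Function.update_self]
  · rcases hcase _ hlt with h8 | h8
    · rw [Function.update_of_ne h8.ne]
      exact h3 u' k' hu' hk' h8
    · obtain ⟨rfl, rfl⟩ := hinj u' k' hu' hk' h8
      rw [h8, Function.update_self]
  · rw [Function.update_apply]
    split_ifs with h8
    · omega
    · rcases hcase _ hlt with h9 | rfl
      · exact h4 j hj h9
      · exact absurd rfl h8
  · rw [Function.update_apply] at hv ⊢
    split_ifs with h8
    · exact ⟨hE, by omega, h8.symm⟩
    · rw [if_neg h8] at hv
      have := h5 v hv
      exact ⟨this.1, by omega, this.2.2⟩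
  · rcases hcase _ hlt with h8 | rfl
    · rw [Function.update_of_ne h8.ne]
      exact h6 j hj h8 i hi hij hilt
    · rw [Function.update_self, ← hij]
      exact h4 i hi hilt
  · rcases hcase _ hlt with h8 | rfl
    · rw [Function.update_of_ne h8.ne] at hne ⊢
      exact h7 j hj h8 hne
    · rw [Function.update_self] at hne ⊢
      exact h5 _ hne

theorem EntryTables.mono {P : PortGraph} {inp head next src minus plus : ℕ → ℕ} {p p' : ℕ}
    (h : EntryTables P inp p head next src minus plus) (hpp : p ≤ p')
    (hno : ∀ j, P.IsEntry j → j < p' → j < p) :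
    EntryTables P inp p' head next src minus plus := by
  obtain ⟨h1, h2, h3, h4, h5, h6, h7⟩ := h
  refine ⟨fun u k hu hk hlt => h1 u k hu hk (hno _ ⟨u, k, hu, hk, rfl⟩ hlt),
    fun u k hu hk hlt => h2 u k hu hk (hno _ ⟨u, k, hu, hk, rfl⟩ hlt),
    fun u k hu hk hlt => h3 u k hu hk (hno _ ⟨u, k, hu, hk, rfl⟩ hlt),
    fun j hj hlt => h4 j hj (hno j hj hlt), fun v hv => ?_,
    fun j hj hlt => h6 j hj (hno j hj hlt), fun j hj hlt => h7 j hj (hno j hj hlt)⟩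
  have := h5 v hv
  exact ⟨this.1, by omega, this.2.2⟩

/-- The owners of the half-edges of the entries below `p` and of the loops of the vertices below
`u`. -/
structure OwnerTable (P : PortGraph) (u p : ℕ) (ow : ℕ → ℕ) : Prop where
  sound : ∀ h, ow h ≠ 0 → ∃ v x, v < P.n ∧ x ≤ 2 * P.deg v ∧ h = 2 * P.start v + x ∧ ow h = v + 1
  minus_ne : ∀ v k, v < P.n → k < P.deg v → P.start v + k < p → ow (2 * P.start v + k) ≠ 0
  plus_ne : ∀ v k, v < P.n → k < P.deg v → P.start v + k < p →
    ow (2 * P.start v + (P.deg v + k)) ≠ 0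
  last_ne : ∀ v, v < u → ow (2 * P.start v + 2 * P.deg v) ≠ 0

theorem OwnerTable.update_ne {ow : ℕ → ℕ} {h h' k : ℕ} (hne : ow h ≠ 0) :
    Function.update ow h' (k + 1) h ≠ 0 := by
  rw [Function.update_apply]
  split_ifs
  · omega
  · exact hne

theorem OwnerTable.update_sound {P : PortGraph} {ow : ℕ → ℕ}
    (hs : ∀ h, ow h ≠ 0 →
      ∃ v x, v < P.n ∧ x ≤ 2 * P.deg v ∧ h = 2 * P.start v + x ∧ ow h = v + 1)
    {u y : ℕ} (hu : u < P.n) (hy : y ≤ 2 * P.deg u) (h : ℕ)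
    (hne : Function.update ow (2 * P.start u + y) (u + 1) h ≠ 0) :
    ∃ v x, v < P.n ∧ x ≤ 2 * P.deg v ∧ h = 2 * P.start v + x ∧
      Function.update ow (2 * P.start u + y) (u + 1) h = v + 1 := by
  rw [Function.update_apply] at hne ⊢
  split_ifs with h1
  · exact ⟨u, y, hu, hy, h1, rfl⟩
  · rw [if_neg h1] at hne
    exact hs h hne

theorem OwnerTable.step {P : PortGraph} {ow : ℕ → ℕ} {u' u k : ℕ}
    (h : OwnerTable P u' (P.start u + k) ow) (hu : u < P.n) (hk : k < P.deg u) :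
    OwnerTable P u' (P.start u + k + 1) (Function.update
      (Function.update ow (2 * P.start u + k) (u + 1)) (2 * P.start u + (P.deg u + k)) (u + 1)) := by
  have hcase : ∀ v j, v < P.n → j < P.deg v → P.start v + j < P.start u + k + 1 →
      P.start v + j < P.start u + k ∨ (v = u ∧ j = k) := by
    intro v j hv hj hlt
    rcases (show P.start v + j < P.start u + k ∨ P.start v + j = P.start u + k by omega) with h1 | h1
    · exact Or.inl h1
    · exact Or.inr (P.start_inj hj.le hk.le h1)
  refine ⟨OwnerTable.update_sound (OwnerTable.update_sound h.sound hu (by omega)) hu (by omega),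
    fun v j hv hj hlt => ?_, fun v j hv hj hlt => ?_, fun v hv => update_ne (update_ne (h.last_ne v hv))⟩
  · apply update_ne
    rcases hcase v j hv hj hlt with h1 | ⟨rfl, rfl⟩
    · exact update_ne (h.minus_ne v j hv hj h1)
    · simp
  · rcases hcase v j hv hj hlt with h1 | ⟨rfl, rfl⟩
    · exact update_ne (update_ne (h.plus_ne v j hv hj h1))
    · simp

/-- Process the entry in register 5, which belongs to the vertex in register 3. -/
def entryStep : Prog :=
  block [.load 10 0 5, .load 11 9 10, .store 10 5 11, .store 9 10 5, .store 11 5 3, .store 12 5 7,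
    .store 3 7 4, .store 13 5 8, .store 3 8 4, .add 7 7 1, .add 8 8 1, .add 5 5 1]

/-- Number the half-edges, and link the entries with the same neighbour. -/
def indexEntries : Prog :=
  block [.const 1 1, .load 12 0 0, .add 2 12 1, .const 3 0, .const 5 1, .loop (.lt 3 12)
    (block [.load 6 0 5, .add 5 5 1, .add 7 5 5, .add 4 3 1, .store 5 4 7, .add 9 5 6, .add 8 7 6,
      .loop (.lt 5 9) entryStep, .store 4 4 8, .store 3 8 4, .store 2 8 8, .move 3 4])]

/-- The invariant for the tables of the vertices below `u`. -/
structure VertexTables (P : PortGraph) (u : ℕ) (tw b a : ℕ → ℕ) : Prop where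
  twin_sound : ∀ h, tw h ≠ 0 → ∃ v, v < P.n ∧ h = 2 * P.start v + 2 * P.deg v ∧ tw h = h
  twin_last : ∀ v, v < u → tw (2 * P.start v + 2 * P.deg v) ≠ 0
  last_eq : ∀ v, v < u → b (v + 1) = 2 * P.start v + 2 * P.deg v
  last_zero : b 0 = 0
  first_eq : ∀ v, v < u → a (v + 1) = 2 * P.start v

theorem VertexTables.step {P : PortGraph} {tw b a : ℕ → ℕ} {u : ℕ}
    (h : VertexTables P u tw b a) (hu : u < P.n) (ha : a (u + 1) = 2 * P.start u) :
    VertexTables P (u + 1)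
      (Function.update tw (2 * P.start u + 2 * P.deg u) (2 * P.start u + 2 * P.deg u))
      (Function.update b (u + 1) (2 * P.start u + 2 * P.deg u)) a := by
  obtain ⟨h1, h2, h3, h4, h5⟩ := h
  have h0 := P.two_le_start u
  refine ⟨fun h hne => ?_, fun v hv => ?_, fun v hv => ?_, ?_, fun v hv => ?_⟩
  · rw [Function.update_apply] at hne ⊢
    split_ifs with h6
    · exact ⟨u, hu, h6, h6.symm⟩
    · rw [if_neg h6] at hne
      exact h1 h hne
  · rw [Function.update_apply]
    split_ifs with h6
    · omega
    · rcases (show v < u ∨ v = u by omega) with h7 | rfl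
      · exact h2 v h7
      · exact absurd rfl h6
  · rcases (show v < u ∨ v = u by omega) with h7 | rfl
    · rw [Function.update_of_ne (by omega), h3 v h7]
    · simp
  · rw [Function.update_of_ne (by omega), h4]
  · rcases (show v < u ∨ v = u by omega) with h7 | rfl
    · exact h5 v h7
    · exact ha

/-- All tables. -/
structure Indexed (P : PortGraph) (inp : ℕ → ℕ) (u p : ℕ) (s : State) : Prop where
  prepared : Prepared P inp s
  entries : EntryTables P inp p (s.mem 9) (s.mem 10) (s.mem 11) (s.mem 12) (s.mem 13)
  owners : OwnerTable P u p (s.mem 3)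
  vertices : VertexTables P u (s.mem 2) (s.mem 4) (s.mem 5)

set_option maxHeartbeats 1600000 in
theorem wp_entryLoop {P : PortGraph} {inp : ℕ → ℕ} {W T u t : ℕ} {s : State}
    (hW : 2 * P.start P.n ≤ W) (hu : u < P.n) (hI : Indexed P inp u (P.start u) s)
    (h3 : s.reg 3 = u) (h4 : s.reg 4 = u + 1) (h5 : s.reg 5 = P.start u)
    (h7 : s.reg 7 = 2 * P.start u) (h8 : s.reg 8 = 2 * P.start u + P.deg u)
    (h9 : s.reg 9 = P.start u + P.deg u) (ha : s.mem 5 (u + 1) = 2 * P.start u)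
    (hT : t + 20 * P.deg u + 2 ≤ T) :
    WP W (.loop (.lt 5 9) entryStep) (fun t s => Indexed P inp u (P.start u + P.deg u) s ∧
      s.reg 3 = u ∧ s.reg 4 = u + 1 ∧ s.reg 5 = P.start u + P.deg u ∧
      s.reg 8 = 2 * P.start u + 2 * P.deg u ∧ s.mem 5 (u + 1) = 2 * P.start u ∧ t ≤ T) t s := by
  have hst := P.start_le hu
  refine WP.loop (fun t s => ∃ k, k ≤ P.deg u ∧ Indexed P inp u (P.start u + k) s ∧
    s.reg 3 = u ∧ s.reg 4 = u + 1 ∧ s.reg 5 = P.start u + k ∧ s.reg 7 = 2 * P.start u + k ∧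
    s.reg 8 = 2 * P.start u + (P.deg u + k) ∧ s.reg 9 = P.start u + P.deg u ∧
    s.mem 5 (u + 1) = 2 * P.start u ∧ t + 20 * (P.deg u - k) + 2 ≤ T) T ?_ ?_ ?_ ?_
  · exact ⟨0, by omega, hI, h3, h4, h5, h7, h8, h9, ha, hT⟩
  · rintro t s ⟨k, -, -, -, -, -, -, -, -, -, h⟩
    omega
  · rintro t s - ⟨k, hk, ⟨hp, he, ho, hv⟩, h3, h4, h5, h7, h8, h9, ha, hT⟩ hc
    simp only [Test.Holds] at hc
    have hk' : k < P.deg u := by omega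
    have h1 := hp.one
    have h0 := hp.input
    refine WP.of_vc ?_
    simp only [entryStep, vc_block_cons, vc_block_nil, vc]
    refine ⟨by simp; omega, by simp; omega, by simp; omega, k + 1, hk', ⟨by simpa using hp, ?_, ?_, ?_⟩,
      by simpa using h3, by simpa using h4, by simp; omega, by simp; omega, by simp; omega,
      by simpa using h9, by simpa using ha, by omega⟩
    · rw [← Nat.add_assoc]
      simp [h0, h3, h5, h7, h8]
      exact he.step hu hk'
    · rw [← Nat.add_assoc]
      simp [h4, h7, h8]
      exact ho.step hu hk'
    · simpa using hv
  · rintro t s - ⟨k, hk, hI, h3, h4, h5, h7, h8, h9, ha, hT⟩ hc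
    simp only [Test.Holds] at hc
    obtain rfl : k = P.deg u := by omega
    exact ⟨hI, h3, h4, h5, by omega, ha, by omega⟩

theorem wp_indexEntries {P : PortGraph} {inp : ℕ → ℕ} (hinp : P.IsInput inp) {W T t : ℕ} {s : State}
    (hW : 2 * P.start P.n ≤ W) (hn : P.n + 1 ≤ W) (hreg : ∀ x, s.reg x = 0) (h0 : s.mem 0 = inp)
    (hmem : ∀ b, b ≠ 0 → s.mem b = fun _ => 0) (hT : t + 60 * P.start P.n + 20 ≤ T) :
    WP W indexEntries (fun t s => Indexed P inp P.n (P.start P.n) s ∧ t ≤ T) t s := by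
  have h2n := P.two_le_start P.n
  refine WP.of_vc ?_
  simp only [indexEntries, vc_block_cons, vc]
  refine ⟨by omega, ?_, by omega, by omega, ?_⟩
  · simp [hreg, h0, hinp.zero]
    omega
  -- Register 5 points at the degree cell, one before the first neighbour. A vertex advances `start`
  -- by its degree plus one, and at 60 steps per input cell this pays for its round.
  refine WP.loop (fun t s => s.reg 3 ≤ P.n ∧ Indexed P inp (s.reg 3) (P.start (s.reg 3)) s ∧
    s.reg 5 + 1 = P.start (s.reg 3) ∧ t + 60 * (P.start P.n - P.start (s.reg 3)) + 5 ≤ T)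
    T ?_ ?_ ?_ ?_
  · refine ⟨by simp, ⟨⟨by simp [hreg], by simp, by simp [hreg, h0, hinp.zero],
      by simp [hreg, h0, hinp.zero], by simp [h0], by simp [hmem], by simp [hmem]⟩, ?_, ?_, ?_⟩,
      by simp [start], ?_⟩
    · have hno : ∀ j, P.IsEntry j → ¬ j < P.start 0 := by
        rintro j ⟨u, k, -, -, rfl⟩ h
        have := P.two_le_start u
        simp only [start] at h
        omega
      have hno' : ∀ u k, u < P.n → k < P.deg u → ¬ P.start u + k < P.start 0 :=
        fun u k hu hk => hno _ ⟨u, k, hu, hk, rfl⟩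
      simp
      exact ⟨fun u k hu hk h => absurd h (hno' u k hu hk),
        fun u k hu hk h => absurd h (hno' u k hu hk), fun u k hu hk h => absurd h (hno' u k hu hk),
        fun j hj h => absurd h (hno j hj), fun v hv => by simp [hmem] at hv,
        fun j hj h => absurd h (hno j hj), fun j hj h => absurd h (hno j hj)⟩
    · have hno' : ∀ u k, ¬ P.start u + k < P.start 0 := by
        intro u k h
        have := P.two_le_start u
        simp only [start] at h
        omega
      simp
      exact ⟨fun h hh => by simp [hmem] at hh, fun v k _ _ h => absurd h (hno' v k),
        fun v k _ _ h => absurd h (hno' v k), fun v hv => by omega⟩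
    · simp
      exact ⟨fun h hh => by simp [hmem] at hh, fun v hv => by omega, fun v hv => by omega,
        by simp [hmem], fun v hv => by omega⟩
    · simp
      omega
  · rintro t s ⟨-, -, -, h⟩
    omega
  · rintro t s - ⟨h3n, ⟨hp, he, ho, hv⟩, h5, hT⟩ hc
    obtain ⟨u, hu'⟩ : ∃ u, s.reg 3 = u := ⟨_, rfl⟩
    rw [hu'] at h3n he ho hv h5 hT
    obtain ⟨hz, h1, h2, h12, hin, hout, h8⟩ := id hp
    simp only [Test.Holds] at hc
    have hu : u < P.n := by omega
    have hst := P.start_le hu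
    have h5' : s.reg 5 = P.start u - 1 := by omega
    have h2u := P.two_le_start u
    have hd : s.mem 0 (s.reg 5) = P.deg u := by rw [hin, h5', hinp.deg u hu]
    have h51 : s.reg 5 + s.reg 1 = P.start u := by omega
    refine WP.of_vc ?_
    simp only [vc_block_cons, vc]
    refine ⟨by simp; omega, by simp; omega, by simp; omega, by simp; omega, by simp; omega, ?_⟩
    refine WP.conseq (wp_entryLoop (inp := inp) (u := u)
      (T := T - 60 * (P.start P.n - P.start u) + 20 * P.deg u + 20) hW hu ?_ ?_ ?_ ?_ ?_ ?_ ?_ ?_ ?_) ?_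
    · refine ⟨by simpa using hp, by simpa using he, by simpa using ho, ?_⟩
      obtain ⟨g1, g2, g3, g4, g5⟩ := hv
      refine ⟨by simpa using g1, by simpa using g2, by simpa using g3, by simpa using g4,
        fun v hv' => ?_⟩
      simp [hu', h1]
      rw [Function.update_of_ne (by omega)]
      exact g5 v hv'
    · simpa using hu'
    · simp [hu', h1]
    · simp [h51]
    · simp [h51]
      omega
    · simp [h51, hd]
      omega
    · simp [h51, hd]
    · simp [hu', h1]
      omega
    · omega
    · rintro t' s' - ⟨⟨hp', he', ho', hv'⟩, h3', h4', h5'', h8', ha', hT'⟩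
      have hstart : P.start (u + 1) = P.start u + P.deg u + 1 := rfl
      have hle : P.start (u + 1) ≤ P.start P.n := hst
      have hno : ∀ j, P.IsEntry j → j < P.start u + P.deg u + 1 → j < P.start u + P.deg u := by
        intro j hj hlt
        by_contra hcon
        obtain rfl : j = P.start u + P.deg u := by omega
        exact P.not_isEntry u hj
      refine ⟨by simp [h4']; omega, ⟨by simpa using hp', ?_, ?_, ?_⟩, by simp [h4', h5'', hstart],
        by simp [h4', hstart]; omega⟩
      · simp [h4', hstart]
        exact he'.mono (by omega) hno
      · simp [h4', h8', hstart]
        refine ⟨OwnerTable.update_sound ho'.sound hu le_rfl, fun v k hv hk hlt =>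
          OwnerTable.update_ne (ho'.minus_ne v k hv hk (hno _ ⟨v, k, hv, hk, rfl⟩ hlt)),
          fun v k hv hk hlt =>
          OwnerTable.update_ne (ho'.plus_ne v k hv hk (hno _ ⟨v, k, hv, hk, rfl⟩ hlt)),
          fun v hv => ?_⟩
        rcases (show v < u ∨ v = u by omega) with h | rfl
        · exact OwnerTable.update_ne (ho'.last_ne v h)
        · simp
      · simpa [h4', h8'] using hv'.step hu ha'
  · rintro t s - ⟨h3n, hI, h5, hT⟩ hc
    simp only [Test.Holds] at hc
    have h12 := hI.prepared.count
    have : s.reg 3 = P.n := by omega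
    rw [this] at hI
    refine ⟨hI, ?_⟩
    omega

end RAM

/-! ### Computing the twins. -/

namespace RAM

open PortGraph

/-- The twins of the loops, and of the half-edges of the entries that satisfy `D`. -/
structure TwinTable (P : PortGraph) (D : ℕ → Prop) (tw : ℕ → ℕ) : Prop where
  sound : ∀ h, tw h ≠ 0 → (∃ v, v < P.n ∧ h = 2 * P.start v + 2 * P.deg v ∧ tw h = h) ∨
    (∃ u k, u < P.n ∧ k < P.deg u ∧ h = 2 * P.start u + k ∧
      tw h = 2 * P.start (P.nbr u k) + (P.deg (P.nbr u k) + P.rev u k)) ∨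
    (∃ u k, u < P.n ∧ k < P.deg u ∧ h = 2 * P.start u + (P.deg u + k) ∧
      tw h = 2 * P.start (P.nbr u k) + P.rev u k)
  last_ne : ∀ v, v < P.n → tw (2 * P.start v + 2 * P.deg v) ≠ 0
  minus_ne : ∀ u k, u < P.n → k < P.deg u → D (P.start u + k) → tw (2 * P.start u + k) ≠ 0
  plus_ne : ∀ u k, u < P.n → k < P.deg u → D (P.start u + k) →
    tw (2 * P.start u + (P.deg u + k)) ≠ 0

theorem TwinTable.mono {P : PortGraph} {D D' : ℕ → Prop} {tw : ℕ → ℕ} (h : TwinTable P D tw)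
    (hD : ∀ j, P.IsEntry j → D' j → D j) : TwinTable P D' tw :=
  ⟨h.sound, h.last_ne, fun u k hu hk hd => h.minus_ne u k hu hk (hD _ ⟨u, k, hu, hk, rfl⟩ hd),
    fun u k hu hk hd => h.plus_ne u k hu hk (hD _ ⟨u, k, hu, hk, rfl⟩ hd)⟩

theorem TwinTable.step {P : PortGraph} {D D' : ℕ → Prop} {tw : ℕ → ℕ} (h : TwinTable P D tw)
    {u k : ℕ} (hu : u < P.n) (hk : k < P.deg u)
    (hD : ∀ j, P.IsEntry j → D' j → D j ∨ j = P.start u + k) :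
    TwinTable P D' (Function.update (Function.update tw (2 * P.start u + k)
      (2 * P.start (P.nbr u k) + (P.deg (P.nbr u k) + P.rev u k)))
      (2 * P.start u + (P.deg u + k)) (2 * P.start (P.nbr u k) + P.rev u k)) := by
  have h2 := P.two_le_start (P.nbr u k)
  have hne : ∀ g, tw g ≠ 0 → Function.update (Function.update tw (2 * P.start u + k)
      (2 * P.start (P.nbr u k) + (P.deg (P.nbr u k) + P.rev u k)))
      (2 * P.start u + (P.deg u + k)) (2 * P.start (P.nbr u k) + P.rev u k) g ≠ 0 := by
    intro g hg
    rw [Function.update_apply, Function.update_apply]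
    split_ifs
    · omega
    · omega
    · exact hg
  have hcase : ∀ v j, v < P.n → j < P.deg v → D' (P.start v + j) →
      D (P.start v + j) ∨ (v = u ∧ j = k) := by
    intro v j hv hj hd
    rcases hD _ ⟨v, j, hv, hj, rfl⟩ hd with h1 | h1
    · exact Or.inl h1
    · exact Or.inr (P.start_inj hj.le hk.le h1)
  refine ⟨fun g hg => ?_, fun v hv => hne _ (h.last_ne v hv), fun v j hv hj hd => ?_,
    fun v j hv hj hd => ?_⟩
  · rw [Function.update_apply, Function.update_apply] at hg ⊢
    split_ifs with h3 h4
    · exact Or.inr (Or.inr ⟨u, k, hu, hk, h3, rfl⟩)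
    · exact Or.inr (Or.inl ⟨u, k, hu, hk, h4, rfl⟩)
    · rw [if_neg h3, if_neg h4] at hg
      exact h.sound g hg
  · rcases hcase v j hv hj hd with h1 | ⟨rfl, rfl⟩
    · exact hne _ (h.minus_ne v j hv hj h1)
    · rw [Function.update_of_ne (by omega), Function.update_self]
      omega
  · rcases hcase v j hv hj hd with h1 | ⟨rfl, rfl⟩
    · exact hne _ (h.plus_ne v j hv hj h1)
    · rw [Function.update_self]
      omega

/-- The tables say that nonzero values are correct and that the required values are nonzero. Since
the numbering is injective, `sound` then determines each value, whatever the order of the writes. -/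
theorem represents_of_tables {P : PortGraph} {tw ow : ℕ → ℕ}
    (ht : TwinTable P (fun _ => True) tw) (ho : OwnerTable P P.n (P.start P.n) ow) :
    P.Represents tw ow := by
  have hlt : ∀ u k, u < P.n → k < P.deg u → P.start u + k < P.start P.n :=
    fun u k hu hk => IsEntry.lt ⟨u, k, hu, hk, rfl⟩
  refine ⟨fun u x hu hx => ?_, fun h hne => ?_, fun u k hu hk => ?_, fun u k hu hk => ?_,
    fun u hu => ?_, fun h hne => ?_⟩
  · have hne : ow (2 * P.start u + x) ≠ 0 := by
      rcases lt_or_ge x (P.deg u) with h1 | h1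
      · exact ho.minus_ne u x hu h1 (hlt u x hu h1)
      · rcases hx.lt_or_eq with h2 | rfl
        · obtain ⟨k, rfl⟩ := Nat.exists_eq_add_of_le h1
          exact ho.plus_ne u k hu (by omega) (hlt u k hu (by omega))
        · exact ho.last_ne u hu
    obtain ⟨v, y, hv, hy, h1, h2⟩ := ho.sound _ hne
    rw [h2, (P.two_start_inj (by omega) (by omega) h1).1]
  · obtain ⟨v, y, hv, hy, h1, h2⟩ := ho.sound _ hne
    exact ⟨v, y, hv, hy, h1⟩
  · rcases ht.sound _ (ht.minus_ne u k hu hk trivial) with ⟨v, hv, h1, h2⟩ |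
      ⟨v, j, hv, hj, h1, h2⟩ | ⟨v, j, hv, hj, h1, h2⟩
    all_goals
      obtain ⟨rfl, h4⟩ := P.two_start_inj (by omega) (by omega) h1
    · omega
    · rw [h2, h4]
    · omega
  · rcases ht.sound _ (ht.plus_ne u k hu hk trivial) with ⟨v, hv, h1, h2⟩ |
      ⟨v, j, hv, hj, h1, h2⟩ | ⟨v, j, hv, hj, h1, h2⟩
    all_goals
      obtain ⟨rfl, h4⟩ := P.two_start_inj (by omega) (by omega) h1
    · omega
    · omega
    · obtain rfl : k = j := by omega
      exact h2
  · rcases ht.sound _ (ht.last_ne u hu) with ⟨v, hv, h1, h2⟩ |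
      ⟨v, j, hv, hj, h1, h2⟩ | ⟨v, j, hv, hj, h1, h2⟩
    all_goals
      obtain ⟨rfl, h4⟩ := P.two_start_inj (by omega) (by omega) h1
    · exact h2
    · omega
    · omega
  · rcases ht.sound _ hne with ⟨v, hv, h1, h2⟩ | ⟨v, j, hv, hj, h1, h2⟩ | ⟨v, j, hv, hj, h1, h2⟩
    · exact ⟨v, _, hv, le_rfl, h1⟩
    · exact ⟨v, _, hv, by omega, h1⟩
    · exact ⟨v, _, hv, by omega, h1⟩

/-- All tables, with the twins of the entries that satisfy `D`. -/
structure Linking (P : PortGraph) (inp : ℕ → ℕ) (D : ℕ → Prop) (s : State) : Prop where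
  prepared : Prepared P inp s
  entries : EntryTables P inp (P.start P.n) (s.mem 9) (s.mem 10) (s.mem 11) (s.mem 12) (s.mem 13)
  owners : OwnerTable P P.n (P.start P.n) (s.mem 3)
  twins : TwinTable P D (s.mem 2)
  last_eq : ∀ v, v < P.n → s.mem 4 (v + 1) = 2 * P.start v + 2 * P.deg v
  last_zero : s.mem 4 0 = 0
  first_eq : ∀ v, v < P.n → s.mem 5 (v + 1) = 2 * P.start v

theorem Indexed.linking {P : PortGraph} {inp : ℕ → ℕ} {s : State}
    (h : Indexed P inp P.n (P.start P.n) s) : Linking P inp (fun _ => False) s :=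
  ⟨h.prepared, h.entries, h.owners,
    ⟨fun g hg => Or.inl (h.vertices.twin_sound g hg), h.vertices.twin_last,
      fun _ _ _ _ h => h.elim, fun _ _ _ _ h => h.elim⟩,
    h.vertices.last_eq, h.vertices.last_zero, h.vertices.first_eq⟩

theorem Linking.mono {P : PortGraph} {inp : ℕ → ℕ} {D D' : ℕ → Prop} {s : State}
    (h : Linking P inp D s) (hD : ∀ j, P.IsEntry j → D' j → D j) : Linking P inp D' s :=
  ⟨h.prepared, h.entries, h.owners, h.twins.mono hD, h.last_eq, h.last_zero, h.first_eq⟩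

@[simp] theorem linking_setReg {P : PortGraph} {inp : ℕ → ℕ} {D : ℕ → Prop} {s : State} {x k : ℕ}
    (hx : 3 ≤ x) (hx' : 12 ≠ x) : Linking P inp D (s.setReg x k) ↔ Linking P inp D s := by
  constructor
  · rintro ⟨h1, h2, h3, h4, h5, h6, h7⟩
    exact ⟨(prepared_setReg hx hx').1 h1, h2, h3, h4, h5, h6, h7⟩
  · rintro ⟨h1, h2, h3, h4, h5, h6, h7⟩
    exact ⟨(prepared_setReg hx hx').2 h1, h2, h3, h4, h5, h6, h7⟩

@[simp] theorem linking_setMem {P : PortGraph} {inp : ℕ → ℕ} {D : ℕ → Prop} {s : State} {i k : ℕ} :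
    Linking P inp D (s.setMem 14 i k) ↔ Linking P inp D s := by
  constructor
  · rintro ⟨h1, h2, h3, h4, h5, h6, h7⟩
    exact ⟨(prepared_setMem (by omega) (by omega)).1 h1, by simpa using h2, by simpa using h3,
      by simpa using h4, by simpa using h5, by simpa using h6, by simpa using h7⟩
  · rintro ⟨h1, h2, h3, h4, h5, h6, h7⟩
    exact ⟨(prepared_setMem (by omega) (by omega)).2 h1, by simpa using h2, by simpa using h3,
      by simpa using h4, by simpa using h5, by simpa using h6, by simpa using h7⟩

/-- Record the entry in register 5 under its neighbour. -/
def noteEntry : Prog := block [.load 10 0 5, .store 14 10 5, .add 5 5 1]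

/-- Link the entry in register 11 with the reverse entry, and go to the previous entry for the same
neighbour. -/
def linkEntry : Prog :=
  block [.load 10 11 11, .load 13 14 10, .load 7 12 11, .load 8 13 13, .store 2 7 8, .load 7 13 11,
    .load 8 12 13, .store 2 7 8, .load 11 10 11]

/-- Link the half-edges of all entries with their twins. -/
def linkTwins : Prog :=
  block [.const 3 0, .const 5 1, .loop (.lt 3 12) (block [.load 6 0 5, .add 5 5 1, .add 9 5 6,
    .loop (.lt 5 9) noteEntry, .load 11 9 3, .loop (.lt 0 11) linkEntry, .add 3 3 1])]

/-- Bank 14 is never cleared. While `v` is processed, only cells of neighbours of `v` will be read,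
and exactly these have just been rewritten. -/
theorem wp_noteEntries {P : PortGraph} {inp : ℕ → ℕ} (hinp : P.IsInput inp) {D : ℕ → Prop}
    {W T v t : ℕ} {s : State} (hW : 2 * P.start P.n ≤ W) (hv : v < P.n)
    (hI : Linking P inp D s) (h3 : s.reg 3 = v) (h5 : s.reg 5 = P.start v)
    (h9 : s.reg 9 = P.start v + P.deg v) (hT : t + 10 * P.deg v + 2 ≤ T) :
    WP W (.loop (.lt 5 9) noteEntry) (fun t s => Linking P inp D s ∧ s.reg 3 = v ∧
      s.reg 5 = P.start v + P.deg v ∧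
      (∀ k, k < P.deg v → s.mem 14 (P.nbr v k) = P.start v + k) ∧ t ≤ T) t s := by
  have hst := P.start_le hv
  refine WP.loop (fun t s => ∃ k, k ≤ P.deg v ∧ Linking P inp D s ∧ s.reg 3 = v ∧
    s.reg 5 = P.start v + k ∧ s.reg 9 = P.start v + P.deg v ∧
    (∀ j, j < k → s.mem 14 (P.nbr v j) = P.start v + j) ∧ t + 10 * (P.deg v - k) + 2 ≤ T) T ?_ ?_ ?_ ?_
  · exact ⟨0, by omega, hI, h3, h5, h9, fun j hj => by omega, hT⟩
  · rintro t s ⟨k, -, -, -, -, -, -, h⟩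
    omega
  · rintro t s - ⟨k, hk, hI, h3, h5, h9, hm, hT⟩ hc
    simp only [Test.Holds] at hc
    have hk' : k < P.deg v := by omega
    have h1 := hI.prepared.one
    have h0 := hI.prepared.input
    have hin : s.mem 0 (s.reg 5) = P.nbr v k := by rw [h0, h5, hinp.nbr v k hv hk']
    have hlt := P.nbr_lt v k hv hk'
    refine WP.of_vc ?_
    simp only [noteEntry, vc_block_cons, vc_block_nil, vc]
    refine ⟨by simp; omega, k + 1, hk', by simpa using hI, by simpa using h3,
      by simp; omega, by simpa using h9, fun j hj => ?_, by omega⟩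
    simp [hin]
    rcases (show j < k ∨ j = k by omega) with h | rfl
    · have hne : P.nbr v j ≠ P.nbr v k := fun he => by
        have := P.nbr_inj v j k hv (by omega) hk' he
        omega
      rw [Function.update_of_ne hne, hm j h]
    · rw [Function.update_self, h5]
  · rintro t s - ⟨k, hk, hI, h3, h5, h9, hm, hT⟩ hc
    simp only [Test.Holds] at hc
    obtain rfl : k = P.deg v := by omega
    exact ⟨hI, h3, h5, hm, by omega⟩

/-- The number of input cells that hold a number above `v`, or stand at an address up to `g` and hold
`v`. -/
def pending (P : PortGraph) (inp : ℕ → ℕ) (v g : ℕ) : ℕ :=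
  {j ∈ Finset.range (P.start P.n) | v < inp j ∨ inp j = v ∧ j ≤ g}.card

/-- `pending` is the potential for the walks along all linked lists together. It drops with each
link followed and does not rise from one vertex to the next, so the walks take at most as many
rounds in total as there are input cells; the header and degree cells counted along do no harm. -/
theorem pending_lt {P : PortGraph} {inp : ℕ → ℕ} {v g g' : ℕ} (hg : g < P.start P.n)
    (hv : inp g = v) (h : g' < g) : pending P inp v g' < pending P inp v g := by
  refine Finset.card_lt_card ⟨fun j hj => ?_, fun hs => ?_⟩
  · simp only [Finset.mem_filter, Finset.mem_range] at hj ⊢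
    omega
  · have := hs (x := g) (by simp [hg, hv])
    simp only [Finset.mem_filter, Finset.mem_range] at this
    omega

theorem pending_succ_le {P : PortGraph} {inp : ℕ → ℕ} {v g g' : ℕ} :
    pending P inp (v + 1) g ≤ pending P inp v g' := by
  refine Finset.card_le_card fun j hj => ?_
  simp only [Finset.mem_filter, Finset.mem_range] at hj ⊢
  omega

theorem pending_le {P : PortGraph} {inp : ℕ → ℕ} {v g : ℕ} :
    pending P inp v g ≤ pending P inp v (P.start P.n) := by
  refine Finset.card_le_card fun j hj => ?_
  simp only [Finset.mem_filter, Finset.mem_range] at hj ⊢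
  omega

theorem pending_le_start {P : PortGraph} {inp : ℕ → ℕ} {v g : ℕ} :
    pending P inp v g ≤ P.start P.n :=
  (Finset.card_filter_le _ _).trans (Finset.card_range _).le

theorem wp_linkEntries {P : PortGraph} {inp : ℕ → ℕ} (hinp : P.IsInput inp)
    {W T v p t : ℕ} {s : State} (hv : v < P.n)
    (hI : Linking P inp (fun j => inp j < v) s) (h3 : s.reg 3 = v) (h5 : s.reg 5 = p)
    (hm : ∀ k, k < P.deg v → s.mem 14 (P.nbr v k) = P.start v + k)
    (h11 : s.reg 11 = s.mem 9 v) (hT : t + 20 * pending P inp v (s.mem 9 v) + 2 ≤ T) :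
    WP W (.loop (.lt 0 11) linkEntry) (fun t s => Linking P inp (fun j => inp j < v + 1) s ∧
      s.reg 3 = v ∧ s.reg 5 = p ∧ t + 20 * pending P inp v 0 ≤ T) t s := by
  refine WP.loop (fun t s => Linking P inp (fun j => inp j < v ∨ inp j = v ∧ s.reg 11 < j) s ∧
    s.reg 3 = v ∧ s.reg 5 = p ∧ (∀ k, k < P.deg v → s.mem 14 (P.nbr v k) = P.start v + k) ∧
    (s.reg 11 ≠ 0 → P.IsEntry (s.reg 11) ∧ inp (s.reg 11) = v) ∧
    t + 20 * pending P inp v (s.reg 11) + 2 ≤ T) T ?_ ?_ ?_ ?_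
  · refine ⟨hI.mono fun j hj hd => ?_, h3, h5, hm, fun hne => ?_, by rw [h11]; exact hT⟩
    · rcases hd with hd | ⟨hd, hlt⟩
      · exact hd
      · have := hI.entries.le_head j hj hj.lt
        rw [hd] at this
        omega
    · rw [h11] at hne ⊢
      have := hI.entries.head_entry v hne
      exact ⟨this.1, this.2.2⟩
  · rintro t s ⟨-, -, -, -, -, h⟩
    omega
  · rintro t s - ⟨hI, h3, h5, hm, hg, hT⟩ hc
    simp only [Test.Holds, hI.prepared.zero] at hc
    obtain ⟨hE, hgv⟩ := hg (by omega)
    obtain ⟨hp, he, ho, ht, hl, hl0, hf⟩ := id hI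
    obtain ⟨g, hgr⟩ : ∃ g, s.reg 11 = g := ⟨_, rfl⟩
    rw [hgr] at hc hE hgv hT ht
    obtain ⟨u, k, hu, hk, hgu⟩ := id hE
    have hnbr : P.nbr u k = v := by rw [← hinp.nbr u k hu hk, ← hgu, hgv]
    have hrev := P.rev_lt u k hu hk
    have hnr := P.nbr_rev u k hu hk
    have hlt : ∀ u k, u < P.n → k < P.deg u → P.start u + k < P.start P.n :=
      fun u k hu hk => IsEntry.lt ⟨u, k, hu, hk, rfl⟩
    rw [hnbr] at hrev hnr
    have e1 : s.mem 11 g = u := by rw [hgu, he.src_eq u k hu hk (hlt u k hu hk)]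
    -- The entry `g` for `v` belongs to `u`, so `u` is a neighbour of `v`, and bank 14 gives the
    -- address of `u` in the list of `v`: the reverse entry.
    have e2 : s.mem 14 u = P.start v + P.rev u k := by rw [← hm _ hrev, hnr]
    have e3 : s.mem 12 g = 2 * P.start u + k := by rw [hgu, he.minus_eq u k hu hk (hlt u k hu hk)]
    have e4 : s.mem 13 g = 2 * P.start u + (P.deg u + k) := by
      rw [hgu, he.plus_eq u k hu hk (hlt u k hu hk)]
    have e5 : s.mem 12 (P.start v + P.rev u k) = 2 * P.start v + P.rev u k :=
      he.minus_eq v _ hv hrev (hlt v _ hv hrev)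
    have e6 : s.mem 13 (P.start v + P.rev u k) = 2 * P.start v + (P.deg v + P.rev u k) :=
      he.plus_eq v _ hv hrev (hlt v _ hv hrev)
    have hsu := P.start_le hu
    have hsv := P.start_le hv
    have hnext : s.mem 10 g < g := by
      by_cases h0 : s.mem 10 g = 0
      · omega
      · exact (he.next_entry g hE hE.lt h0).2.1
    have hgl := hE.lt
    refine WP.of_vc ?_
    simp only [linkEntry, vc_block_cons, vc_block_nil, vc]
    refine ⟨⟨by simpa using hp, by simpa using he, by simpa using ho, ?_, by simpa using hl,
        by simpa using hl0, by simpa using hf⟩, by simpa using h3, by simpa using h5,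
      by simpa using hm, ?_, ?_⟩
    -- By `le_next` no entry for `v` lies strictly between `next g` and `g`, so only `g` is added to
    -- the linked entries.
    · have := ht.step (D' := fun j => inp j < v ∨ inp j = v ∧ s.mem 10 g < j) hu hk fun j hj hd => by
        rcases hd with hd | ⟨hd, hlt⟩
        · exact Or.inl (Or.inl hd)
        · rcases lt_trichotomy j g with h | h | h
          · have := he.le_next g hE hE.lt j hj (by rw [hd, hgv]) h
            omega
          · exact Or.inr (h.trans hgu)
          · exact Or.inl (Or.inr ⟨hd, h⟩)
      rw [hnbr] at this
      simp [hgr, e1, e2, e3, e4, e5, e6]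
      exact this
    · simp [hgr]
      intro hne
      have := he.next_entry g hE hE.lt hne
      exact ⟨this.1, by rw [this.2.2, hgv]⟩
    · have := pending_lt hgl hgv hnext
      simp [hgr]
      omega
  · rintro t s - ⟨hI, h3, h5, hm, hg, hT⟩ hc
    simp only [Test.Holds, hI.prepared.zero] at hc
    have h0 : s.reg 11 = 0 := by omega
    rw [h0] at hT hI
    refine ⟨hI.mono fun j hj hd => ?_, h3, h5, by omega⟩
    have := hj.ne_zero
    omega

theorem wp_linkTwins {P : PortGraph} {inp : ℕ → ℕ} (hinp : P.IsInput inp) {W T t : ℕ} {s : State}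
    (hW : 2 * P.start P.n ≤ W) (hn : P.n + 1 ≤ W) (hI : Linking P inp (fun _ => False) s)
    (hT : t + 80 * P.start P.n + 20 ≤ T) :
    WP W linkTwins (fun t s => Linking P inp (fun _ => True) s ∧ t ≤ T) t s := by
  have h2n := P.two_le_start P.n
  refine WP.of_vc ?_
  simp only [linkTwins, vc_block_cons, vc]
  refine ⟨by omega, by omega, ?_⟩
  refine WP.loop (fun t s => s.reg 3 ≤ P.n ∧ Linking P inp (fun j => inp j < s.reg 3) s ∧
    s.reg 5 + 1 = P.start (s.reg 3) ∧ t + 60 * (P.start P.n - P.start (s.reg 3)) +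
      20 * pending P inp (s.reg 3) (P.start P.n) + 5 ≤ T) T ?_ ?_ ?_ ?_
  · have := pending_le_start (P := P) (inp := inp) (v := 0) (g := P.start P.n)
    refine ⟨by simp, ?_, by simp [start], ?_⟩
    · simpa using hI
    · simp
      omega
  · rintro t s ⟨-, -, -, h⟩
    omega
  · rintro t s - ⟨h3n, hI, h5, hT⟩ hc
    obtain ⟨v, hv'⟩ : ∃ v, s.reg 3 = v := ⟨_, rfl⟩
    rw [hv'] at h3n hI h5 hT
    have hp := hI.prepared
    have h1 := hp.one
    have h12 := hp.count
    simp only [Test.Holds] at hc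
    have hv : v < P.n := by omega
    have hst := P.start_le hv
    have h2v := P.two_le_start v
    have hd : s.mem 0 (s.reg 5) = P.deg v := by
      rw [hp.input, show s.reg 5 = P.start v - 1 by omega, hinp.deg v hv]
    have h51 : s.reg 5 + s.reg 1 = P.start v := by omega
    refine WP.of_vc ?_
    simp only [vc_block_cons, vc]
    refine ⟨by simp; omega, by simp; omega, ?_⟩
    refine WP.conseq (wp_noteEntries hinp (v := v) (D := fun j => inp j < v)
      (T := t + 10 * P.deg v + 10) hW hv ?_ ?_ ?_ ?_ ?_) ?_
    · simpa using hI
    · simpa using hv'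
    · simp [h51]
    · simp [h51, hd]
    · omega
    · rintro t' s' - ⟨hI', h3', h5', hm', hT'⟩
      have hpl := pending_le (P := P) (inp := inp) (v := v) (g := s'.mem 9 v)
      simp only [vc_block_cons, vc]
      refine WP.conseq (wp_linkEntries hinp (v := v) (p := P.start v + P.deg v)
        (T := t + 10 * P.deg v + 20 + 20 * pending P inp v (P.start P.n)) hv ?_ ?_ ?_ ?_ ?_ ?_) ?_
      · simpa using hI'
      · simpa using h3'
      · simpa using h5'
      · simpa using hm'
      · simp [h3']
      · simp
        omega
      · rintro t'' s'' - ⟨hI'', h3'', h5'', hT''⟩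
        have hstart : P.start (v + 1) = P.start v + P.deg v + 1 := rfl
        have hps := pending_succ_le (P := P) (inp := inp) (v := v) (g := P.start P.n) (g' := 0)
        have h1'' := hI''.prepared.one
        simp only [vc_block_cons, vc_block_nil, vc]
        refine ⟨by omega, by simp [h3'', h1'']; omega, ?_, by simp [h3'', h1'', h5'', hstart], ?_⟩
        · simp [h3'', h1'']
          exact hI''.mono fun j _ hd => Nat.lt_succ_of_le hd
        · simp [h3'', h1'', hstart]
          omega
  · rintro t s - ⟨h3n, hI, h5, hT⟩ hc
    simp only [Test.Holds] at hc
    have h12 := hI.prepared.count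
    refine ⟨hI.mono fun j hj _ => ?_, by omega⟩
    obtain ⟨u, k, hu, hk, rfl⟩ := hj
    have := P.nbr_lt u k hu hk
    rw [hinp.nbr u k hu hk]
    omega

end RAM

/-! ### The whole program. -/

namespace RAM

open PortGraph

/-- Find a strongly dominant matching. -/
def findStronglyDominant : Prog := block [indexEntries, linkTwins, solve]

theorem wp_findStronglyDominant {P : PortGraph} {inp : ℕ → ℕ} (hinp : P.IsInput inp) {W : ℕ}
    {s : State} (hreg : ∀ x, s.reg x = 0) (h0 : s.mem 0 = inp)
    (hmem : ∀ b, b ≠ 0 → s.mem b = fun _ => 0) (hW : 730 * P.start P.n + 140 ≤ W) :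
    WP W findStronglyDominant (fun t s => t ≤ W ∧
      ∃ (tw ow : ℕ → ℕ) (hR : P.Represents tw ow), Solved hR.toHalfEdges s) 0 s := by
  have hle : ∀ u, u + 2 ≤ P.start u := by
    intro u
    induction u with
    | zero => exact le_rfl
    | succ u ih =>
      rw [start]
      omega
  have hn := hle P.n
  refine WP.seq (WP.conseq (wp_indexEntries hinp (T := 60 * P.start P.n + 20) (by omega) (by omega)
    hreg h0 hmem (by omega)) ?_)
  rintro t₁ s₁ - ⟨hI, ht₁⟩
  refine WP.seq (WP.conseq (wp_linkTwins hinp (T := 140 * P.start P.n + 40) (by omega) (by omega)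
    hI.linking (by omega)) ?_)
  rintro t₂ s₂ - ⟨hL, ht₂⟩
  have hR := represents_of_tables hL.twins hL.owners
  have hsize := hR.size_le
  -- The factor 730 is 140 for the preprocessing, 440 for `220 * size` with `size ≤ 2 * start n`,
  -- and 150 for the vertices.
  refine WP.seq (WP.conseq (wp_solve (H := hR.toHalfEdges) (T := 730 * P.start P.n + 120) ?_ ?_
    (by omega) ⟨hL.prepared.zero, hL.prepared.one, rfl, rfl, hL.prepared.output⟩ hL.prepared.limit
    hL.prepared.marks ?_ ?_ hL.last_zero ?_) ?_)
  · rintro v ⟨h1, h2⟩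
    have := P.start_le (u := v - 1) (u' := P.n) (lt_of_lt_of_le (by omega) h2)
    change 2 * P.start (v - 1) + 2 * P.deg (v - 1) + 1 < W
    omega
  · change P.n + 1 ≤ W
    omega
  · rintro v ⟨h1, h2⟩
    obtain ⟨u, rfl⟩ := Nat.exists_eq_add_of_le' h1
    exact hL.first_eq u h2
  · rintro v ⟨h1, h2⟩
    obtain ⟨u, rfl⟩ := Nat.exists_eq_add_of_le' h1
    exact hL.last_eq u h2
  · change t₂ + 220 * hR.toHalfEdges.size + 150 * P.n + 80 ≤ _
    omega
  · rintro t₃ s₃ - ⟨hs, ht₃⟩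
    refine WP.of_vc ?_
    simp only [vc_block_nil]
    exact ⟨by omega, _, _, hR, hs⟩

end RAM

/-! ### The input word as adjacency lists. -/

theorem ListedBefore.iff_lt {α : Type*} {l : List α} (hl : l.Nodup) {i j : ℕ} {x y : α}
    (hi : l[i]? = some x) (hj : l[j]? = some y) : ListedBefore l x y ↔ i < j := by
  refine ⟨?_, fun h => ⟨i, j, h, hi, hj⟩⟩
  rintro ⟨i', j', hij, hi', hj'⟩
  rwa [(List.getElem?_inj (List.getElem?_eq_some_iff.1 hi).1 hl).1 (hi.trans hi'.symm),
    (List.getElem?_inj (List.getElem?_eq_some_iff.1 hj).1 hl).1 (hj.trans hj'.symm)]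

namespace Roommates

variable {n : ℕ} (G : Roommates (Fin n))

/-- The preference list of a vertex as a list of numbers. -/
def prefNat (u : ℕ) : List ℕ := if h : u < n then (G.pref ⟨u, h⟩).map Fin.val else []

theorem prefNat_coe (u : Fin n) : G.prefNat u = (G.pref u).map Fin.val := by
  simp [prefNat]

theorem nodup_prefNat (u : ℕ) : (G.prefNat u).Nodup := by
  rw [prefNat]
  split_ifs
  · exact (G.nodup_pref _).map Fin.val_injective
  · exact List.nodup_nil

theorem mem_prefNat {u v : ℕ} :
    v ∈ G.prefNat u ↔ ∃ (hu : u < n) (hv : v < n), G.graph.Adj ⟨u, hu⟩ ⟨v, hv⟩ := by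
  rw [prefNat]
  split_ifs with hu
  · simp only [List.mem_map, G.mem_pref]
    constructor
    · rintro ⟨w, hw, rfl⟩
      exact ⟨hu, w.2, hw⟩
    · rintro ⟨_, hv, h⟩
      exact ⟨⟨v, hv⟩, h, rfl⟩
  · simp [hu]

theorem mem_prefNat_comm {u v : ℕ} : v ∈ G.prefNat u ↔ u ∈ G.prefNat v := by
  rw [mem_prefNat, mem_prefNat]
  exact ⟨fun ⟨hu, hv, h⟩ => ⟨hv, hu, h.symm⟩, fun ⟨hv, hu, h⟩ => ⟨hu, hv, h.symm⟩⟩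

theorem getD_mem_prefNat {u k : ℕ} (hk : k < (G.prefNat u).length) :
    (G.prefNat u).getD k 0 ∈ G.prefNat u := by
  rw [List.getD_eq_getElem _ _ hk]
  exact List.getElem_mem hk

/-- The graph by lists of numbers. -/
def toPortGraph : PortGraph where
  n := n
  deg u := (G.prefNat u).length
  nbr u k := (G.prefNat u).getD k 0
  rev u k := (G.prefNat ((G.prefNat u).getD k 0)).idxOf u
  nbr_lt u k _ hk := by
    obtain ⟨-, hv, -⟩ := G.mem_prefNat.1 (G.getD_mem_prefNat hk)
    exact hv
  rev_lt u k _ hk := List.idxOf_lt_length_iff.2 (G.mem_prefNat_comm.1 (G.getD_mem_prefNat hk))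
  nbr_rev u k _ hk := by
    have := List.idxOf_lt_length_iff.2 (G.mem_prefNat_comm.1 (G.getD_mem_prefNat hk))
    rw [List.getD_eq_getElem _ _ this, List.getElem_idxOf]
  nbr_inj u j k _ hj hk h := by
    rw [List.getD_eq_getElem _ _ hj, List.getD_eq_getElem _ _ hk] at h
    exact (G.nodup_prefNat u).getElem_inj_iff.1 h
  nbr_ne u k _ hk h := by
    have := G.getD_mem_prefNat hk
    rw [h] at this
    obtain ⟨hu, hv, h⟩ := G.mem_prefNat.1 this
    exact h.ne rfl

theorem deg_toPortGraph (u : Fin n) : G.toPortGraph.deg u = (G.pref u).length := by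
  simp [toPortGraph, prefNat_coe]

/-- The degrees sum to twice the number of edges, which turns the input length into the bound in `n`
and `m`. -/
theorem start_toPortGraph :
    G.toPortGraph.start n = 2 + n + 2 * G.graph.edgeSet.ncard := by
  classical
  have key : ∀ m, G.toPortGraph.start m = 2 + m + ∑ u ∈ Finset.range m, G.toPortGraph.deg u := by
    intro m
    induction m with
    | zero => rfl
    | succ m ih =>
      rw [PortGraph.start, ih, Finset.sum_range_succ]
      omega
  rw [key, Finset.sum_range, Set.ncard_eq_toFinset_card', ← SimpleGraph.edgeFinset,
    ← SimpleGraph.sum_degrees_eq_twice_card_edges]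
  congr 1
  refine Finset.sum_congr rfl fun u _ => ?_
  rw [deg_toPortGraph, ← List.toFinset_card_of_nodup (G.nodup_pref u),
    ← SimpleGraph.card_neighborFinset_eq_degree]
  congr 1
  ext v
  simp [G.mem_pref]

theorem encode_eq : G.encode =
    n :: (List.range n).flatMap (fun u => (G.prefNat u).length :: G.prefNat u) := by
  rw [encode, ← List.map_coe_finRange_eq_range, List.flatMap_map]
  simp [prefNat_coe]

theorem length_flatMap_prefNat (m : ℕ) :
    ((List.range m).flatMap (fun u => (G.prefNat u).length :: G.prefNat u)).length + 2 =
      G.toPortGraph.start m := by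
  induction m with
  | zero => rfl
  | succ m ih =>
    rw [List.range_succ, List.flatMap_append, List.length_append, PortGraph.start, ← ih]
    simp [toPortGraph]
    omega

theorem getD_flatMap_prefNat {m u x : ℕ} (hu : u < m) (hx : x ≤ (G.prefNat u).length) :
    ((List.range m).flatMap (fun u => (G.prefNat u).length :: G.prefNat u)).getD
      (G.toPortGraph.start u - 2 + x) 0 = ((G.prefNat u).length :: G.prefNat u).getD x 0 := by
  induction m with
  | zero => omega
  | succ m ih =>
    have hl := G.length_flatMap_prefNat m
    rw [List.range_succ, List.flatMap_append]
    rcases (show u < m ∨ u = m by omega) with h | rfl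
    · have h1 := G.toPortGraph.start_le h
      have h2 : G.toPortGraph.deg u = (G.prefNat u).length := rfl
      have h3 := G.toPortGraph.two_le_start u
      rw [List.getD_append _ _ _ _ (by omega), ih h]
    · rw [List.getD_append_right _ _ _ _ (by omega)]
      congr 1
      · simp
      · omega

theorem isInput_encode : G.toPortGraph.IsInput (fun i => G.encode.getD i 0) := by
  rw [encode_eq]
  refine ⟨by simp [toPortGraph], fun u hu => ?_, fun u k hu hk => ?_⟩
  · have h := G.getD_flatMap_prefNat (m := n) (x := 0) hu (by omega)
    have h2 := G.toPortGraph.two_le_start u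
    rw [show G.toPortGraph.start u - 1 = G.toPortGraph.start u - 2 + 0 + 1 by omega,
      List.getD_cons_succ]
    exact h
  · have h := G.getD_flatMap_prefNat (m := n) (x := k + 1) hu hk
    have h2 := G.toPortGraph.two_le_start u
    rw [show G.toPortGraph.start u + k = G.toPortGraph.start u - 2 + (k + 1) + 1 by omega,
      List.getD_cons_succ]
    exact h

theorem le_of_mem_encode {x : ℕ} (hx : x ∈ G.encode) : x ≤ G.toPortGraph.start n := by
  have hle : ∀ u, u + 2 ≤ G.toPortGraph.start u := by
    intro u
    induction u with
    | zero => exact le_rfl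
    | succ u ih =>
      rw [PortGraph.start]
      omega
  have hn := hle n
  rw [encode_eq, List.mem_cons, List.mem_flatMap] at hx
  rcases hx with rfl | ⟨u, hu, hx⟩
  · omega
  · rcases List.mem_cons.1 hx with rfl | hx
    · have := G.toPortGraph.start_le (List.mem_range.1 hu)
      have h2 : G.toPortGraph.deg u = (G.prefNat u).length := rfl
      omega
    · obtain ⟨-, hx, -⟩ := G.mem_prefNat.1 hx
      omega

theorem init_encode_bounded {W : ℕ} (hW : G.toPortGraph.start n ≤ W) :
    (RAM.init G.encode).Bounded W := by
  refine ⟨fun _ => Nat.zero_le _, fun b i => ?_⟩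
  simp only [RAM.init]
  split_ifs
  · rcases lt_or_ge i G.encode.length with h | h
    · rw [List.getD_eq_getElem _ _ h]
      exact (G.le_of_mem_encode (List.getElem_mem h)).trans hW
    · rw [List.getD_eq_default _ _ h]
      exact Nat.zero_le _
  · exact Nat.zero_le _

end Roommates

/-! ### Half-edge matchings and matchings of the bidirected instance. -/

namespace Roommates

variable {n : ℕ} (G : Roommates (Fin n))

/-- The half-edge at `u` for a neighbour in a form. -/
def halfEdge (u : Fin n) : Fin n × Form → ℕ
  | (v, .minus) => 2 * G.toPortGraph.start u + (G.pref u).idxOf v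
  | (v, .plus) => 2 * G.toPortGraph.start u + ((G.pref u).length + (G.pref u).idxOf v)

/-- The other form. -/
def Form.flip : Form → Form
  | .plus => .minus
  | .minus => .plus

variable {G}

theorem idxOf_lt {u v : Fin n} (h : G.graph.Adj u v) : (G.pref u).idxOf v < (G.pref u).length :=
  List.idxOf_lt_length_iff.2 ((G.mem_pref u v).2 h)

theorem exists_halfEdge_eq {u v : Fin n} (h : G.graph.Adj u v) (f : Form) :
    ∃ x, x < 2 * (G.pref u).length ∧ G.halfEdge u (v, f) = 2 * G.toPortGraph.start u + x ∧
      (G.biPref u)[x]? = some (v, f) := by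
  have hi := idxOf_lt h
  have hv : (G.pref u)[(G.pref u).idxOf v] = v := List.getElem_idxOf hi
  cases f
  · exact ⟨_, by omega, rfl, by rw [G.biPref_getElem?_plus u hi, hv]⟩
  · exact ⟨_, by omega, rfl, by rw [G.biPref_getElem?_minus u hi, hv]⟩

/-- Up to the offset of the vertex, a half-edge is the position in `biPref`. -/
theorem listedBefore_iff_halfEdge_lt {u v w : Fin n} (hv : G.graph.Adj u v) (hw : G.graph.Adj u w)
    (f g : Form) :
    ListedBefore (G.biPref u) (v, f) (w, g) ↔ G.halfEdge u (v, f) < G.halfEdge u (w, g) := by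
  obtain ⟨x, -, hx, hx'⟩ := exists_halfEdge_eq hv f
  obtain ⟨y, -, hy, hy'⟩ := exists_halfEdge_eq hw g
  rw [ListedBefore.iff_lt (G.nodup_biPref u) hx' hy', hx, hy]
  omega

theorem halfEdge_inj {u v w : Fin n} (hv : G.graph.Adj u v) (hw : G.graph.Adj u w) {f g : Form}
    (h : G.halfEdge u (v, f) = G.halfEdge u (w, g)) : v = w ∧ f = g := by
  obtain ⟨x, -, hx, hx'⟩ := exists_halfEdge_eq hv f
  obtain ⟨y, -, hy, hy'⟩ := exists_halfEdge_eq hw g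
  obtain rfl : x = y := by omega
  rw [hx'] at hy'
  simpa using hy'

theorem nbr_idxOf {u v : Fin n} (h : G.graph.Adj u v) :
    G.toPortGraph.nbr u ((G.pref u).idxOf v) = v := by
  have hi := idxOf_lt h
  simp [toPortGraph, prefNat_coe, hi]

theorem rev_idxOf {u v : Fin n} (h : G.graph.Adj u v) :
    G.toPortGraph.rev u ((G.pref u).idxOf v) = (G.pref v).idxOf u := by
  refine G.toPortGraph.nbr_inj v _ _ v.2 ?_ (by rw [deg_toPortGraph]; exact idxOf_lt h.symm) ?_
  · have := G.toPortGraph.rev_lt u _ u.2 (by rw [deg_toPortGraph]; exact idxOf_lt h)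
    rwa [nbr_idxOf h] at this
  · have := G.toPortGraph.nbr_rev u _ u.2 (by rw [deg_toPortGraph]; exact idxOf_lt h)
    rw [nbr_idxOf h] at this
    rw [this, nbr_idxOf h.symm]

theorem twin_halfEdge {tw ow : ℕ → ℕ} (hR : G.toPortGraph.Represents tw ow) {u v : Fin n}
    (h : G.graph.Adj u v) (f : Form) :
    tw (G.halfEdge u (v, f)) = G.halfEdge v (u, f.flip) := by
  have hk : (G.pref u).idxOf v < G.toPortGraph.deg u := by
    rw [deg_toPortGraph]
    exact idxOf_lt h
  cases f
  · have := hR.twin_plus u _ u.2 hk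
    rwa [nbr_idxOf h, rev_idxOf h, deg_toPortGraph] at this
  · have := hR.twin_minus u _ u.2 hk
    rwa [nbr_idxOf h, rev_idxOf h, deg_toPortGraph] at this

theorem owner_halfEdge {tw ow : ℕ → ℕ} (hR : G.toPortGraph.Represents tw ow) {u v : Fin n}
    (h : G.graph.Adj u v) (f : Form) :
    ow (G.halfEdge u (v, f)) = u + 1 := by
  obtain ⟨x, hx, he, -⟩ := exists_halfEdge_eq h f
  rw [he]
  exact hR.owner_eq u x u.2 (by rw [deg_toPortGraph]; exact hx.le)

theorem eq_last_or_halfEdge {tw ow : ℕ → ℕ} (hR : G.toPortGraph.Represents tw ow) {u : Fin n}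
    {h : ℕ} (hh : ow h = u + 1) :
    h = 2 * G.toPortGraph.start u + 2 * G.toPortGraph.deg u ∨
      ∃ v f, G.graph.Adj u v ∧ h = G.halfEdge u (v, f) := by
  obtain ⟨w, x, hw, hx, rfl⟩ := hR.owner_ne h (by omega)
  rw [hR.owner_eq w x hw hx] at hh
  obtain rfl : w = u := by omega
  rw [deg_toPortGraph] at hx ⊢
  have hadj : ∀ k (hk : k < (G.pref u).length), G.graph.Adj u (G.pref u)[k] :=
    fun k hk => (G.mem_pref _ _).1 (List.getElem_mem hk)
  have hidx : ∀ k (hk : k < (G.pref u).length), (G.pref u).idxOf (G.pref u)[k] = k :=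
    fun k hk => (G.nodup_pref u).idxOf_getElem k hk
  rcases lt_or_ge x (G.pref u).length with h1 | h1
  · exact Or.inr ⟨_, .minus, hadj x h1, by rw [halfEdge, hidx x h1]⟩
  · rcases hx.lt_or_eq with h2 | rfl
    · obtain ⟨k, rfl⟩ := Nat.exists_eq_add_of_le h1
      have hk : k < (G.pref u).length := by omega
      exact Or.inr ⟨_, .plus, hadj k hk, by rw [halfEdge, hidx k hk]⟩
    · exact Or.inl rfl

end Roommates

namespace Roommates

variable {n : ℕ} {G : Roommates (Fin n)}

theorem BiMatched.adj {V : Type*} {G : Roommates V} {M' : Set G.BiEdge} {u v : V} {f : Form}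
    (h : G.BiMatched M' u (v, f)) : G.graph.Adj u v := by
  obtain ⟨e, -, ⟨rfl, h⟩ | ⟨rfl, h⟩⟩ := h
  · obtain ⟨rfl, -⟩ := Prod.mk.inj h
    exact e.adj
  · obtain ⟨rfl, -⟩ := Prod.mk.inj h
    exact e.adj.symm

theorem BiMatched.flip {V : Type*} {G : Roommates V} {M' : Set G.BiEdge} {u v : V} {f : Form}
    (h : G.BiMatched M' u (v, f)) : G.BiMatched M' v (u, f.flip) := by
  obtain ⟨e, he, ⟨rfl, h⟩ | ⟨rfl, h⟩⟩ := h
  · obtain ⟨rfl, rfl⟩ := Prod.mk.inj h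
    exact ⟨e, he, Or.inr ⟨rfl, rfl⟩⟩
  · obtain ⟨rfl, rfl⟩ := Prod.mk.inj h
    exact ⟨e, he, Or.inl ⟨rfl, rfl⟩⟩

theorem BiMatching.biMatched_unique {V : Type*} {G : Roommates V} {M' : Set G.BiEdge}
    (hM : G.BiMatching M') {u : V} {x y : V × Form} (hx : G.BiMatched M' u x)
    (hy : G.BiMatched M' u y) : x = y := by
  obtain ⟨e, he, hx⟩ := hx
  obtain ⟨f, hf, hy⟩ := hy
  obtain rfl := hM u e he f hf (hx.imp And.left And.left) (hy.imp And.left And.left)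
  rcases hx with ⟨rfl, rfl⟩ | ⟨rfl, rfl⟩ <;> rcases hy with ⟨h, rfl⟩ | ⟨h, rfl⟩
  · rfl
  · exact absurd h e.adj.ne'
  · exact absurd h e.adj.ne
  · rfl

/-- The matching of the bidirected instance given by the half-edges along which the vertices are
matched. -/
def biEdges (G : Roommates (Fin n)) (μ : ℕ → ℕ) : Set G.BiEdge :=
  {e | μ (e.fst + 1) = G.halfEdge e.fst (e.snd, .minus)}

theorem isVertex_succ {tw ow : ℕ → ℕ} (hR : G.toPortGraph.Represents tw ow) (u : Fin n) :
    hR.toHalfEdges.IsVertex (u + 1) :=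
  ⟨by omega, u.2⟩

theorem opp_halfEdge {tw ow : ℕ → ℕ} (hR : G.toPortGraph.Represents tw ow) {u v : Fin n}
    (h : G.graph.Adj u v) (f : Form) : hR.toHalfEdges.opp (G.halfEdge u (v, f)) = v + 1 := by
  change ow (tw _) = _
  rw [twin_halfEdge hR h, owner_halfEdge hR h.symm]

theorem halfEdge_flip_of_stable {tw ow : ℕ → ℕ} (hR : G.toPortGraph.Represents tw ow)
    {μ : ℕ → ℕ} (hμ : hR.toHalfEdges.Stable μ) {u v : Fin n} (h : G.graph.Adj u v) {f : Form}
    (he : μ (u + 1) = G.halfEdge u (v, f)) : μ (v + 1) = G.halfEdge v (u, f.flip) := by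
  have := hμ.twin_eq _ (isVertex_succ hR u)
  rw [he, opp_halfEdge hR h] at this
  rw [← this]
  exact twin_halfEdge hR h f

theorem biMatched_biEdges_iff {tw ow : ℕ → ℕ} (hR : G.toPortGraph.Represents tw ow)
    {μ : ℕ → ℕ} (hμ : hR.toHalfEdges.Stable μ) {u v : Fin n} (h : G.graph.Adj u v) (f : Form) :
    G.BiMatched (G.biEdges μ) u (v, f) ↔ μ (u + 1) = G.halfEdge u (v, f) := by
  constructor
  · rintro ⟨e, he, ⟨rfl, hx⟩ | ⟨rfl, hx⟩⟩
    · obtain ⟨rfl, rfl⟩ := Prod.mk.inj hx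
      exact he
    · obtain ⟨rfl, rfl⟩ := Prod.mk.inj hx
      exact halfEdge_flip_of_stable hR hμ e.adj he
  · intro he
    cases f
    · exact ⟨⟨(v, u), h.symm⟩, halfEdge_flip_of_stable hR hμ h he, Or.inr ⟨rfl, rfl⟩⟩
    · exact ⟨⟨(u, v), h⟩, he, Or.inl ⟨rfl, rfl⟩⟩

theorem last_or_biMatched {tw ow : ℕ → ℕ} (hR : G.toPortGraph.Represents tw ow)
    {μ : ℕ → ℕ} (hμ : hR.toHalfEdges.Stable μ) (u : Fin n) :
    μ (u + 1) = 2 * G.toPortGraph.start u + 2 * G.toPortGraph.deg u ∨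
      ∃ v f, G.graph.Adj u v ∧ μ (u + 1) = G.halfEdge u (v, f) ∧
        G.BiMatched (G.biEdges μ) u (v, f) := by
  rcases eq_last_or_halfEdge hR (hμ.owner_eq _ (isVertex_succ hR u)) with h | ⟨v, f, h, he⟩
  · exact Or.inl h
  · exact Or.inr ⟨v, f, h, he, (biMatched_biEdges_iff hR hμ h f).2 he⟩

theorem halfEdge_lt_last {u v : Fin n} (h : G.graph.Adj u v) (f : Form) :
    G.halfEdge u (v, f) < 2 * G.toPortGraph.start u + 2 * G.toPortGraph.deg u := by
  obtain ⟨x, hx, he, -⟩ := exists_halfEdge_eq h f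
  rw [deg_toPortGraph]
  omega

theorem biMatched_of_lt {tw ow : ℕ → ℕ} (hR : G.toPortGraph.Represents tw ow)
    {μ : ℕ → ℕ} (hμ : hR.toHalfEdges.Stable μ) {u v : Fin n} (h : G.graph.Adj u v) {f : Form}
    (hlt : μ (u + 1) < G.halfEdge u (v, f)) :
    ∃ x, G.BiMatched (G.biEdges μ) u x ∧ ListedBefore (G.biPref u) x (v, f) := by
  rcases last_or_biMatched hR hμ u with h1 | ⟨w, g, hw, he, hm⟩
  · have := halfEdge_lt_last h f
    omega
  · exact ⟨(w, g), hm, (listedBefore_iff_halfEdge_lt hw h g f).2 (by omega)⟩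

/-- `not_blocks` gives a weak inequality at one end of each dart. For a dart outside the matching
equality is impossible at either end, since matched half-edges come in twin pairs. A strict
inequality also means that the vertex is not on its loop, so it has a better partner. -/
theorem biStable_biEdges {tw ow : ℕ → ℕ} (hR : G.toPortGraph.Represents tw ow)
    {μ : ℕ → ℕ} (hμ : hR.toHalfEdges.Stable μ) : G.BiStable (G.biEdges μ) := by
  have huniq : ∀ {u v w : Fin n} {f g : Form}, G.BiMatched (G.biEdges μ) u (v, f) →
      G.BiMatched (G.biEdges μ) u (w, g) → v = w ∧ f = g := by
    intro u v w f g h1 h2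
    refine halfEdge_inj h1.adj h2.adj ?_
    rw [← (biMatched_biEdges_iff hR hμ h1.adj f).1 h1, ← (biMatched_biEdges_iff hR hμ h2.adj g).1 h2]
  refine ⟨fun u e he f hf heu hfu => ?_, fun e he => ?_⟩
  · rcases heu with rfl | rfl <;> rcases hfu with h | h
    · have := huniq ⟨e, he, Or.inl ⟨rfl, rfl⟩⟩ ⟨f, hf, Or.inl ⟨h, rfl⟩⟩
      exact SimpleGraph.Dart.ext _ _ (Prod.ext h.symm this.1)
    · have := huniq ⟨e, he, Or.inl ⟨rfl, rfl⟩⟩ ⟨f, hf, Or.inr ⟨h, rfl⟩⟩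
      exact absurd this.2 (by simp)
    · have := huniq ⟨e, he, Or.inr ⟨rfl, rfl⟩⟩ ⟨f, hf, Or.inl ⟨h, rfl⟩⟩
      exact absurd this.2 (by simp)
    · have := huniq ⟨e, he, Or.inr ⟨rfl, rfl⟩⟩ ⟨f, hf, Or.inr ⟨h, rfl⟩⟩
      exact SimpleGraph.Dart.ext _ _ (Prod.ext this.1 h.symm)
  · have hne : μ (e.fst + 1) ≠ G.halfEdge e.fst (e.snd, .minus) := he
    have hne' : μ (e.snd + 1) ≠ G.halfEdge e.snd (e.fst, .plus) := fun h =>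
      he (halfEdge_flip_of_stable hR hμ e.adj.symm h)
    have ho : ow (G.halfEdge e.fst (e.snd, .minus)) = e.fst + 1 := owner_halfEdge hR e.adj _
    have ht : tw (G.halfEdge e.fst (e.snd, .minus)) = _ := twin_halfEdge hR e.adj _
    have hb : μ (ow (G.halfEdge e.fst (e.snd, .minus))) ≤ G.halfEdge e.fst (e.snd, .minus) ∨
        μ (hR.toHalfEdges.opp (G.halfEdge e.fst (e.snd, .minus))) ≤
          tw (G.halfEdge e.fst (e.snd, .minus)) :=
      hμ.not_blocks _ (by change ow _ ≠ 0; omega)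
    rw [ho, ht, opp_halfEdge hR e.adj] at hb
    exact hb.imp (fun h => biMatched_of_lt hR hμ e.adj (lt_of_le_of_ne h hne))
      (fun h => biMatched_of_lt hR hμ e.adj.symm (lt_of_le_of_ne h hne'))

/-- Unmatched vertices are assigned their loops, which are their own twins and come after all other
half-edges. -/
theorem exists_stable_of_biStable {tw ow : ℕ → ℕ} (hR : G.toPortGraph.Represents tw ow)
    {M' : Set G.BiEdge} (hM : G.BiStable M') : ∃ μ, hR.toHalfEdges.Stable μ := by
  have hex : ∀ u : Fin n, ∃ h, (∃ v f, G.BiMatched M' u (v, f) ∧ h = G.halfEdge u (v, f)) ∨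
      (¬ ∃ x, G.BiMatched M' u x) ∧ h = 2 * G.toPortGraph.start u + 2 * G.toPortGraph.deg u := by
    intro u
    by_cases h : ∃ x, G.BiMatched M' u x
    · obtain ⟨⟨v, f⟩, h⟩ := h
      exact ⟨_, Or.inl ⟨v, f, h, rfl⟩⟩
    · exact ⟨_, Or.inr ⟨h, rfl⟩⟩
  choose g hg using hex
  have hmatched : ∀ {u v : Fin n} {f : Form}, G.BiMatched M' u (v, f) →
      g u = G.halfEdge u (v, f) := by
    intro u v f h
    rcases hg u with ⟨w, k, hw, he⟩ | ⟨hno, -⟩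
    · rw [he, hM.1.biMatched_unique hw h]
    · exact absurd ⟨_, h⟩ hno
  have howner : ∀ u : Fin n, ow (g u) = u + 1 := by
    intro u
    rcases hg u with ⟨w, k, hw, he⟩ | ⟨-, he⟩
    · rw [he, owner_halfEdge hR hw.adj]
    · rw [he]
      exact hR.owner_eq u _ u.2 le_rfl
  have hlt : ∀ {u v : Fin n} {f : Form} (_ : G.graph.Adj u v), (∃ x, G.BiMatched M' u x ∧
      ListedBefore (G.biPref u) x (v, f)) → g u ≤ G.halfEdge u (v, f) := by
    rintro u v f h ⟨⟨w, k⟩, hw, hl⟩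
    rw [hmatched hw]
    exact ((listedBefore_iff_halfEdge_lt hw.adj h k f).1 hl).le
  have hblock : ∀ {u v : Fin n} (_ : G.graph.Adj u v), g u ≤ G.halfEdge u (v, .minus) ∨
      g v ≤ G.halfEdge v (u, .plus) := by
    intro u v h
    by_cases he : (⟨(u, v), h⟩ : G.BiEdge) ∈ M'
    · exact Or.inl (hmatched ⟨_, he, Or.inl ⟨rfl, rfl⟩⟩).le
    · exact (hM.2 _ he).imp (hlt h) (hlt h.symm)
  -- Half-edge vertices are shifted by one, as `0` owns the unused numbers. The default value `0` is
  -- irrelevant, because `Stable` evaluates `μ` at vertices only.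
  obtain ⟨μ, hμ⟩ : ∃ μ : ℕ → ℕ, ∀ u : Fin n, μ (u + 1) = g u :=
    ⟨fun v => if h : v - 1 < n then g ⟨v - 1, h⟩ else 0, fun u => by simp⟩
  have hvertex : ∀ v, hR.toHalfEdges.IsVertex v → ∃ u : Fin n, v = u + 1 := by
    rintro v ⟨h1, h2⟩
    obtain ⟨u, rfl⟩ := Nat.exists_eq_add_of_le' h1
    exact ⟨⟨u, h2⟩, rfl⟩
  refine ⟨μ, ⟨fun v hv => ?_, fun v hv => ?_, fun h hh => ?_⟩⟩
  · obtain ⟨u, rfl⟩ := hvertex v hv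
    rw [hμ]
    exact howner u
  · obtain ⟨u, rfl⟩ := hvertex v hv
    rw [hμ]
    rcases hg u with ⟨w, k, hw, he⟩ | ⟨-, he⟩
    · rw [he, opp_halfEdge hR hw.adj, hμ, hmatched hw.flip]
      exact twin_halfEdge hR hw.adj k
    · have htw : tw (g u) = g u := by
        rw [he]
        exact hR.twin_last u u.2
      have hop : hR.toHalfEdges.opp (g u) = u + 1 := by
        change ow (tw (g u)) = _
        rw [htw, howner]
      rw [hop, hμ]
      exact htw
  · obtain ⟨u, hu⟩ := hvertex _ (HalfEdges.isVertex_owner hh)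
    rcases eq_last_or_halfEdge hR hu with rfl | ⟨v, f, hadj, rfl⟩
    · left
      rw [hu, hμ]
      rcases hg u with ⟨w, k, hw, he⟩ | ⟨-, he⟩
      · rw [he]
        exact (halfEdge_lt_last hw.adj k).le
      · exact he.le
    · have htw : hR.toHalfEdges.twin (G.halfEdge u (v, f)) = G.halfEdge v (u, f.flip) :=
        twin_halfEdge hR hadj f
      rw [hu, opp_halfEdge hR hadj, htw, hμ, hμ]
      -- A plus half-edge from `u` to `v` is the far side of the dart from `v` to `u`, so the
      -- condition is that of the reversed dart.
      cases f
      · exact (hblock hadj.symm).symm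
      · exact hblock hadj

theorem describes_of_outputs {tw ow : ℕ → ℕ} (hR : G.toPortGraph.Represents tw ow)
    {μ : ℕ → ℕ} (hμ : hR.toHalfEdges.Stable μ) {s : RAM.State}
    (hout : ∀ v, hR.toHalfEdges.IsVertex v → RAM.Outputs hR.toHalfEdges s μ v) :
    G.Describes (fun u => s.output (u + 1)) (G.projection (G.biEdges μ)) := by
  intro u
  have ho : s.output (u + 1) = _ := hout _ (isVertex_succ hR u)
  constructor
  · rintro v ⟨e, he, h⟩
    obtain ⟨f, hf⟩ : ∃ f, G.BiMatched (G.biEdges μ) u (v, f) := by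
      rcases h with ⟨rfl, rfl⟩ | ⟨rfl, rfl⟩
      · exact ⟨_, e, he, Or.inl ⟨rfl, rfl⟩⟩
      · exact ⟨_, e, he, Or.inr ⟨rfl, rfl⟩⟩
    have hne : (v : ℕ) + 1 ≠ u + 1 := fun h => hf.adj.ne (Fin.ext (by omega))
    rw [(biMatched_biEdges_iff hR hμ hf.adj f).1 hf, opp_halfEdge hR hf.adj, if_neg hne] at ho
    exact ho
  · intro hno
    rcases last_or_biMatched hR hμ u with h | ⟨v, f, -, -, e, he, h⟩
    · have hop : hR.toHalfEdges.opp (μ (u + 1)) = u + 1 := by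
        change ow (tw _) = _
        rw [h, hR.twin_last u u.2]
        exact hR.owner_eq u _ u.2 le_rfl
      rw [hop, if_pos rfl] at ho
      exact ho
    · exact absurd ⟨e, he, h.imp And.left And.left⟩ hno

end Roommates

theorem theorem2 :
    -- stable matchings of the bidirected instance project onto strongly dominant matchings
    (∀ (V : Type*) [Finite V] (G : Roommates V),
      (∀ M' : Set G.BiEdge, G.BiStable M' → G.StronglyDominant (G.projection M')) ∧
      (∀ M : G.graph.Subgraph, G.StronglyDominant M →
        ∃ M' : Set G.BiEdge, G.BiStable M' ∧ G.projection M' = M)) ∧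
    -- one program, running in linear time with words of logarithmic length, solves all instances
    (∃ (P : RAM.Prog) (c : ℕ), ∀ (n : ℕ) (G : Roommates (Fin n)),
      ∃ (t : ℕ) (s : RAM.State),
        RAM.Exec (c * (n + G.graph.edgeSet.ncard + 1)) P (RAM.init G.encode) t s ∧
        t ≤ c * (n + G.graph.edgeSet.ncard + 1) ∧
        ((s.output 0 = 1 ∧ ∃ M : G.graph.Subgraph, G.StronglyDominant M ∧
            G.Describes (fun u => s.output (u + 1)) M) ∨
          (s.output 0 = 0 ∧ ¬ ∃ M : G.graph.Subgraph, G.StronglyDominant M))) := by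
  refine ⟨fun V _ G => ⟨fun M' hM => G.stronglyDominant_projection hM,
    fun M hM => G.exists_biStable_of_stronglyDominant hM⟩, RAM.findStronglyDominant, 1600,
    fun n G => ?_⟩
  -- The constant is `1600 = 2 * 730 + 140`, as `start n = 2 + n + 2 m` is at most `2 (n + m + 1)`.
  have hstart : G.toPortGraph.start G.toPortGraph.n = _ := G.start_toPortGraph
  obtain ⟨t, s, hexec, -, ht, tw, ow, hR, hs⟩ := RAM.wp_findStronglyDominant G.isInput_encode
    (W := 1600 * (n + G.graph.edgeSet.ncard + 1)) (s := RAM.init G.encode) (fun _ => rfl)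
    (by simp [RAM.init]) (fun b hb => by simp [RAM.init, hb]) (by omega)
    (G.init_encode_bounded (by rw [G.start_toPortGraph]; omega))
  refine ⟨t, s, hexec, by omega, ?_⟩
  rcases hs with ⟨h0, μ, hμ, hout⟩ | ⟨h0, hno⟩
  · exact Or.inl ⟨h0, _, G.stronglyDominant_projection (Roommates.biStable_biEdges hR hμ),
      Roommates.describes_of_outputs hR hμ hout⟩
  · refine Or.inr ⟨h0, fun ⟨M, hM⟩ => hno ?_⟩
    obtain ⟨M', hM', -⟩ := G.exists_biStable_of_stronglyDominant hM
    exact Roommates.exists_stable_of_biStable hR hM'
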